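/- Let $P$ be a monic complex polynomial of degree $d$ with only simple roots, let $Q$ be a complex polynomial of degree $d-1$ that is nonzero at every root of $P$, and let $R$ be a function holomorphic on the disk $|w|<1/A$ for some $A>0$, so that $R(z^{-1})=\sum_{j\ge 0}R_jz^{-j}$ for $|z|>A$. Put $$\mathcal P=P(\partial_z)+z^{-1}Q(\partial_z)+z^{-2}R(z^{-1}).$$ Let $-\alpha$ be a root of $P$, put $\tau=\tau_\alpha=Q(-\alpha)/P'(-\alpha)$, and assume $\operatorname{Re}\tau>0$. Let $\theta,\omega\in\mathbb R$ with $0<\omega\le\pi$, write $I=(\theta-\omega/2,\theta+\omega/2)$, and let $$\Omega=\{\alpha+re^{i\eta}: r>0,\ \eta\in I\}$$ be the open sector with tip $\alpha$, bisecting direction $\theta$ and opening angle $\omega$. Assume that the closure of $\Omega$ contains no point $\beta\ne\alpha$ with $P(-\beta)=0$. Notation. For $\Lambda>0$ let $\widehat\Omega^\Lambda=\bigcup_{\eta\in I}\{z:\operatorname{Re}(e^{i\eta}z)>\Lambda\}$, and let $\Delta$ be the distance to its boundary. For real $\sigma$, let $\widehat{\mathcal H}^{\sigma}(\widehat\Omega^\Lambda)$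 be the space of holomorphic functions $\Phi$ on $\widehat\Omega^\Lambda$ with $|\Phi|\le C\Delta^{\sigma}$ for some constant $C$, and let $\widehat{\mathcal H}^{\sigma}(\widehat\Omega^\bullet)$ be the colimit of these spaces under restriction as $\Lambda\to\infty$ (functions that agree on $\widehat\Omega^\Lambda$ for some large $\Lambda$ are identified, and $\mathcal P\Psi=0$ means that the equation holds on $\widehat\Omega^\Lambda$ for some large $\Lambda$). Let $\mathcal H^{\sigma}(\Omega)$ be the space of holomorphic functions $\varphi$ on $\Omega$ with $|\varphi|\le C|\zeta-\alpha|^{\sigma}e^{\Lambda|\zeta-\alpha|}$ for some constants $C,\Lambda$. Powers of $\zeta-\alpha$ on $\Omega$ use the branch with $\arg(\zeta-\alpha)\in I$, and powers of $z$ on $\widehat\Omega^\Lambda$ use the branch with $\arg z\in(-\theta-\pi,-\theta+\pi)$. Let $(\partial^{-1}f)(\zeta)=\int_\alpha^\zeta f\,d\zeta'$ along the straight segment. Then: 1. The affine space $$\mathcal A=e^{-\alpha z}\bigl[z^{-\tau}+\widehat{\mathcal H}^{-\operatorname{Re}\tau-1}(\widehat\Omega^\bullet)\bigr]$$ is contained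 in $e^{-\alpha z}\,\widehat{\mathcal H}^{-\operatorname{Re}\tau}(\widehat\Omega^\bullet)$, and the equation $\mathcal P\Psi=0$ has exactly one solution $\Psi_\alpha$ in $\mathcal A$. 2. The Volterra equation $$P(-\zeta)\,\psi+\partial^{-1}\bigl[Q(-\zeta)\,\psi\bigr]+\sum_{j\ge 0}R_j\,\partial^{-2-j}\psi=0\quad\text{on }\Omega$$ (the series being required to converge absolutely at each point of $\Omega$) has exactly one solution $\psi_\alpha$ in $\dfrac{(\zeta-\alpha)^{\tau-1}}{\Gamma(\tau)}+\mathcal H^{\operatorname{Re}\tau}(\Omega)$. 3. $\Psi_\alpha$ is the Laplace transform of $\psi_\alpha$ based at $\alpha$: there is a $\Lambda$ such that, for every $\eta\in I$ and every $z$ with $\operatorname{Re}(e^{i\eta}z)>\Lambda$, the integral $\displaystyle\int_{\alpha+e^{i\eta}[0,\infty)}e^{-z\zeta}\,\psi_\alpha(\zeta)\,d\zeta$ converges absolutely, and these integrals are the values of a representative of $\Psi_\alpha$. -/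

import Mathlib

open Filter Topology Set

noncomputable section

namespace LevelOne

/-- The branch of `w ↦ w ^ s` for which `arg w` is taken in `(θ - π, θ + π]`. -/
def branchPow (θ : ℝ) (s w : ℂ) : ℂ :=
  Complex.exp (s * (Complex.log (Complex.exp (-(θ * Complex.I)) * w) + θ * Complex.I))

/-! ### The differential operator on the frequency domain -/

/-- The polynomial differential operator `S (d/dz)`, applied to `Φ` at `z`. -/
def polyDeriv (S : Polynomial ℂ) (Φ : ℂ → ℂ) (z : ℂ) : ℂ :=
  S.sum fun k a => a * iteratedDeriv k Φ z

/-- The operator `P (d/dz) + z⁻¹ Q (d/dz) + z⁻² R (z⁻¹)`, applied to `Φ` at `z`. -/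
def levelOneOp (P Q : Polynomial ℂ) (R : ℂ → ℂ) (Φ : ℂ → ℂ) (z : ℂ) : ℂ :=
  polyDeriv P Φ z + z⁻¹ * polyDeriv Q Φ z + (z ^ 2)⁻¹ * R z⁻¹ * Φ z

/-- The exponent `τ_α = Q(-α) / P'(-α)` attached to a root `-α` of `P`. -/
def charExponent (P Q : Polynomial ℂ) (α : ℂ) : ℂ :=
  Q.eval (-α) / P.derivative.eval (-α)

/-! ### The position domain -/

/-- The open (unbounded) sector with tip `α`, bisecting direction `θ` and opening angle `ω`. -/
def sector (α : ℂ) (θ ω : ℝ) : Set ℂ :=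
  {ζ | ∃ r : ℝ, 0 < r ∧ ∃ η ∈ Ioo (θ - ω / 2) (θ + ω / 2),
    ζ = α + r * Complex.exp (η * Complex.I)}

/-- Membership in the space of holomorphic functions `φ` on `Ω` for which
`|ζ - α| ^ (-σ) * exp (-Λ |ζ - α|) * |φ|` is bounded on `Ω` for some real `Λ`. -/
def IsSingExp (σ : ℝ) (α : ℂ) (Ω : Set ℂ) (φ : ℂ → ℂ) : Prop :=
  DifferentiableOn ℂ φ Ω ∧
    ∃ Λ C : ℝ, ∀ ζ ∈ Ω, ‖φ ζ‖ ≤ C * ‖ζ - α‖ ^ σ * Real.exp (Λ * ‖ζ - α‖)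

/-- The operator `∂_{ζ,α}⁻¹`: integration from `α` to `ζ` along the straight segment. -/
def integralFrom (α : ℂ) (f : ℂ → ℂ) (ζ : ℂ) : ℂ :=
  ∫ t in (0 : ℝ)..1, f (α + t * (ζ - α)) * (ζ - α)

/-- `ψ` solves `[P(-ζ) + ∂⁻¹ ∘ Q(-ζ) + ∂⁻² ∘ R(∂⁻¹)] ψ = 0` on `Ω`, where `∂⁻¹` is integration
from `α`; here `R(∂⁻¹) = ∑ R_j ∂^{-j}`, where `R_j` are the Taylor coefficients of `R` at `0`. -/
def SolvesVolterra (P Q : Polynomial ℂ) (R : ℂ → ℂ) (α : ℂ) (Ω : Set ℂ) (ψ : ℂ → ℂ) : Prop :=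
  ∀ ζ ∈ Ω,
    HasSum (fun j : ℕ => iteratedDeriv j R 0 / (j.factorial : ℂ) * (integralFrom α)^[j + 2] ψ ζ)
      (-(P.eval (-ζ) * ψ ζ + integralFrom α (fun ξ => Q.eval (-ξ) * ψ ξ) ζ))

/-- Membership in `(ζ - α)^(τ-1) / Γ(τ)` plus the space of functions of order `Re τ` on the sector,
where the power is the branch for which the sector has the arguments `(θ - ω/2, θ + ω/2)`. -/
def InPositionAffine (τ α : ℂ) (θ ω : ℝ) (ψ : ℂ → ℂ) : Prop :=
  IsSingExp τ.re α (sector α θ ω)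
    fun ζ => ψ ζ - branchPow θ (τ - 1) (ζ - α) / Complex.Gamma τ

/-! ### The dual domains and the decay spaces on them -/

/-- The union of the half-planes `Re (e^{iη} z) > Λ` over all angles `η` in the opening of the
sector. -/
def dualDomain (θ ω Λ : ℝ) : Set ℂ :=
  {z | ∃ η ∈ Ioo (θ - ω / 2) (θ + ω / 2), Λ < (Complex.exp (η * Complex.I) * z).re}

/-- The filter generated by the dual domains as `Λ` grows. -/
def dualFilter (θ ω : ℝ) : Filter ℂ := ⨅ Λ : ℝ, 𝓟 (dualDomain θ ω Λ)

/-- Functions on the dual domains, two of them being identified when they agree on the dual domain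
for some large `Λ`. -/
abbrev DualGerm (θ ω : ℝ) : Type := (dualFilter θ ω).Germ ℂ

/-- Membership in the space of holomorphic functions `Φ` on `U` with `|Φ| ≲ Δ ^ σ`, where `Δ` is
the distance to the boundary of `U`. -/
def IsDualSingExp (σ : ℝ) (U : Set ℂ) (Φ : ℂ → ℂ) : Prop :=
  DifferentiableOn ℂ Φ U ∧ ∃ C : ℝ, ∀ z ∈ U, ‖Φ z‖ ≤ C * Metric.infDist z (frontier U) ^ σ

/-- The colimit, as `Λ` grows, of the spaces of holomorphic functions of decay order `σ` on the dual
domains. -/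
def dualSpace (σ θ ω : ℝ) : Set (DualGerm θ ω) :=
  {G | ∃ Λ : ℝ, 0 < Λ ∧ ∃ Φ : ℂ → ℂ, IsDualSingExp σ (dualDomain θ ω Λ) Φ ∧
    G = (Φ : DualGerm θ ω)}

/-- The exponential factor `e^{-αz}`. -/
def expFactor (α : ℂ) (θ ω : ℝ) : DualGerm θ ω :=
  ((fun z : ℂ => Complex.exp (-(α * z)) : ℂ → ℂ) : DualGerm θ ω)

/-- The power `z ^ s`, with the branch for which `arg z` is in `(-θ - π, -θ + π]`. -/
def powGerm (s : ℂ) (θ ω : ℝ) : DualGerm θ ω :=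
  ((fun z : ℂ => branchPow (-θ) s z : ℂ → ℂ) : DualGerm θ ω)

/-- The affine space `e^{-αz} [z^{-τ} + (the decay space of order -Re τ - 1)]`. -/
def frequencyAffine (τ α : ℂ) (θ ω : ℝ) : Set (DualGerm θ ω) :=
  {G | ∃ H ∈ dualSpace (-τ.re - 1) θ ω, G = expFactor α θ ω * (powGerm (-τ) θ ω + H)}

/-- The space `e^{-αz} (the decay space of order σ)`. -/
def expDualSpace (σ : ℝ) (α : ℂ) (θ ω : ℝ) : Set (DualGerm θ ω) :=
  {G | ∃ H ∈ dualSpace σ θ ω, G = expFactor α θ ω * H}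

/-- The germ `G` is represented by a function that satisfies the differential equation on the dual
domain for some large `Λ`. -/
def SolvesODE (P Q : Polynomial ℂ) (R : ℂ → ℂ) {θ ω : ℝ} (G : DualGerm θ ω) : Prop :=
  ∃ Φ : ℂ → ℂ, G = (Φ : DualGerm θ ω) ∧ ∀ᶠ z in dualFilter θ ω, levelOneOp P Q R Φ z = 0

/-! ### The Laplace transform -/

/-- The integrand, in the arc length `r`, of the Laplace transform along the ray from `α` in
direction `η`. -/
def laplaceIntegrand (α : ℂ) (η : ℝ) (ψ : ℂ → ℂ) (z : ℂ) (r : ℝ) : ℂ :=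
  Complex.exp (-(z * (α + r * Complex.exp (η * Complex.I)))) *
    ψ (α + r * Complex.exp (η * Complex.I)) * Complex.exp (η * Complex.I)

/-- `Ψ` is the Laplace transform of `ψ` based at `α`: for some `Λ` and all angles `η` in the opening
of the sector, the integral of `e^{-zζ} ψ dζ` along the ray from `α` in direction `η` converges
absolutely to `Ψ` on the half-plane `Re (e^{iη} z) > Λ`. -/
def IsLaplaceTransform (α : ℂ) (θ ω : ℝ) (ψ Ψ : ℂ → ℂ) : Prop :=
  ∃ Λ : ℝ, ∀ η ∈ Ioo (θ - ω / 2) (θ + ω / 2), ∀ z : ℂ,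
    Λ < (Complex.exp (η * Complex.I) * z).re →
      MeasureTheory.IntegrableOn (laplaceIntegrand α η ψ z) (Ioi 0) ∧
        Ψ z = ∫ r in Ioi (0 : ℝ), laplaceIntegrand α η ψ z r

end LevelOne

end

/-!
Write `P = (X + α) P₁` and `Q = τ P₁ + (X + α) S` with `deg S < deg P`, and put `ξ = ζ - α`. On the
sector `1 / P₁(-ζ)` and `S(-ζ) / P₁(-ζ)` are bounded, because the other points `β` with
`P(-β) = 0` stay away from its closure.

*Position domain.* The Volterra equation for `ψ` has a regular singularity at the tip. The
substitution `ψ = ξ^τ y / P(-ζ)` removes it: the part `P(-ζ) ψ + τ ∂⁻¹[P₁(-ζ) ψ]` is integrated by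
the factor `ξ^τ`, and what remains is `y = y₀ - ∂⁻¹ N y` with an operator `N` that is bounded in the
norms `sup |y| e^{-Λ|ξ|}`. Since `∂⁻¹` has norm `1 / Λ` there, this is a contraction for large `Λ`.
The constant `y₀ = -P₁(-α) / Γ(τ)` encodes the leading term `ξ^(τ-1) / Γ(τ)`, and every solution in
the affine space has to arise in this way, which gives existence (`exists_solvesVolterra`) and
uniqueness (`eqOn_of_solvesVolterra`).

*Laplace transform.* Along a ray from `α`, the Laplace transform turns multiplication by `-ζ` into
`d/dz` and `∂⁻¹` into `z⁻¹`; the boundary terms vanish as `Re τ > 0`. So it turns the Volterra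
equation into the differential equation (`levelOneOp_sectorLaplace`). Rotating the ray does not
change the value (`rayLaplace_eq`), and the transform of `ξ^(τ-1) / Γ(τ)` is `e^{-αz} z^{-τ}`; since
the distance to the boundary of the dual domain is comparable to the best value of
`Re (e^{iη} z) - Λ`, the transform of `ψ` lies in the affine space on the frequency domain
(`sectorLaplace_mem_frequencyAffine`).

*Uniqueness on the frequency domain.* The difference `δ` of two solutions is
`O(m^(-Re τ - 1)) e^{-αz}` with `m = Re (e^{iθ} z)`, on one half-plane. There `P₁(d/dz)` can be
inverted on such functions, factor by factor: for each root `-β` of `P₁`, the factor `e^{(β - α) z}`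
decays in some direction that does not leave the half-plane, because `β` is not on the ray from `α`
in direction `θ`. The equation reads `(d/dz + α) G + (τ / z) G = …` with `G = P₁(d/dz) δ`, where the
right-hand side gains a power of `m`, and integration to infinity with the factor
`e^{αz} z^τ` recovers `G` with a constant that is small deep in the half-plane
(`norm_polyDeriv_le_half`). Hence `δ = 0` there (`exists_eq_zero_of_levelOneOp`), and on the whole
dual domain by the identity theorem.
-/

namespace LevelOne

/-! ### Sectors and branches of powers -/

/-- A point of an open sector of opening at most `π` is recognised by two strict linear
inequalities; openness and convexity of the sector are read off from them. -/
theorem mem_sector_iff {α : ℂ} {θ ω : ℝ} (hω : 0 < ω) (hωπ : ω ≤ Real.pi) {ζ : ℂ} :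
    ζ ∈ sector α θ ω ↔
      0 < (Complex.exp ((-θ + ω / 2 : ℝ) * Complex.I) * (ζ - α)).im ∧
        (Complex.exp ((-θ - ω / 2 : ℝ) * Complex.I) * (ζ - α)).im < 0 := by
  have key : ∀ (r x y : ℝ), (Complex.exp (x * Complex.I) * (r * Complex.exp (y * Complex.I))).im =
      r * Real.sin (x + y) := by
    intro r x y
    rw [mul_left_comm, ← Complex.exp_add, ← add_mul, ← Complex.ofReal_add, Complex.im_ofReal_mul,
      Complex.exp_ofReal_mul_I_im]
  constructor
  · rintro ⟨r, hr, η, ⟨h1, h2⟩, rfl⟩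
    rw [add_sub_cancel_left, key, key]
    constructor
    · exact mul_pos hr (Real.sin_pos_of_pos_of_lt_pi (by linarith) (by linarith))
    · exact mul_neg_of_pos_of_neg hr (Real.sin_neg_of_neg_of_neg_pi_lt (by linarith) (by linarith))
  · rintro ⟨h1, h2⟩
    set v := Complex.exp ((-θ : ℝ) * Complex.I) * (ζ - α) with hv
    have hz : ζ - α = Complex.exp (θ * Complex.I) * v := by
      rw [hv, ← mul_assoc, ← Complex.exp_add]
      simp
    have hpol : ζ - α = (‖v‖ : ℝ) * Complex.exp ((θ + v.arg : ℝ) * Complex.I) := by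
      rw [hz]
      conv_lhs => rw [← Complex.norm_mul_exp_arg_mul_I v]
      rw [mul_left_comm, ← Complex.exp_add]
      push_cast
      ring_nf
    rw [hpol, key] at h1 h2
    have hv0 : 0 < ‖v‖ := by
      rcases (norm_nonneg v).lt_or_eq with h | h
      · exact h
      · rw [← h] at h1; simp at h1
    have s1 : 0 < Real.sin (-θ + ω / 2 + (θ + v.arg)) := pos_of_mul_pos_right h1 hv0.le
    have s2 : Real.sin (-θ - ω / 2 + (θ + v.arg)) < 0 := by
      by_contra! h
      exact absurd h2 (not_lt.2 (mul_nonneg hv0.le h))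
    have a1 := Complex.neg_pi_lt_arg v
    have a2 := Complex.arg_le_pi v
    refine ⟨‖v‖, hv0, θ + v.arg, ⟨?_, ?_⟩, by rw [← hpol]; ring⟩
    · by_contra! h
      exact absurd s1 (not_lt.2 (Real.sin_nonpos_of_nonpos_of_neg_pi_le (by linarith) (by linarith)))
    · by_contra! h
      exact absurd s2 (not_lt.2 (Real.sin_nonneg_of_nonneg_of_le_pi (by linarith) (by linarith)))

theorem isOpen_sector {α : ℂ} {θ ω : ℝ} (hω : 0 < ω) (hωπ : ω ≤ Real.pi) :
    IsOpen (sector α θ ω) := by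
  have : sector α θ ω = {ζ | 0 < (Complex.exp ((-θ + ω / 2 : ℝ) * Complex.I) * (ζ - α)).im} ∩
      {ζ | (Complex.exp ((-θ - ω / 2 : ℝ) * Complex.I) * (ζ - α)).im < 0} := by
    ext ζ; exact mem_sector_iff hω hωπ
  rw [this]
  exact (isOpen_lt (by fun_prop) (by fun_prop)).inter (isOpen_lt (by fun_prop) (by fun_prop))

theorem convex_sector {α : ℂ} {θ ω : ℝ} (hω : 0 < ω) (hωπ : ω ≤ Real.pi) :
    Convex ℝ (sector α θ ω) := by
  intro x hx y hy a b ha hb hab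
  rw [mem_sector_iff hω hωπ] at hx hy ⊢
  have hsplit : ∀ e : ℂ, (e * (a • x + b • y - α)).im =
      a * (e * (x - α)).im + b * (e * (y - α)).im := by
    intro e
    have : e * (a • x + b • y - α) = (a : ℂ) * (e * (x - α)) + (b : ℂ) * (e * (y - α)) := by
      have h1 : (a : ℂ) + b = 1 := by exact_mod_cast hab
      simp only [Complex.real_smul]
      linear_combination (e * α) * h1
    rw [this, Complex.add_im, Complex.im_ofReal_mul, Complex.im_ofReal_mul]
  rw [hsplit, hsplit]
  rcases ha.lt_or_eq with h | h
  · exact ⟨by nlinarith [mul_pos h hx.1, mul_nonneg hb hy.1.le],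
      by nlinarith [mul_pos h (neg_pos.2 hx.2), mul_nonneg hb (neg_pos.2 hy.2).le]⟩
  · have hb1 : b = 1 := by linarith
    subst h; subst hb1
    simpa using hy

theorem sector_scale {α : ℂ} {θ ω : ℝ} {ζ : ℂ} (hζ : ζ ∈ sector α θ ω) {t : ℝ} (ht : 0 < t) :
    α + t * (ζ - α) ∈ sector α θ ω := by
  obtain ⟨r, hr, η, hη, rfl⟩ := hζ
  exact ⟨t * r, mul_pos ht hr, η, hη, by push_cast; ring⟩

theorem sector_sub_ne_zero {α : ℂ} {θ ω : ℝ} {ζ : ℂ} (hζ : ζ ∈ sector α θ ω) : ζ - α ≠ 0 := by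
  obtain ⟨r, hr, η, hη, rfl⟩ := hζ
  rw [add_sub_cancel_left]
  exact mul_ne_zero (by exact_mod_cast hr.ne') (Complex.exp_ne_zero _)

theorem sector_norm_sub_pos {α : ℂ} {θ ω : ℝ} {ζ : ℂ} (hζ : ζ ∈ sector α θ ω) : 0 < ‖ζ - α‖ :=
  norm_pos_iff.2 (sector_sub_ne_zero hζ)

theorem ray_mem_sector {α : ℂ} {θ ω η : ℝ} (hη : η ∈ Ioo (θ - ω / 2) (θ + ω / 2)) {r : ℝ}
    (hr : 0 < r) : α + r * Complex.exp (η * Complex.I) ∈ sector α θ ω :=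
  ⟨r, hr, η, hη, rfl⟩

theorem norm_ray_sub (α : ℂ) (η : ℝ) {r : ℝ} (hr : 0 ≤ r) :
    ‖α + r * Complex.exp (η * Complex.I) - α‖ = r := by
  rw [add_sub_cancel_left, norm_mul, Complex.norm_exp_ofReal_mul_I, mul_one, Complex.norm_real,
    Real.norm_of_nonneg hr]

/-- The branch of the logarithm that belongs to `branchPow θ`. -/
noncomputable def branchLog (θ : ℝ) (w : ℂ) : ℂ :=
  Complex.log (Complex.exp (-(θ * Complex.I)) * w) + θ * Complex.I

theorem branchPow_eq (θ : ℝ) (s w : ℂ) : branchPow θ s w = Complex.exp (s * branchLog θ w) := rfl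

theorem exp_branchLog (θ : ℝ) {w : ℂ} (hw : w ≠ 0) : Complex.exp (branchLog θ w) = w := by
  rw [branchLog, Complex.exp_add, Complex.exp_log (mul_ne_zero (Complex.exp_ne_zero _) hw),
    mul_right_comm, ← Complex.exp_add]
  simp

theorem branchLog_re (θ : ℝ) (w : ℂ) : (branchLog θ w).re = Real.log ‖w‖ := by
  rw [branchLog, Complex.add_re, Complex.log_re, norm_mul, Complex.norm_exp]
  simp

theorem abs_branchLog_im_le (θ : ℝ) (w : ℂ) : |(branchLog θ w).im| ≤ Real.pi + |θ| := by
  rw [branchLog, Complex.add_im, Complex.log_im]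
  refine (abs_add_le _ _).trans (add_le_add (Complex.abs_arg_le_pi _) ?_)
  simp

theorem branchPow_add (θ : ℝ) (s t w : ℂ) :
    branchPow θ (s + t) w = branchPow θ s w * branchPow θ t w := by
  rw [branchPow_eq, branchPow_eq, branchPow_eq, add_mul, Complex.exp_add]

theorem branchPow_one (θ : ℝ) {w : ℂ} (hw : w ≠ 0) : branchPow θ 1 w = w := by
  rw [branchPow_eq, one_mul, exp_branchLog θ hw]

theorem branchPow_neg_mul_self (θ : ℝ) (s w : ℂ) : branchPow θ (-s) w * branchPow θ s w = 1 := by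
  rw [← branchPow_add]
  simp [branchPow_eq]

theorem branchPow_sub_one_mul (θ : ℝ) (s : ℂ) {w : ℂ} (hw : w ≠ 0) :
    branchPow θ (s - 1) w * w = branchPow θ s w := by
  have h := branchPow_add θ (s - 1) 1 w
  rwa [sub_add_cancel, branchPow_one θ hw, eq_comm] at h

/-- The constant that compares `|w ^ s|` with `|w| ^ Re s`. -/
noncomputable def branchConst (θ : ℝ) (s : ℂ) : ℝ := Real.exp (|s.im| * (Real.pi + |θ|))

theorem one_le_branchConst (θ : ℝ) (s : ℂ) : 1 ≤ branchConst θ s :=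
  Real.one_le_exp (by positivity)

theorem branchConst_neg (θ : ℝ) (s : ℂ) : branchConst θ (-s) = branchConst θ s := by
  simp [branchConst]

theorem norm_branchPow_le (θ : ℝ) (s : ℂ) {w : ℂ} (hw : w ≠ 0) :
    ‖branchPow θ s w‖ ≤ branchConst θ s * ‖w‖ ^ s.re := by
  rw [branchPow_eq, Complex.norm_exp, Complex.mul_re, branchLog_re,
    Real.rpow_def_of_pos (norm_pos_iff.2 hw), branchConst, ← Real.exp_add]
  apply Real.exp_le_exp.2
  have h1 : -(s.im * (branchLog θ w).im) ≤ |s.im| * (Real.pi + |θ|) := by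
    refine (neg_le_abs _).trans ?_
    rw [abs_mul]
    exact mul_le_mul_of_nonneg_left (abs_branchLog_im_le θ w) (abs_nonneg _)
  linarith

theorem hasDerivAt_branchPow (θ : ℝ) (s : ℂ) {w : ℂ}
    (hw : Complex.exp (-(θ * Complex.I)) * w ∈ Complex.slitPlane) :
    HasDerivAt (branchPow θ s) (s / w * branchPow θ s w) w := by
  have hw0 : w ≠ 0 := by
    rintro rfl; simp at hw
  have h1 : HasDerivAt (fun w => Complex.exp (-(θ * Complex.I)) * w)
      (Complex.exp (-(θ * Complex.I))) w := by
    simpa using (hasDerivAt_id w).const_mul (Complex.exp (-(θ * Complex.I)))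
  have h2 := (((h1.clog hw).add_const (θ * Complex.I)).const_mul s).cexp
  refine (h2.congr_deriv ?_)
  rw [branchPow_eq, branchLog]
  have := Complex.exp_ne_zero (-(θ * Complex.I))
  field_simp

theorem branchLog_polar {θ η r : ℝ} (hr : 0 < r) (hη : |η - θ| < Real.pi) :
    branchLog θ (r * Complex.exp (η * Complex.I)) = Real.log r + η * Complex.I := by
  have h : Complex.exp (-(θ * Complex.I)) * (r * Complex.exp (η * Complex.I)) =
      r * Complex.exp ((η - θ : ℝ) * Complex.I) := by
    rw [mul_left_comm, ← Complex.exp_add]; push_cast; ring_nf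
  rw [abs_lt] at hη
  have h3 : Complex.log (Complex.exp ((η - θ : ℝ) * Complex.I)) = (η - θ : ℝ) * Complex.I := by
    apply Complex.log_exp <;> simp <;> linarith
  rw [branchLog, h, Complex.log_ofReal_mul hr (Complex.exp_ne_zero _), h3]
  push_cast; ring

theorem sector_rotate_mem_slitPlane {α : ℂ} {θ ω : ℝ} (hωπ : ω ≤ Real.pi) {ζ : ℂ}
    (hζ : ζ ∈ sector α θ ω) : Complex.exp (-(θ * Complex.I)) * (ζ - α) ∈ Complex.slitPlane := by
  obtain ⟨r, hr, η, ⟨h1, h2⟩, rfl⟩ := hζ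
  have h : Complex.exp (-(θ * Complex.I)) * (α + r * Complex.exp (η * Complex.I) - α) =
      r * Complex.exp ((η - θ : ℝ) * Complex.I) := by
    rw [add_sub_cancel_left, mul_left_comm, ← Complex.exp_add]; push_cast; ring_nf
  rw [h]
  left
  rw [Complex.re_ofReal_mul, Complex.exp_ofReal_mul_I_re]
  exact mul_pos hr (Real.cos_pos_of_mem_Ioo ⟨by linarith, by linarith⟩)

theorem hasDerivAt_branchPow_sub {α : ℂ} {θ ω : ℝ} (hωπ : ω ≤ Real.pi) (s : ℂ) {ζ : ℂ}
    (hζ : ζ ∈ sector α θ ω) :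
    HasDerivAt (fun ζ => branchPow θ s (ζ - α))
      (s / (ζ - α) * branchPow θ s (ζ - α)) ζ := by
  have h := (hasDerivAt_branchPow θ s (sector_rotate_mem_slitPlane hωπ hζ)).comp ζ
    ((hasDerivAt_id ζ).sub_const α)
  rw [mul_one] at h
  exact h

/-! ### Holomorphic functions of a given order on the sector, and integration from its tip -/

/-- The quantitative form of `IsSingExp`: `f` is holomorphic on `Ω` and
`|f| ≤ M |ζ - α| ^ σ exp (Λ |ζ - α|)` there. -/
structure SingExpWith (σ Λ M : ℝ) (α : ℂ) (Ω : Set ℂ) (f : ℂ → ℂ) : Prop where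
  diff : DifferentiableOn ℂ f Ω
  bound : ∀ ζ ∈ Ω, ‖f ζ‖ ≤ M * ‖ζ - α‖ ^ σ * Real.exp (Λ * ‖ζ - α‖)

section sector

variable {α : ℂ} {θ ω σ Λ M σ' Λ' M' : ℝ} {f g : ℂ → ℂ}

namespace SingExpWith

theorem add (hf : SingExpWith σ Λ M α (sector α θ ω) f)
    (hg : SingExpWith σ Λ M' α (sector α θ ω) g) :
    SingExpWith σ Λ (M + M') α (sector α θ ω) (fun ζ => f ζ + g ζ) :=
  ⟨hf.diff.add hg.diff, fun ζ hζ => (norm_add_le _ _).trans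
    ((add_le_add (hf.bound ζ hζ) (hg.bound ζ hζ)).trans_eq (by ring))⟩

theorem sub (hf : SingExpWith σ Λ M α (sector α θ ω) f)
    (hg : SingExpWith σ Λ M' α (sector α θ ω) g) :
    SingExpWith σ Λ (M + M') α (sector α θ ω) (fun ζ => f ζ - g ζ) :=
  ⟨hf.diff.sub hg.diff, fun ζ hζ => (norm_sub_le _ _).trans
    ((add_le_add (hf.bound ζ hζ) (hg.bound ζ hζ)).trans_eq (by ring))⟩

theorem mul (hM : 0 ≤ M) (hf : SingExpWith σ Λ M α (sector α θ ω) f)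
    (hg : SingExpWith σ' Λ' M' α (sector α θ ω) g) :
    SingExpWith (σ + σ') (Λ + Λ') (M * M') α (sector α θ ω) (fun ζ => f ζ * g ζ) := by
  refine ⟨hf.diff.mul hg.diff, fun ζ hζ => ?_⟩
  have h0 := sector_norm_sub_pos hζ
  rw [norm_mul, Real.rpow_add h0, add_mul, Real.exp_add]
  exact (mul_le_mul (hf.bound ζ hζ) (hg.bound ζ hζ) (norm_nonneg _) (by positivity)).trans_eq
    (by ring)

theorem mono (hM : 0 ≤ M) (hMM : M ≤ M') (hΛ : Λ ≤ Λ')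
    (hf : SingExpWith σ Λ M α (sector α θ ω) f) :
    SingExpWith σ Λ' M' α (sector α θ ω) f := by
  refine ⟨hf.diff, fun ζ hζ => (hf.bound ζ hζ).trans ?_⟩
  have h0 := sector_norm_sub_pos hζ
  have hM' : 0 ≤ M' := hM.trans hMM
  gcongr

theorem congr (hf : SingExpWith σ Λ M α (sector α θ ω) f) (h : EqOn g f (sector α θ ω)) :
    SingExpWith σ Λ M α (sector α θ ω) g :=
  ⟨hf.diff.congr h, fun ζ hζ => by rw [h hζ]; exact hf.bound ζ hζ⟩

/-- A factor `ζ - α` may be absorbed into the exponential. -/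
theorem lower (hM : 0 ≤ M) (hf : SingExpWith (σ + 1) Λ M α (sector α θ ω) f) :
    SingExpWith σ (Λ + 1) M α (sector α θ ω) f := by
  refine ⟨hf.diff, fun ζ hζ => (hf.bound ζ hζ).trans ?_⟩
  have h0 := sector_norm_sub_pos hζ
  rw [Real.rpow_add h0, Real.rpow_one, add_mul, Real.exp_add, one_mul]
  have h1 : ‖ζ - α‖ ≤ Real.exp ‖ζ - α‖ := by linarith [Real.add_one_le_exp ‖ζ - α‖]
  calc M * (‖ζ - α‖ ^ σ * ‖ζ - α‖) * Real.exp (Λ * ‖ζ - α‖)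
      ≤ M * (‖ζ - α‖ ^ σ * Real.exp ‖ζ - α‖) * Real.exp (Λ * ‖ζ - α‖) := by gcongr
    _ = _ := by ring

theorem const_mul (hf : SingExpWith σ Λ M α (sector α θ ω) f) (c : ℂ) :
    SingExpWith σ Λ (‖c‖ * M) α (sector α θ ω) (fun ζ => c * f ζ) :=
  ⟨hf.diff.const_mul c, fun ζ hζ => by
    rw [norm_mul]
    exact (mul_le_mul_of_nonneg_left (hf.bound ζ hζ) (norm_nonneg c)).trans_eq (by ring)⟩

theorem isSingExp (hf : SingExpWith σ Λ M α (sector α θ ω) f) :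
    IsSingExp σ α (sector α θ ω) f := ⟨hf.diff, Λ, M, hf.bound⟩

end SingExpWith

theorem IsSingExp.exists_singExpWith (hf : IsSingExp σ α (sector α θ ω) f) :
    ∃ Λ₀ M : ℝ, 0 ≤ Λ₀ ∧ 0 ≤ M ∧ ∀ Λ, Λ₀ ≤ Λ → SingExpWith σ Λ M α (sector α θ ω) f := by
  obtain ⟨hd, Λ, C, h⟩ := hf
  refine ⟨|Λ|, |C|, abs_nonneg _, abs_nonneg _, fun Λ' hΛ' => ⟨hd, fun ζ hζ => (h ζ hζ).trans ?_⟩⟩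
  have h0 := sector_norm_sub_pos hζ
  have h1 := le_abs_self C
  have h2 := (le_abs_self Λ).trans hΛ'
  gcongr

/-- `∂⁻¹ f` on the ray through `ζ`, as an integral with variable end point. -/
theorem integralFrom_ray (α ξ : ℂ) (f : ℂ → ℂ) (s : ℝ) :
    integralFrom α f (α + s * ξ) = ∫ t in (0 : ℝ)..s, f (α + t * ξ) * ξ := by
  have h := intervalIntegral.smul_integral_comp_mul_right (a := 0) (b := 1)
    (fun t : ℝ => f (α + t * ξ) * ξ) s
  rw [zero_mul, one_mul] at h
  rw [← h, integralFrom, ← intervalIntegral.integral_smul]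
  congr 1
  ext t
  simp only [add_sub_cancel_left, Complex.real_smul]
  push_cast
  rw [mul_assoc (t : ℂ)]
  ring

theorem SingExpWith.norm_segment_le (hf : SingExpWith σ Λ M α (sector α θ ω) f) {ζ : ℂ}
    (hζ : ζ ∈ sector α θ ω) {t : ℝ} (ht : 0 < t) :
    ‖f (α + t * (ζ - α)) * (ζ - α)‖ ≤
      M * (t * ‖ζ - α‖) ^ σ * Real.exp (Λ * (t * ‖ζ - α‖)) * ‖ζ - α‖ := by
  have h := hf.bound _ (sector_scale hζ ht)
  rw [add_sub_cancel_left, norm_mul, Complex.norm_real, Real.norm_of_nonneg ht.le] at h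
  rw [norm_mul]
  gcongr

theorem intervalIntegrable_rpow_mul_exp (hσ : -1 < σ) (Λ r a b : ℝ) :
    IntervalIntegrable (fun t : ℝ => t ^ σ * Real.exp (Λ * (t * r))) MeasureTheory.volume a b :=
  (intervalIntegral.intervalIntegrable_rpow' hσ).mul_continuousOn (by fun_prop)

theorem SingExpWith.intervalIntegrable (hσ : -1 < σ) (hf : SingExpWith σ Λ M α (sector α θ ω) f)
    {ζ : ℂ} (hζ : ζ ∈ sector α θ ω) {s : ℝ} (hs : 0 ≤ s) :
    IntervalIntegrable (fun t : ℝ => f (α + t * (ζ - α)) * (ζ - α)) MeasureTheory.volume 0 s := by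
  have h0 := sector_norm_sub_pos hζ
  have hg := (intervalIntegrable_rpow_mul_exp hσ Λ ‖ζ - α‖ 0 s).const_mul
    (M * ‖ζ - α‖ ^ σ * ‖ζ - α‖)
  refine hg.mono_fun' ?_ ?_
  · rw [uIoc_of_le hs]
    refine ContinuousOn.aestronglyMeasurable ?_ measurableSet_Ioc
    refine ContinuousOn.mul (hf.diff.continuousOn.comp (by fun_prop) ?_) continuousOn_const
    exact fun t ht => sector_scale hζ ht.1
  · rw [uIoc_of_le hs]
    refine (MeasureTheory.ae_restrict_iff' measurableSet_Ioc).2 (Eventually.of_forall fun t ht => ?_)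
    refine (hf.norm_segment_le hζ ht.1).trans_eq ?_
    rw [Real.mul_rpow ht.1.le h0.le]
    ring

theorem integralFrom_congr (h : EqOn f g (sector α θ ω)) :
    EqOn (integralFrom α f) (integralFrom α g) (sector α θ ω) := by
  intro ζ hζ
  refine intervalIntegral.integral_congr_ae (Eventually.of_forall fun t ht => ?_)
  rw [uIoc_of_le zero_le_one] at ht
  rw [h (sector_scale hζ ht.1)]

theorem integralFrom_const_mul (c : ℂ) (f : ℂ → ℂ) (ζ : ℂ) :
    integralFrom α (fun ξ => c * f ξ) ζ = c * integralFrom α f ζ := by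
  simp only [integralFrom, mul_assoc]
  exact intervalIntegral.integral_const_mul _ _

theorem integralFrom_add (hσ : -1 < σ) (hσ' : -1 < σ')
    (hf : SingExpWith σ Λ M α (sector α θ ω) f)
    (hg : SingExpWith σ' Λ' M' α (sector α θ ω) g) {ζ : ℂ} (hζ : ζ ∈ sector α θ ω) :
    integralFrom α (fun ξ => f ξ + g ξ) ζ = integralFrom α f ζ + integralFrom α g ζ := by
  simp only [integralFrom, add_mul]
  exact intervalIntegral.integral_add (hf.intervalIntegrable hσ hζ zero_le_one)
    (hg.intervalIntegrable hσ' hζ zero_le_one)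

theorem integralFrom_sub (hσ : -1 < σ) (hσ' : -1 < σ')
    (hf : SingExpWith σ Λ M α (sector α θ ω) f)
    (hg : SingExpWith σ' Λ' M' α (sector α θ ω) g) {ζ : ℂ} (hζ : ζ ∈ sector α θ ω) :
    integralFrom α (fun ξ => f ξ - g ξ) ζ = integralFrom α f ζ - integralFrom α g ζ := by
  simp only [integralFrom, sub_mul]
  exact intervalIntegral.integral_sub (hf.intervalIntegrable hσ hζ zero_le_one)
    (hg.intervalIntegrable hσ' hζ zero_le_one)

theorem norm_integralFrom_le (hσ : -1 < σ) (hΛ : 0 ≤ Λ) (hM : 0 ≤ M)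
    (hf : SingExpWith σ Λ M α (sector α θ ω) f) {ζ : ℂ} (hζ : ζ ∈ sector α θ ω) :
    ‖integralFrom α f ζ‖ ≤ M / (σ + 1) * ‖ζ - α‖ ^ (σ + 1) * Real.exp (Λ * ‖ζ - α‖) := by
  have h0 := sector_norm_sub_pos hζ
  set c := M * ‖ζ - α‖ ^ (σ + 1) * Real.exp (Λ * ‖ζ - α‖) with hc
  have hint : IntervalIntegrable (fun t : ℝ => c * t ^ σ) MeasureTheory.volume 0 1 :=
    (intervalIntegral.intervalIntegrable_rpow' hσ).const_mul c
  refine (intervalIntegral.norm_integral_le_of_norm_le zero_le_one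
    (Eventually.of_forall fun t ht => ?_) hint).trans_eq ?_
  · refine (hf.norm_segment_le hζ ht.1).trans ?_
    rw [Real.mul_rpow ht.1.le h0.le, hc, Real.rpow_add h0, Real.rpow_one]
    have h1 : Λ * (t * ‖ζ - α‖) ≤ Λ * ‖ζ - α‖ :=
      mul_le_mul_of_nonneg_left (mul_le_of_le_one_left h0.le ht.2) hΛ
    have h2 : 0 ≤ t ^ σ := Real.rpow_nonneg ht.1.le _
    calc M * (t ^ σ * ‖ζ - α‖ ^ σ) * Real.exp (Λ * (t * ‖ζ - α‖)) * ‖ζ - α‖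
        ≤ M * (t ^ σ * ‖ζ - α‖ ^ σ) * Real.exp (Λ * ‖ζ - α‖) * ‖ζ - α‖ := by gcongr
      _ = _ := by ring
  · rw [intervalIntegral.integral_const_mul, integral_rpow (Or.inl hσ)]
    have : σ + 1 ≠ 0 := by linarith
    rw [Real.zero_rpow this, Real.one_rpow, hc]
    ring

theorem norm_integralFrom_le' (hσ : 0 ≤ σ) (hΛ : 0 < Λ) (hM : 0 ≤ M)
    (hf : SingExpWith σ Λ M α (sector α θ ω) f) {ζ : ℂ} (hζ : ζ ∈ sector α θ ω) :
    ‖integralFrom α f ζ‖ ≤ M / Λ * ‖ζ - α‖ ^ σ * Real.exp (Λ * ‖ζ - α‖) := by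
  have h0 := sector_norm_sub_pos hζ
  set c := M * ‖ζ - α‖ ^ σ with hc
  have hd : ∀ t ∈ uIcc (0 : ℝ) 1, HasDerivAt (fun t : ℝ => c / Λ * Real.exp (Λ * (t * ‖ζ - α‖)))
      (c * Real.exp (Λ * (t * ‖ζ - α‖)) * ‖ζ - α‖) t := by
    intro t _
    have := ((((hasDerivAt_id t).mul_const ‖ζ - α‖).const_mul Λ).exp).const_mul (c / Λ)
    refine this.congr_deriv ?_
    simp only [id]
    field_simp
  have hint : IntervalIntegrable (fun t : ℝ => c * Real.exp (Λ * (t * ‖ζ - α‖)) * ‖ζ - α‖)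
      MeasureTheory.volume 0 1 := by
    apply Continuous.intervalIntegrable; fun_prop
  refine (intervalIntegral.norm_integral_le_of_norm_le zero_le_one
    (Eventually.of_forall fun t ht => ?_) hint).trans ?_
  · refine (hf.norm_segment_le hζ ht.1).trans ?_
    have h1 : (t * ‖ζ - α‖) ^ σ ≤ ‖ζ - α‖ ^ σ :=
      Real.rpow_le_rpow (mul_nonneg ht.1.le h0.le) (mul_le_of_le_one_left h0.le ht.2) hσ
    rw [hc]
    gcongr
  · rw [intervalIntegral.integral_eq_sub_of_hasDerivAt hd hint]
    have : 0 ≤ c / Λ := by positivity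
    rw [one_mul, zero_mul, mul_zero, Real.exp_zero, hc]
    have e : M / Λ * ‖ζ - α‖ ^ σ = c / Λ := by rw [hc]; ring
    rw [e, ← hc]
    linarith

/-- `∂⁻¹ f` is a primitive of `f` on the sector. -/
theorem hasDerivAt_integralFrom (hω : 0 < ω) (hωπ : ω ≤ Real.pi) (hσ : -1 < σ) (hM : 0 ≤ M)
    (hf : SingExpWith σ Λ M α (sector α θ ω) f) {ζ : ℂ} (hζ : ζ ∈ sector α θ ω) :
    HasDerivAt (integralFrom α f) (f ζ) ζ := by
  have hopen : IsOpen (sector α θ ω) := isOpen_sector hω hωπ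
  have h0 := sector_norm_sub_pos hζ
  obtain ⟨ρ, hρ, hball⟩ := Metric.nhds_basis_closedBall.mem_iff.1 (hopen.mem_nhds hζ)
  -- A uniform bound for the integrand near `ζ`, with the singularity `t ^ σ` at the tip split off.
  have hcont : ContinuousOn (fun ξ : ℂ => M * ‖ξ - α‖ ^ σ * Real.exp (|Λ| * ‖ξ - α‖) * ‖ξ - α‖)
      (Metric.closedBall ζ ρ) := by
    have : ContinuousOn (fun ξ : ℂ => ‖ξ - α‖ ^ σ) (Metric.closedBall ζ ρ) :=
      ContinuousOn.rpow_const (by fun_prop)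
        fun ξ hξ => Or.inl (sector_norm_sub_pos (hball hξ)).ne'
    fun_prop
  obtain ⟨C, hC⟩ := (isCompact_closedBall ζ ρ).exists_bound_of_continuousOn hcont
  have hF : ∀ t ∈ Ioc (0 : ℝ) 1, ∀ ξ ∈ sector α θ ω,
      DifferentiableAt ℂ (fun ξ => f (α + t * (ξ - α)) * (ξ - α)) ξ := by
    intro t ht ξ hξ
    have h1 : DifferentiableAt ℂ f (α + t * (ξ - α)) :=
      hf.diff.differentiableAt (hopen.mem_nhds (sector_scale hξ ht.1))
    have h2 : DifferentiableAt ℂ (fun ξ : ℂ => f (α + t * (ξ - α))) ξ :=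
      DifferentiableAt.comp ξ (f := fun ξ : ℂ => α + t * (ξ - α)) h1 (by fun_prop)
    fun_prop
  have hFb : ∀ t ∈ Ioc (0 : ℝ) 1, ∀ ξ ∈ Metric.closedBall ζ ρ,
      ‖f (α + t * (ξ - α)) * (ξ - α)‖ ≤ C * t ^ σ := by
    intro t ht ξ hξ
    have h0 := sector_norm_sub_pos (hball hξ)
    refine (hf.norm_segment_le (hball hξ) ht.1).trans ?_
    have h1 : Λ * (t * ‖ξ - α‖) ≤ |Λ| * ‖ξ - α‖ :=
      mul_le_mul (le_abs_self _) (mul_le_of_le_one_left h0.le ht.2)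
        (mul_nonneg ht.1.le h0.le) (abs_nonneg _)
    have h2 : 0 ≤ t ^ σ := Real.rpow_nonneg ht.1.le _
    rw [Real.mul_rpow ht.1.le h0.le]
    calc M * (t ^ σ * ‖ξ - α‖ ^ σ) * Real.exp (Λ * (t * ‖ξ - α‖)) * ‖ξ - α‖
        ≤ M * (t ^ σ * ‖ξ - α‖ ^ σ) * Real.exp (|Λ| * ‖ξ - α‖) * ‖ξ - α‖ := by gcongr
      _ = (M * ‖ξ - α‖ ^ σ * Real.exp (|Λ| * ‖ξ - α‖) * ‖ξ - α‖) * t ^ σ := by ring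
      _ ≤ C * t ^ σ := mul_le_mul_of_nonneg_right ((le_abs_self _).trans (hC ξ hξ)) h2
  have hsub : Metric.ball ζ (ρ / 2) ⊆ sector α θ ω :=
    (Metric.ball_subset_closedBall.trans (Metric.closedBall_subset_closedBall (by linarith))).trans
      hball
  have main := intervalIntegral.hasDerivAt_integral_of_dominated_loc_of_deriv_le
    (μ := MeasureTheory.volume) (a := 0) (b := 1) (𝕜 := ℂ)
    (F := fun ξ (t : ℝ) => f (α + t * (ξ - α)) * (ξ - α))
    (F' := fun ξ (t : ℝ) => deriv (fun ξ => f (α + t * (ξ - α)) * (ξ - α)) ξ) (x₀ := ζ)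
    (bound := fun t => C / (ρ / 2) * t ^ σ)
    (Metric.ball_mem_nhds ζ (half_pos hρ))
    (by
      filter_upwards [hopen.mem_nhds hζ] with ξ hξ
      exact (hf.intervalIntegrable hσ hξ zero_le_one).aestronglyMeasurable_restrict_uIoc)
    (hf.intervalIntegrable hσ hζ zero_le_one)
    (by
      rw [uIoc_of_le zero_le_one]
      have hdf : ContinuousOn (deriv f) (sector α θ ω) :=
        (hf.diff.deriv hopen).continuousOn
      have hcf := hf.diff.continuousOn
      have hmaps : MapsTo (fun t : ℝ => α + t * (ζ - α)) (Ioc 0 1) (sector α θ ω) :=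
        fun t ht => sector_scale hζ ht.1
      have : ContinuousOn (fun t : ℝ => deriv f (α + t * (ζ - α)) * t * (ζ - α) +
          f (α + t * (ζ - α))) (Ioc 0 1) := by
        have c1 : ContinuousOn (fun t : ℝ => deriv f (α + t * (ζ - α))) (Ioc 0 1) :=
          hdf.comp (by fun_prop) hmaps
        have c2 : ContinuousOn (fun t : ℝ => f (α + t * (ζ - α))) (Ioc 0 1) :=
          hcf.comp (by fun_prop) hmaps
        fun_prop
      refine (this.congr fun t ht => ?_).aestronglyMeasurable measurableSet_Ioc
      have d1 : HasDerivAt f (deriv f (α + t * (ζ - α))) (α + t * (ζ - α)) :=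
        (hf.diff.differentiableAt (hopen.mem_nhds (hmaps ht))).hasDerivAt
      have d2 : HasDerivAt (fun ξ : ℂ => α + t * (ξ - α)) t ζ := by
        simpa using (((hasDerivAt_id ζ).sub_const α).const_mul (t : ℂ)).const_add α
      have d3 := (d1.comp ζ d2).mul ((hasDerivAt_id ζ).sub_const α)
      rw [mul_one] at d3
      exact d3.deriv)
    (by
      refine Eventually.of_forall fun t ht ξ hξ => ?_
      rw [uIoc_of_le zero_le_one] at ht
      have hcb : Metric.closedBall ξ (ρ / 2) ⊆ Metric.closedBall ζ ρ :=
        Metric.closedBall_subset_closedBall' (by linarith [Metric.mem_ball.1 hξ])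
      refine (Complex.norm_deriv_le_of_forall_mem_sphere_norm_le (half_pos hρ) ?_ fun w hw =>
        hFb t ht w (hcb (Metric.sphere_subset_closedBall hw))).trans_eq (by ring)
      refine DifferentiableOn.diffContOnCl fun w hw => ?_
      rw [closure_ball _ (half_pos hρ).ne'] at hw
      exact (hF t ht w (hball (hcb hw))).differentiableWithinAt)
    ((intervalIntegral.intervalIntegrable_rpow' hσ).const_mul _)
    (by
      refine Eventually.of_forall fun t ht ξ hξ => ?_
      rw [uIoc_of_le zero_le_one] at ht
      exact (hF t ht ξ (hsub hξ)).hasDerivAt)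
  -- The value of the derivative is found along the ray through `ζ`.
  have hD := main.2
  set D := ∫ t in (0 : ℝ)..1, deriv (fun ξ => f (α + t * (ξ - α)) * (ξ - α)) ζ
  have hray : HasDerivAt (fun s : ℝ => integralFrom α f (α + s * (ζ - α))) (D * (ζ - α)) 1 := by
    have e : α + ((1 : ℝ) : ℂ) * (ζ - α) = ζ := by push_cast; ring
    have hin : HasDerivAt (fun s : ℝ => α + s * (ζ - α)) (ζ - α) 1 := by
      simpa using ((Complex.ofRealCLM.hasDerivAt (x := 1)).mul_const (ζ - α)).const_add α
    have hD' : HasDerivAt (integralFrom α f) D (α + ((1 : ℝ) : ℂ) * (ζ - α)) := by rw [e]; exact hD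
    exact hD'.comp (1 : ℝ) hin
  have hray' : HasDerivAt (fun s : ℝ => integralFrom α f (α + s * (ζ - α)))
      (f ζ * (ζ - α)) 1 := by
    have hcont : ContinuousOn (fun t : ℝ => f (α + t * (ζ - α)) * (ζ - α)) (Ioi 0) :=
      ContinuousOn.mul (hf.diff.continuousOn.comp (by fun_prop)
        fun t ht => sector_scale hζ ht) continuousOn_const
    have h1 := intervalIntegral.integral_hasDerivAt_right
      (hf.intervalIntegrable hσ hζ zero_le_one)
      (hcont.stronglyMeasurableAtFilter isOpen_Ioi _ (by simp))
      (hcont.continuousAt (Ioi_mem_nhds one_pos))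
    have e : α + ((1 : ℝ) : ℂ) * (ζ - α) = ζ := by push_cast; ring
    rw [e] at h1
    exact h1.congr_of_eventuallyEq <| Eventually.of_forall fun s => integralFrom_ray α (ζ - α) f s
  have := mul_right_cancel₀ (sector_sub_ne_zero hζ) (hray.unique hray')
  rwa [this] at hD

theorem SingExpWith.integralFrom (hω : 0 < ω) (hωπ : ω ≤ Real.pi) (hσ : -1 < σ) (hΛ : 0 ≤ Λ)
    (hM : 0 ≤ M) (hf : SingExpWith σ Λ M α (sector α θ ω) f) :
    SingExpWith (σ + 1) Λ (M / (σ + 1)) α (sector α θ ω) (integralFrom α f) :=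
  ⟨fun _ hζ => (hasDerivAt_integralFrom hω hωπ hσ hM hf hζ).differentiableAt.differentiableWithinAt,
    fun _ hζ => norm_integralFrom_le hσ hΛ hM hf hζ⟩

theorem SingExpWith.integralFrom' (hω : 0 < ω) (hωπ : ω ≤ Real.pi) (hσ : 0 ≤ σ) (hΛ : 0 < Λ)
    (hM : 0 ≤ M) (hf : SingExpWith σ Λ M α (sector α θ ω) f) :
    SingExpWith σ Λ (M / Λ) α (sector α θ ω) (LevelOne.integralFrom α f) :=
  ⟨fun _ hζ => (hasDerivAt_integralFrom hω hωπ (by linarith) hM hf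
    hζ).differentiableAt.differentiableWithinAt,
    fun _ hζ => norm_integralFrom_le' hσ hΛ hM hf hζ⟩

theorem SingExpWith.tendsto_tip (hσ : 0 < σ) (hf : SingExpWith σ Λ M α (sector α θ ω) f) {ζ : ℂ}
    (hζ : ζ ∈ sector α θ ω) : Tendsto (fun t : ℝ => f (α + t * (ζ - α))) (𝓝[>] 0) (𝓝 0) := by
  have hb : Tendsto (fun t : ℝ => M * (t * ‖ζ - α‖) ^ σ * Real.exp (Λ * (t * ‖ζ - α‖)))
      (𝓝[>] 0) (𝓝 0) := by
    have hc : Continuous (fun t : ℝ => M * (t * ‖ζ - α‖) ^ σ * Real.exp (Λ * (t * ‖ζ - α‖))) := by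
      have : Continuous fun t : ℝ => (t * ‖ζ - α‖) ^ σ :=
        Continuous.rpow_const (by fun_prop) fun _ => Or.inr hσ.le
      fun_prop
    have := hc.tendsto 0
    simp only [zero_mul, Real.zero_rpow hσ.ne', mul_zero] at this
    exact this.mono_left nhdsWithin_le_nhds
  refine squeeze_zero_norm' ?_ hb
  filter_upwards [self_mem_nhdsWithin] with t ht
  have := hf.bound _ (sector_scale hζ ht)
  rwa [add_sub_cancel_left, norm_mul, Complex.norm_real, Real.norm_of_nonneg (le_of_lt ht)] at this

/-- A holomorphic function on the sector is recovered from its derivative and its radial limits at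
the tip. -/
theorem eq_add_integralFrom (hω : 0 < ω) (hωπ : ω ≤ Real.pi) (hσ : -1 < σ) (hΛ : 0 ≤ Λ)
    (hM : 0 ≤ M) (hf : SingExpWith σ Λ M α (sector α θ ω) f) {y : ℂ → ℂ} {c : ℂ}
    (hy : ∀ ζ ∈ sector α θ ω, HasDerivAt y (f ζ) ζ) {ζ : ℂ} (hζ : ζ ∈ sector α θ ω)
    (hlim : Tendsto (fun t : ℝ => y (α + t * (ζ - α))) (𝓝[>] 0) (𝓝 c)) :
    y ζ = c + LevelOne.integralFrom α f ζ := by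
  have h0 := sector_norm_sub_pos hζ
  have hconst : ∀ t : ℝ, 0 < t → y (α + t * (ζ - α)) - LevelOne.integralFrom α f (α + t * (ζ - α)) =
      y ζ - LevelOne.integralFrom α f ζ := by
    intro t ht
    have hd : ∀ ξ ∈ sector α θ ω,
        HasDerivWithinAt (fun ξ => y ξ - LevelOne.integralFrom α f ξ) 0 (sector α θ ω) ξ := by
      intro ξ hξ
      exact (((hy ξ hξ).sub (hasDerivAt_integralFrom hω hωπ hσ hM hf hξ)).congr_deriv
        (sub_self _)).hasDerivWithinAt
    have := (convex_sector hω hωπ).norm_image_sub_le_of_norm_hasDerivWithin_le (C := 0) hd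
      (fun ξ _ => by simp) hζ (sector_scale hζ ht)
    rw [zero_mul] at this
    exact sub_eq_zero.1 (norm_le_zero_iff.1 this)
  have hJ := (hf.integralFrom hω hωπ hσ hΛ hM).tendsto_tip (by linarith) hζ
  have h1 := hlim.sub hJ
  have h2 : Tendsto (fun t : ℝ => y (α + t * (ζ - α)) -
      LevelOne.integralFrom α f (α + t * (ζ - α))) (𝓝[>] 0)
      (𝓝 (y ζ - LevelOne.integralFrom α f ζ)) := by
    refine tendsto_const_nhds.congr' ?_
    filter_upwards [self_mem_nhdsWithin] with t ht
    exact (hconst t ht).symm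
  have := tendsto_nhds_unique h2 h1
  rw [sub_zero] at this
  rw [← this]; ring

end sector

/-! ### Polynomials on the sector -/

open Polynomial in
/-- Division by a linear factor. -/
theorem exists_eq_linear_mul_add (S : ℂ[X]) (β : ℂ) :
    ∃ T : ℂ[X], S = (X + C β) * T + C (S.eval (-β)) ∧ T.natDegree ≤ S.natDegree - 1 := by
  refine ⟨S /ₘ (X - C (-β)), ?_, ?_⟩
  · have h := modByMonic_add_div S (X - C (-β))
    rw [modByMonic_X_sub_C_eq_C_eval] at h
    conv_lhs => rw [← h]
    rw [C_neg, sub_neg_eq_add, add_comm]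
  · rw [natDegree_divByMonic _ (monic_X_sub_C _), natDegree_X_sub_C]

open Polynomial in
/-- The monic polynomial whose roots are the negatives of the members of `s`. -/
noncomputable def negRootsPoly (s : Multiset ℂ) : ℂ[X] := (s.map fun β => X + C β).prod

open Polynomial in
theorem negRootsPoly_cons (β : ℂ) (s : Multiset ℂ) :
    negRootsPoly (β ::ₘ s) = (X + C β) * negRootsPoly s := by
  simp [negRootsPoly]

open Polynomial in
theorem natDegree_negRootsPoly (s : Multiset ℂ) :
    (negRootsPoly s).natDegree = Multiset.card s := by
  have h := natDegree_multiset_prod_X_sub_C_eq_card (s.map fun β => -β)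
  rw [Multiset.map_map, Multiset.card_map] at h
  rw [negRootsPoly, ← h]
  congr 3
  ext1 β
  simp

open Polynomial in
/-- The simple root `-α` is split off from `P`, and its contribution is split off from `Q`: with
`P = (X + α) P₁` one has `Q = τ P₁ + (X + α) S` where `deg S ≤ deg P₁`. -/
theorem exists_factorization {P Q : ℂ[X]} (hPmonic : P.Monic) (hPsimple : P.roots.Nodup)
    (hQdeg : Q.natDegree + 1 = P.natDegree) {α : ℂ} (hα : P.IsRoot (-α)) :
    ∃ (s : Multiset ℂ) (S : ℂ[X]), P = (X + C α) * negRootsPoly s ∧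
      Q = C (charExponent P Q α) * negRootsPoly s + (X + C α) * S ∧
      S.natDegree ≤ Multiset.card s ∧ (negRootsPoly s).eval (-α) ≠ 0 ∧
      ∀ β ∈ s, P.IsRoot (-β) ∧ β ≠ α := by
  have hP0 := hPmonic.ne_zero
  have hmem : -α ∈ P.roots := (mem_roots hP0).2 hα
  set s : Multiset ℂ := (P.roots.erase (-α)).map fun x => -x with hs
  have hmap : (α ::ₘ s) = P.roots.map fun x => -x := by
    rw [← Multiset.cons_erase hmem, Multiset.map_cons, neg_neg]
  have hprod : P = (X + C α) * negRootsPoly s := by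
    rw [← negRootsPoly_cons, hmap, negRootsPoly, Multiset.map_map]
    have h := (IsAlgClosed.splits P).eq_prod_roots
    rw [hPmonic.leadingCoeff, C_1, one_mul] at h
    conv_lhs => rw [h]
    congr 2
    ext1 x
    simp [sub_eq_add_neg]
  have hroots : ∀ β ∈ s, P.IsRoot (-β) ∧ β ≠ α := by
    intro β hβ
    obtain ⟨x, hx, rfl⟩ := Multiset.mem_map.1 hβ
    rw [neg_neg]
    refine ⟨(mem_roots hP0).1 (Multiset.mem_of_mem_erase hx), fun h => ?_⟩
    rw [← h, neg_neg] at hx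
    exact hPsimple.notMem_erase hx
  have heval : (negRootsPoly s).eval (-α) ≠ 0 := by
    rw [negRootsPoly, eval_multiset_prod, Multiset.map_map]
    refine Multiset.prod_ne_zero fun h0 => ?_
    obtain ⟨β, hβ, h⟩ := Multiset.mem_map.1 h0
    simp only [Function.comp, eval_add, eval_X, eval_C] at h
    exact (hroots β hβ).2 (by linear_combination h)
  have hτ : charExponent P Q α = Q.eval (-α) / (negRootsPoly s).eval (-α) := by
    rw [charExponent]
    congr 1
    rw [hprod]
    simp
  obtain ⟨S, hS, -⟩ := exists_eq_linear_mul_add (Q - C (charExponent P Q α) * negRootsPoly s) α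
  have h0 : (Q - C (charExponent P Q α) * negRootsPoly s).eval (-α) = 0 := by
    rw [eval_sub, eval_mul, eval_C, hτ]
    field_simp
    ring
  rw [h0, C_0, add_zero] at hS
  refine ⟨s, S, hprod, by rw [← hS]; ring, ?_, heval, hroots⟩
  have hcard : Multiset.card s = Q.natDegree := by
    have := congrArg natDegree hprod
    rw [← negRootsPoly_cons, natDegree_negRootsPoly, Multiset.card_cons] at this
    omega
  by_cases hS0 : S = 0
  · simp [hS0]
  · have h1 : ((X + C α) * S).natDegree = 1 + S.natDegree := by
      rw [natDegree_mul (X_add_C_ne_zero α) hS0, natDegree_X_add_C]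
    have h2 : (Q - C (charExponent P Q α) * negRootsPoly s).natDegree ≤ Q.natDegree := by
      refine (natDegree_sub_le _ _).trans (max_le le_rfl ?_)
      refine (natDegree_C_mul_le _ _).trans ?_
      rw [natDegree_negRootsPoly, hcard]
    rw [hS, h1] at h2
    omega

open Polynomial in
/-- A proper fraction is bounded away from its poles. -/
theorem exists_norm_eval_div_le {W : Set ℂ} {ε : ℝ} (hε : 0 < ε) (s : Multiset ℂ)
    (hs : ∀ β ∈ s, ∀ ζ ∈ W, ε ≤ ‖-ζ + β‖) (S : ℂ[X]) (hS : S.natDegree ≤ Multiset.card s) :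
    ∃ K : ℝ, 0 ≤ K ∧ ∀ ζ ∈ W, ‖S.eval (-ζ) / (negRootsPoly s).eval (-ζ)‖ ≤ K := by
  induction s using Multiset.induction generalizing S with
  | empty =>
    rw [Multiset.card_zero, Nat.le_zero, natDegree_eq_zero] at hS
    obtain ⟨c, rfl⟩ := hS
    exact ⟨‖c‖, norm_nonneg _, fun ζ _ => by simp [negRootsPoly]⟩
  | cons β s ih =>
    have hs' : ∀ γ ∈ s, ∀ ζ ∈ W, ε ≤ ‖-ζ + γ‖ := fun γ hγ =>
      hs γ (Multiset.mem_cons_of_mem hγ)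
    obtain ⟨T, hT, hdeg⟩ := exists_eq_linear_mul_add S β
    rw [Multiset.card_cons] at hS
    obtain ⟨K₁, hK₁, h₁⟩ := ih hs' T (by omega)
    obtain ⟨K₂, hK₂, h₂⟩ := ih hs' 1 (by simp)
    set c := S.eval (-β)
    refine ⟨K₁ + ‖c‖ / ε * K₂, by positivity, fun ζ hζ => ?_⟩
    have hne : ε ≤ ‖-ζ + β‖ := hs β (Multiset.mem_cons_self β s) ζ hζ
    have hne0 : -ζ + β ≠ 0 := norm_pos_iff.1 (hε.trans_le hne)
    have e : S.eval (-ζ) / (negRootsPoly (β ::ₘ s)).eval (-ζ) =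
        T.eval (-ζ) / (negRootsPoly s).eval (-ζ) +
          c / (-ζ + β) * ((1 : ℂ[X]).eval (-ζ) / (negRootsPoly s).eval (-ζ)) := by
      rw [negRootsPoly_cons]
      conv_lhs => rw [hT]
      simp only [eval_add, eval_mul, eval_X, eval_C, eval_one]
      rw [add_div, mul_div_mul_left _ _ hne0, div_mul_div_comm, mul_one]
    rw [e]
    refine (norm_add_le _ _).trans (add_le_add (h₁ ζ hζ) ?_)
    rw [norm_mul, norm_div]
    have := h₂ ζ hζ
    gcongr

open Polynomial in
theorem eval_negRootsPoly_ne_zero {s : Multiset ℂ} {ζ : ℂ} (h : ∀ β ∈ s, β ≠ ζ) :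
    (negRootsPoly s).eval (-ζ) ≠ 0 := by
  rw [negRootsPoly, eval_multiset_prod, Multiset.map_map]
  refine Multiset.prod_ne_zero fun h0 => ?_
  obtain ⟨β, hβ, h'⟩ := Multiset.mem_map.1 h0
  simp only [Function.comp, eval_add, eval_X, eval_C] at h'
  exact h β hβ (by linear_combination h')

/-- Polynomials grow more slowly than the exponential function. -/
theorem exists_norm_eval_neg_le (S : Polynomial ℂ) (α : ℂ) :
    ∃ K : ℝ, 0 ≤ K ∧ ∀ ζ : ℂ, ‖S.eval (-ζ)‖ ≤ K * Real.exp ‖ζ - α‖ := by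
  induction S using Polynomial.induction_on' with
  | add p q hp hq =>
    obtain ⟨K₁, h₁, h₁'⟩ := hp
    obtain ⟨K₂, h₂, h₂'⟩ := hq
    refine ⟨K₁ + K₂, by positivity, fun ζ => ?_⟩
    rw [Polynomial.eval_add, add_mul]
    exact (norm_add_le _ _).trans (add_le_add (h₁' ζ) (h₂' ζ))
  | monomial n a =>
    refine ⟨‖a‖ * (n.factorial * Real.exp ‖α‖), by positivity, fun ζ => ?_⟩
    rw [Polynomial.eval_monomial, norm_mul, norm_pow, norm_neg, mul_assoc, mul_assoc]
    refine mul_le_mul_of_nonneg_left ?_ (norm_nonneg a)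
    have h := Real.pow_div_factorial_le_exp ‖ζ‖ (norm_nonneg _) n
    rw [div_le_iff₀' (by positivity)] at h
    refine h.trans (mul_le_mul_of_nonneg_left ?_ (by positivity))
    rw [← Real.exp_add]
    refine Real.exp_le_exp.2 ?_
    have := norm_add_le α (ζ - α)
    rwa [add_sub_cancel] at this

section sector

variable {α : ℂ} {θ ω σ Λ M : ℝ} {f : ℂ → ℂ}

theorem exists_singExpWith_eval_neg (S : Polynomial ℂ) (α : ℂ) (θ ω : ℝ) :
    ∃ K : ℝ, 0 ≤ K ∧ SingExpWith 0 1 K α (sector α θ ω) (fun ζ => S.eval (-ζ)) := by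
  obtain ⟨K, hK, h⟩ := exists_norm_eval_neg_le S α
  refine ⟨K, hK, ?_, fun ζ _ => ?_⟩
  · exact (S.differentiable.comp differentiable_neg).differentiableOn
  · rw [Real.rpow_zero, mul_one, one_mul]
    exact h ζ

/-- Multiplication by a polynomial, at the cost of a larger exponential type that does not depend on
the polynomial. -/
theorem SingExpWith.eval_neg_mul (hM : 0 ≤ M) (hf : SingExpWith σ Λ M α (sector α θ ω) f)
    (S : Polynomial ℂ) :
    ∃ K : ℝ, 0 ≤ K ∧ SingExpWith σ (Λ + 1) K α (sector α θ ω) (fun ζ => S.eval (-ζ) * f ζ) := by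
  obtain ⟨K, hK, h⟩ := exists_singExpWith_eval_neg S α θ ω
  refine ⟨K * M, by positivity, ?_⟩
  have := h.mul hK hf
  rwa [zero_add, add_comm 1 Λ] at this

theorem singExpWith_branchPow (hωπ : ω ≤ Real.pi) (s : ℂ) :
    SingExpWith s.re 0 (branchConst θ s) α (sector α θ ω) (fun ζ => branchPow θ s (ζ - α)) :=
  ⟨fun _ hζ => (hasDerivAt_branchPow_sub hωπ s hζ).differentiableAt.differentiableWithinAt,
    fun ζ hζ => by simpa using norm_branchPow_le θ s (sector_sub_ne_zero hζ)⟩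

end sector

/-! ### Series of iterated integrals -/

section sector

variable {α : ℂ} {θ ω σ Λ M M' : ℝ} {f g : ℂ → ℂ}

/-- Geometrically dominated series of holomorphic functions on the sector. -/
theorem singExpWith_tsum (hω : 0 < ω) (hωπ : ω ≤ Real.pi) (hσ : 0 ≤ σ) (hΛ : 0 ≤ Λ) (hM : 0 ≤ M)
    {F : ℕ → ℂ → ℂ} (hF : ∀ j, SingExpWith σ Λ (M * (1 / 2) ^ j) α (sector α θ ω) (F j)) :
    (∀ ζ ∈ sector α θ ω, Summable fun j => F j ζ) ∧
      SingExpWith σ Λ (2 * M) α (sector α θ ω) (fun ζ => ∑' j, F j ζ) := by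
  have hgeom : ∀ c : ℝ, HasSum (fun j : ℕ => M * (1 / 2) ^ j * c) (2 * M * c) := fun c => by
    have := ((hasSum_geometric_two).mul_left M).mul_right c
    rwa [mul_comm M 2] at this
  have hb : ∀ ζ ∈ sector α θ ω, ∀ j,
      ‖F j ζ‖ ≤ M * (1 / 2) ^ j * (‖ζ - α‖ ^ σ * Real.exp (Λ * ‖ζ - α‖)) := fun ζ hζ j =>
    ((hF j).bound ζ hζ).trans_eq (by ring)
  refine ⟨fun ζ hζ => Summable.of_norm_bounded (hgeom _).summable (hb ζ hζ), fun ζ₀ hζ₀ => ?_,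
    fun ζ hζ => (tsum_of_norm_bounded (hgeom _) (hb ζ hζ)).trans_eq (by ring)⟩
  -- The bounds are uniform on bounded parts of the sector.
  set ρ := ‖ζ₀ - α‖ + 1
  have hopen : IsOpen (sector α θ ω ∩ {ζ | ‖ζ - α‖ < ρ}) :=
    (isOpen_sector hω hωπ).inter (isOpen_lt (by fun_prop) (by fun_prop))
  have hd := Complex.differentiableOn_tsum_of_summable_norm
    (hgeom (ρ ^ σ * Real.exp (Λ * ρ))).summable
    (fun j => ((hF j).diff.mono inter_subset_left : DifferentiableOn ℂ (F j)
      (sector α θ ω ∩ {ζ | ‖ζ - α‖ < ρ}))) hopen (fun j ζ hζ => by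
        refine (hb ζ hζ.1 j).trans ?_
        have h1 : ‖ζ - α‖ ≤ ρ := le_of_lt hζ.2
        gcongr)
  exact (hd.differentiableAt (hopen.mem_nhds
    ⟨hζ₀, lt_add_one ‖ζ₀ - α‖⟩)).differentiableWithinAt

theorem hasSum_integralFrom (hω : 0 < ω) (hωπ : ω ≤ Real.pi) (hσ : 0 ≤ σ) (hΛ : 0 ≤ Λ)
    (hM : 0 ≤ M) {F : ℕ → ℂ → ℂ}
    (hF : ∀ j, SingExpWith σ Λ (M * (1 / 2) ^ j) α (sector α θ ω) (F j)) {ζ : ℂ}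
    (hζ : ζ ∈ sector α θ ω) :
    HasSum (fun j => integralFrom α (F j) ζ) (integralFrom α (fun ξ => ∑' j, F j ξ) ζ) := by
  have h0 := sector_norm_sub_pos hζ
  set c := ‖ζ - α‖ ^ σ * Real.exp (Λ * ‖ζ - α‖) * ‖ζ - α‖
  have hgeom : HasSum (fun j : ℕ => M * (1 / 2) ^ j * c) (M * 2 * c) :=
    ((hasSum_geometric_two).mul_left M).mul_right c
  refine intervalIntegral.hasSum_integral_of_dominated_convergence
    (fun j _ => M * (1 / 2) ^ j * c) ?_ ?_ ?_ ?_ ?_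
  · exact fun j =>
      ((hF j).intervalIntegrable (by linarith) hζ zero_le_one).aestronglyMeasurable_restrict_uIoc
  · intro j
    refine Eventually.of_forall fun t ht => ?_
    rw [uIoc_of_le zero_le_one] at ht
    refine ((hF j).norm_segment_le hζ ht.1).trans ?_
    have h1 : t * ‖ζ - α‖ ≤ ‖ζ - α‖ := mul_le_of_le_one_left h0.le ht.2
    have h2 : 0 ≤ t * ‖ζ - α‖ := mul_nonneg ht.1.le h0.le
    calc _ ≤ M * (1 / 2) ^ j * ‖ζ - α‖ ^ σ * Real.exp (Λ * ‖ζ - α‖) * ‖ζ - α‖ := by gcongr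
      _ = _ := by ring
  · exact Eventually.of_forall fun t _ => hgeom.summable
  · exact intervalIntegrable_const
  · refine Eventually.of_forall fun t ht => ?_
    rw [uIoc_of_le zero_le_one] at ht
    exact ((singExpWith_tsum hω hωπ hσ hΛ hM hF).1 _ (sector_scale hζ ht.1)).hasSum.mul_right _

theorem singExpWith_iterate (hω : 0 < ω) (hωπ : ω ≤ Real.pi) (hσ : -1 < σ) (hΛ : 0 < Λ)
    (hM : 0 ≤ M) (hf : SingExpWith σ Λ M α (sector α θ ω) f) (j : ℕ) :
    SingExpWith (σ + 1) Λ (M / (σ + 1) * (1 / Λ) ^ j) α (sector α θ ω)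
      ((integralFrom α)^[j + 1] f) := by
  have hσ1 : 0 < σ + 1 := by linarith
  induction j with
  | zero => simpa using hf.integralFrom hω hωπ hσ hΛ.le hM
  | succ j ih =>
    rw [Function.iterate_succ_apply']
    have := ih.integralFrom' hω hωπ hσ1.le hΛ (by positivity)
    convert this using 1
    rw [pow_succ]
    ring

theorem iterate_integralFrom_congr (h : EqOn f g (sector α θ ω)) (j : ℕ) :
    EqOn ((integralFrom α)^[j] f) ((integralFrom α)^[j] g) (sector α θ ω) := by
  induction j with
  | zero => simpa using h
  | succ j ih =>
    rw [Function.iterate_succ_apply', Function.iterate_succ_apply']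
    exact integralFrom_congr ih

theorem iterate_integralFrom_sub (hω : 0 < ω) (hωπ : ω ≤ Real.pi) (hσ : -1 < σ) (hΛ : 0 < Λ)
    (hM : 0 ≤ M) (hM' : 0 ≤ M') (hf : SingExpWith σ Λ M α (sector α θ ω) f)
    (hg : SingExpWith σ Λ M' α (sector α θ ω) g) (j : ℕ) :
    EqOn ((integralFrom α)^[j + 1] fun ζ => f ζ - g ζ)
      (fun ζ => (integralFrom α)^[j + 1] f ζ - (integralFrom α)^[j + 1] g ζ)
      (sector α θ ω) := by
  induction j with
  | zero => exact fun ζ hζ => integralFrom_sub hσ hσ hf hg hζ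
  | succ j ih =>
    intro ζ hζ
    rw [Function.iterate_succ_apply', integralFrom_congr ih hζ]
    rw [integralFrom_sub (by linarith) (by linarith) (singExpWith_iterate hω hωπ hσ hΛ hM hf j)
      (singExpWith_iterate hω hωπ hσ hΛ hM' hg j) hζ]
    simp only [Function.iterate_succ_apply']

/-- The operator `∑ c_j ∂^{-1-j}`, where `∂⁻¹` is integration from `α`. -/
noncomputable def iteratedSeries (c : ℕ → ℂ) (α : ℂ) (f : ℂ → ℂ) (ζ : ℂ) : ℂ :=
  ∑' j, c j * (integralFrom α)^[j + 1] f ζ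

variable {c : ℕ → ℂ} {C B : ℝ}

theorem singExpWith_iteratedSeries_term (hω : 0 < ω) (hωπ : ω ≤ Real.pi) (hσ : -1 < σ)
    (hB : 0 < B) (hc : ∀ j, ‖c j‖ ≤ C * B ^ j) (hΛ : 2 * B ≤ Λ) (hM : 0 ≤ M)
    (hf : SingExpWith σ Λ M α (sector α θ ω) f) (j : ℕ) :
    SingExpWith (σ + 1) Λ (C * (M / (σ + 1)) * (1 / 2) ^ j) α (sector α θ ω)
      (fun ζ => c j * (integralFrom α)^[j + 1] f ζ) := by
  have hσ1 : 0 < σ + 1 := by linarith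
  have hΛ0 : 0 < Λ := by linarith
  refine ((singExpWith_iterate hω hωπ hσ hΛ0 hM hf j).const_mul (c j)).mono (by positivity) ?_ le_rfl
  have h1 : (B * (1 / Λ)) ^ j ≤ (1 / 2) ^ j := by
    refine pow_le_pow_left₀ (by positivity) ?_ j
    rw [mul_one_div, div_le_div_iff₀ hΛ0 two_pos]
    linarith
  have hC : 0 ≤ C := by simpa using (norm_nonneg _).trans (hc 0)
  calc ‖c j‖ * (M / (σ + 1) * (1 / Λ) ^ j) ≤ C * B ^ j * (M / (σ + 1) * (1 / Λ) ^ j) := by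
        have := hc j
        gcongr
    _ = C * (M / (σ + 1)) * (B * (1 / Λ)) ^ j := by rw [mul_pow]; ring
    _ ≤ _ := by gcongr

theorem SingExpWith.iteratedSeries (hω : 0 < ω) (hωπ : ω ≤ Real.pi) (hσ : -1 < σ)
    (hB : 0 < B) (hc : ∀ j, ‖c j‖ ≤ C * B ^ j) (hΛ : 2 * B ≤ Λ) (hM : 0 ≤ M)
    (hf : SingExpWith σ Λ M α (sector α θ ω) f) :
    SingExpWith (σ + 1) Λ (2 * (C * (M / (σ + 1)))) α (sector α θ ω) (iteratedSeries c α f) := by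
  have hσ1 : 0 < σ + 1 := by linarith
  have hC : 0 ≤ C := by simpa using (norm_nonneg _).trans (hc 0)
  exact (singExpWith_tsum hω hωπ hσ1.le (by linarith) (by positivity)
    (singExpWith_iteratedSeries_term hω hωπ hσ hB hc hΛ hM hf)).2

theorem hasSum_integralFrom_iteratedSeries (hω : 0 < ω) (hωπ : ω ≤ Real.pi) (hσ : -1 < σ)
    (hB : 0 < B) (hc : ∀ j, ‖c j‖ ≤ C * B ^ j) (hΛ : 2 * B ≤ Λ) (hM : 0 ≤ M)
    (hf : SingExpWith σ Λ M α (sector α θ ω) f) {ζ : ℂ} (hζ : ζ ∈ sector α θ ω) :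
    HasSum (fun j => c j * (integralFrom α)^[j + 2] f ζ)
      (integralFrom α (iteratedSeries c α f) ζ) := by
  have hσ1 : 0 < σ + 1 := by linarith
  have hC : 0 ≤ C := by simpa using (norm_nonneg _).trans (hc 0)
  have h := hasSum_integralFrom hω hωπ hσ1.le (by linarith) (by positivity)
    (singExpWith_iteratedSeries_term hω hωπ hσ hB hc hΛ hM hf) hζ
  refine h.congr_fun fun j => ?_
  rw [integralFrom_const_mul, ← Function.iterate_succ_apply' (integralFrom α)]

theorem iteratedSeries_congr (h : EqOn f g (sector α θ ω)) :
    EqOn (iteratedSeries c α f) (iteratedSeries c α g) (sector α θ ω) := by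
  intro ζ hζ
  simp only [iteratedSeries]
  congr 1
  ext j
  rw [iterate_integralFrom_congr h _ hζ]

theorem iteratedSeries_sub (hω : 0 < ω) (hωπ : ω ≤ Real.pi) (hσ : -1 < σ)
    (hB : 0 < B) (hc : ∀ j, ‖c j‖ ≤ C * B ^ j) (hΛ : 2 * B ≤ Λ) (hM : 0 ≤ M) (hM' : 0 ≤ M')
    (hf : SingExpWith σ Λ M α (sector α θ ω) f) (hg : SingExpWith σ Λ M' α (sector α θ ω) g)
    {ζ : ℂ} (hζ : ζ ∈ sector α θ ω) :
    iteratedSeries c α (fun ζ => f ζ - g ζ) ζ = iteratedSeries c α f ζ - iteratedSeries c α g ζ := by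
  have hσ1 : 0 < σ + 1 := by linarith
  have hC : 0 ≤ C := by simpa using (norm_nonneg _).trans (hc 0)
  have hs : ∀ {f : ℂ → ℂ} {M : ℝ}, 0 ≤ M → SingExpWith σ Λ M α (sector α θ ω) f →
      Summable fun j => c j * (integralFrom α)^[j + 1] f ζ := fun hM hf =>
    (singExpWith_tsum hω hωπ hσ1.le (by linarith) (by positivity)
      (singExpWith_iteratedSeries_term hω hωπ hσ hB hc hΛ hM hf)).1 ζ hζ
  simp only [iteratedSeries]
  rw [← (hs hM hf).tsum_sub (hs hM' hg)]
  congr 1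
  ext j
  rw [iterate_integralFrom_sub hω hωπ hσ (by linarith) hM hM' hf hg j hζ, mul_sub]

/-! ### Contractions in the space of functions of exponential type -/

/-- An affine fixed point equation whose linear part halves the norm has a solution: the iterates of
the constant `c` converge geometrically. -/
theorem exists_fixed_point (hω : 0 < ω) (hωπ : ω ≤ Real.pi) (hΛ : 0 ≤ Λ)
    {T : (ℂ → ℂ) → ℂ → ℂ}
    (hT : ∀ M y, 0 ≤ M → SingExpWith 0 Λ M α (sector α θ ω) y →
      SingExpWith 0 Λ (M / 2) α (sector α θ ω) (T y))
    (hsub : ∀ M M' y y', 0 ≤ M → 0 ≤ M' → SingExpWith 0 Λ M α (sector α θ ω) y →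
      SingExpWith 0 Λ M' α (sector α θ ω) y' →
      EqOn (T fun ζ => y ζ - y' ζ) (fun ζ => T y ζ - T y' ζ) (sector α θ ω)) (c : ℂ) :
    ∃ (y : ℂ → ℂ) (M : ℝ), 0 ≤ M ∧ SingExpWith 0 Λ M α (sector α θ ω) y ∧
      ∀ ζ ∈ sector α θ ω, y ζ = c - T y ζ := by
  let s : ℕ → ℂ → ℂ := fun n => (fun y ζ => c - T y ζ)^[n] fun _ => c
  have hs_succ : ∀ n, s (n + 1) = fun ζ => c - T (s n) ζ := fun n =>
    Function.iterate_succ_apply' _ _ _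
  have hconst : SingExpWith 0 Λ ‖c‖ α (sector α θ ω) fun _ => c := by
    refine ⟨differentiableOn_const c, fun ζ _ => ?_⟩
    rw [Real.rpow_zero, mul_one]
    exact le_mul_of_one_le_right (norm_nonneg c) (Real.one_le_exp (by positivity))
  have hs : ∀ n, SingExpWith 0 Λ (2 * ‖c‖) α (sector α θ ω) (s n) := by
    intro n
    induction n with
    | zero => exact hconst.mono (norm_nonneg c) (by linarith [norm_nonneg c]) le_rfl
    | succ n ih =>
      rw [hs_succ]
      have := hconst.sub (hT _ _ (by positivity) ih)
      rwa [show ‖c‖ + 2 * ‖c‖ / 2 = 2 * ‖c‖ by ring] at this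
  have hd : ∀ n, SingExpWith 0 Λ (‖c‖ / 2 * (1 / 2) ^ n) α (sector α θ ω)
      (fun ζ => s (n + 1) ζ - s n ζ) := by
    intro n
    induction n with
    | zero =>
      have h := (hT _ _ (norm_nonneg c) hconst).const_mul (-1)
      rw [norm_neg, norm_one, one_mul] at h
      rw [pow_zero, mul_one]
      exact h.congr fun ζ _ => by rw [hs_succ]; simp [s]
    | succ n ih =>
      have h := (hT _ _ (by positivity) ih).const_mul (-1)
      rw [norm_neg, norm_one, one_mul] at h
      refine (h.congr fun ζ hζ => ?_).mono (by positivity) (le_of_eq (by rw [pow_succ]; ring)) le_rfl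
      rw [hsub _ _ _ _ (by positivity) (by positivity) (hs (n + 1)) (hs n) hζ]
      have e1 := congrFun (hs_succ (n + 1)) ζ
      have e2 := congrFun (hs_succ n) ζ
      simp only at e1 e2 ⊢
      linear_combination e1 - e2
  obtain ⟨hsum, htsum⟩ := singExpWith_tsum hω hωπ le_rfl hΛ (by positivity) hd
  set y : ℂ → ℂ := fun ζ => c + ∑' n, (s (n + 1) ζ - s n ζ) with hy
  have hyb : SingExpWith 0 Λ (‖c‖ + 2 * (‖c‖ / 2)) α (sector α θ ω) y := hconst.add htsum
  have hlim : ∀ ζ ∈ sector α θ ω, Tendsto (fun n => s n ζ) atTop (𝓝 (y ζ)) := by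
    intro ζ hζ
    have h := ((hsum ζ hζ).hasSum.tendsto_sum_nat).const_add c
    refine h.congr fun n => ?_
    rw [Finset.sum_range_sub (fun n => s n ζ)]
    simp [s]
  have htail : ∀ n, SingExpWith 0 Λ (‖c‖ * (1 / 2) ^ n) α (sector α θ ω)
      (fun ζ => s n ζ - y ζ) := by
    intro n
    refine ⟨(hs n).diff.sub hyb.diff, fun ζ hζ => ?_⟩
    have h := dist_le_of_le_geometric_two_of_tendsto (C := ‖c‖ * Real.exp (Λ * ‖ζ - α‖))
      (f := fun n => s n ζ) (fun n => ?_) (hlim ζ hζ) n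
    · rw [dist_eq_norm] at h
      rw [Real.rpow_zero, mul_one]
      refine h.trans_eq ?_
      rw [one_div, inv_pow]
      ring
    · have h := (hd n).bound ζ hζ
      rw [Real.rpow_zero, mul_one] at h
      rw [dist_comm, dist_eq_norm]
      refine h.trans_eq ?_
      rw [one_div, inv_pow]
      ring
  refine ⟨y, _, by positivity, hyb, fun ζ hζ => ?_⟩
  have h1 : Tendsto (fun n => T (s n) ζ) atTop (𝓝 (T y ζ)) := by
    rw [tendsto_iff_norm_sub_tendsto_zero]
    have hz : Tendsto (fun n : ℕ => ‖c‖ * (1 / 2) ^ n / 2 * Real.exp (Λ * ‖ζ - α‖)) atTop (𝓝 0) := by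
      have := (((tendsto_pow_atTop_nhds_zero_of_lt_one (r := (1 / 2 : ℝ)) (by norm_num)
        (by norm_num)).const_mul ‖c‖).div_const 2).mul_const (Real.exp (Λ * ‖ζ - α‖))
      simpa using this
    refine squeeze_zero (fun n => norm_nonneg _) (fun n => ?_) hz
    have h := (hT _ _ (by positivity) (htail n)).bound ζ hζ
    rw [hsub _ _ _ _ (by positivity) (by positivity) (hs n) hyb hζ, Real.rpow_zero, mul_one] at h
    exact h
  have h2 : Tendsto (fun n => s (n + 1) ζ) atTop (𝓝 (c - T y ζ)) := by
    simp only [hs_succ]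
    exact h1.const_sub c
  exact tendsto_nhds_unique ((tendsto_add_atTop_iff_nat 1).2 (hlim ζ hζ)) h2

/-- If `T` halves the norms, then `y = -T y` has only the trivial solution. -/
theorem eq_zero_of_contraction {T : (ℂ → ℂ) → ℂ → ℂ}
    (hT : ∀ M y, 0 ≤ M → SingExpWith 0 Λ M α (sector α θ ω) y →
      SingExpWith 0 Λ (M / 2) α (sector α θ ω) (T y)) {y : ℂ → ℂ} (hM : 0 ≤ M)
    (hy : SingExpWith 0 Λ M α (sector α θ ω) y) (hfix : ∀ ζ ∈ sector α θ ω, y ζ = -T y ζ)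
    {ζ : ℂ} (hζ : ζ ∈ sector α θ ω) : y ζ = 0 := by
  have h : ∀ n : ℕ, SingExpWith 0 Λ (M * (1 / 2) ^ n) α (sector α θ ω) y := by
    intro n
    induction n with
    | zero => simpa using hy
    | succ n ih =>
      have h := (hT _ _ (by positivity) ih).const_mul (-1)
      rw [norm_neg, norm_one, one_mul] at h
      refine (h.congr fun ζ hζ => ?_).mono (by positivity) (le_of_eq (by rw [pow_succ]; ring)) le_rfl
      simpa using hfix ζ hζ
  have hz : Tendsto (fun n : ℕ => M * (1 / 2) ^ n * ‖ζ - α‖ ^ (0 : ℝ) * Real.exp (Λ * ‖ζ - α‖))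
      atTop (𝓝 0) := by
    have := (((tendsto_pow_atTop_nhds_zero_of_lt_one (r := (1 / 2 : ℝ)) (by norm_num)
      (by norm_num)).const_mul M).mul_const (‖ζ - α‖ ^ (0 : ℝ))).mul_const
        (Real.exp (Λ * ‖ζ - α‖))
    simpa using this
  exact norm_le_zero_iff.1 (ge_of_tendsto' hz fun n => (h n).bound ζ hζ)

end sector

/-! ### The Volterra equation -/

/-- The Taylor coefficients of `R` at `0`. -/
noncomputable def taylorCoeff (R : ℂ → ℂ) (j : ℕ) : ℂ := iteratedDeriv j R 0 / (j.factorial : ℂ)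

open Polynomial in
/-- The factorizations `P = (X + α) P₁` and `Q = τ P₁ + (X + α) S`, with the bounds on the sector
that make `α` the only singular point of the Volterra equation. -/
structure SectorFactorization (P Q P₁ S : ℂ[X]) (τ α : ℂ) (θ ω K : ℝ) : Prop where
  nonneg : 0 ≤ K
  eq_P : P = (X + C α) * P₁
  eq_Q : Q = C τ * P₁ + (X + C α) * S
  ne_zero : ∀ ζ ∈ sector α θ ω, P₁.eval (-ζ) ≠ 0
  norm_inv_le : ∀ ζ ∈ sector α θ ω, ‖(P₁.eval (-ζ))⁻¹‖ ≤ K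
  norm_quot_le : ∀ ζ ∈ sector α θ ω, ‖S.eval (-ζ) / P₁.eval (-ζ)‖ ≤ K

section volterra

variable {P Q P₁ S : Polynomial ℂ} {τ α : ℂ} {θ ω K Λ M C B : ℝ} {R y ψ : ℂ → ℂ}

namespace SectorFactorization

theorem eval_P (hF : SectorFactorization P Q P₁ S τ α θ ω K) (ζ : ℂ) :
    P.eval (-ζ) = -((ζ - α) * P₁.eval (-ζ)) := by
  rw [hF.eq_P]; simp; ring

theorem eval_Q (hF : SectorFactorization P Q P₁ S τ α θ ω K) (ζ : ℂ) :
    Q.eval (-ζ) = τ * P₁.eval (-ζ) - (ζ - α) * S.eval (-ζ) := by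
  rw [hF.eq_Q]; simp; ring

theorem singExpWith_inv (hF : SectorFactorization P Q P₁ S τ α θ ω K) :
    SingExpWith 0 0 K α (sector α θ ω) (fun ζ => (P₁.eval (-ζ))⁻¹) :=
  ⟨DifferentiableOn.inv (P₁.differentiable.comp differentiable_neg).differentiableOn hF.ne_zero,
    fun ζ hζ => by simpa using hF.norm_inv_le ζ hζ⟩

theorem singExpWith_quot (hF : SectorFactorization P Q P₁ S τ α θ ω K) :
    SingExpWith 0 0 K α (sector α θ ω) (fun ζ => S.eval (-ζ) / P₁.eval (-ζ)) :=
  ⟨DifferentiableOn.div (S.differentiable.comp differentiable_neg).differentiableOn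
    (P₁.differentiable.comp differentiable_neg).differentiableOn hF.ne_zero,
    fun ζ hζ => by simpa using hF.norm_quot_le ζ hζ⟩

end SectorFactorization

/-- The unknown `ψ` of the Volterra equation, written in terms of the unknown
`y = (ζ - α) ^ (-τ) P(-ζ) ψ`, which is regular at the tip. -/
noncomputable def ofRegular (P₁ : Polynomial ℂ) (τ α : ℂ) (θ : ℝ) (y : ℂ → ℂ) (ζ : ℂ) : ℂ :=
  -(branchPow θ (τ - 1) (ζ - α) * ((P₁.eval (-ζ))⁻¹ * y ζ))

/-- The operator `N` for which the Volterra equation becomes `y' = -N y`. -/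
noncomputable def regularOp (P₁ S : Polynomial ℂ) (R : ℂ → ℂ) (τ α : ℂ) (θ : ℝ) (y : ℂ → ℂ)
    (ζ : ℂ) : ℂ :=
  S.eval (-ζ) / P₁.eval (-ζ) * y ζ +
    branchPow θ (-τ) (ζ - α) * iteratedSeries (taylorCoeff R) α (ofRegular P₁ τ α θ y) ζ

theorem singExpWith_ofRegular (hωπ : ω ≤ Real.pi) (hF : SectorFactorization P Q P₁ S τ α θ ω K)
    (hy : SingExpWith 0 Λ M α (sector α θ ω) y) :
    SingExpWith (τ.re - 1) Λ (branchConst θ τ * (K * M)) α (sector α θ ω)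
      (ofRegular P₁ τ α θ y) := by
  have hK := hF.nonneg
  have hE : 0 ≤ branchConst θ τ := zero_le_one.trans (one_le_branchConst θ τ)
  have h1 := (singExpWith_branchPow (α := α) (θ := θ) hωπ (τ - 1)).mul
    (zero_le_one.trans (one_le_branchConst θ _)) (hF.singExpWith_inv.mul hK hy)
  have h2 := h1.const_mul (-1)
  have e : branchConst θ (τ - 1) = branchConst θ τ := by simp [branchConst]
  simp only [norm_neg, norm_one, one_mul, zero_add, add_zero, Complex.sub_re, Complex.one_re, e]
    at h2
  exact h2.congr fun ζ _ => by simp [ofRegular]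

/-- The norm of `regularOp` in the spaces of exponential type is bounded uniformly in the type. -/
noncomputable def regularOpConst (τ : ℂ) (θ K C : ℝ) : ℝ :=
  K + branchConst θ τ * (2 * (C * (branchConst θ τ * K / τ.re)))

theorem regularOpConst_nonneg (hτ : 0 < τ.re) (hK : 0 ≤ K) (hC : 0 ≤ C) :
    0 ≤ regularOpConst τ θ K C := by
  have : 0 ≤ branchConst θ τ := zero_le_one.trans (one_le_branchConst θ τ)
  unfold regularOpConst
  positivity

theorem singExpWith_regularOp (hω : 0 < ω) (hωπ : ω ≤ Real.pi) (hτ : 0 < τ.re)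
    (hF : SectorFactorization P Q P₁ S τ α θ ω K) (hB : 0 < B)
    (hc : ∀ j, ‖taylorCoeff R j‖ ≤ C * B ^ j) (hΛ : 2 * B ≤ Λ)
    (hM : 0 ≤ M) (hy : SingExpWith 0 Λ M α (sector α θ ω) y) :
    SingExpWith 0 Λ (regularOpConst τ θ K C * M) α (sector α θ ω)
      (regularOp P₁ S R τ α θ y) := by
  have hE : 0 ≤ branchConst θ τ := zero_le_one.trans (one_le_branchConst θ τ)
  have hK := hF.nonneg
  have h1 := hF.singExpWith_quot.mul hK hy
  have h2 := (singExpWith_ofRegular hωπ hF hy).iteratedSeries hω hωπ (by linarith) hB hc hΛ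
    (by positivity)
  have h3 := (singExpWith_branchPow (α := α) (θ := θ) hωπ (-τ)).mul
    (zero_le_one.trans (one_le_branchConst θ _)) h2
  simp only [branchConst_neg, Complex.neg_re, sub_add_cancel, neg_add_cancel, zero_add] at h1 h3
  have h4 := h1.add h3
  have e : K * M + branchConst θ τ * (2 * (C * (branchConst θ τ * (K * M) / τ.re))) =
      regularOpConst τ θ K C * M := by
    rw [regularOpConst]; ring
  rw [e] at h4
  exact h4

theorem regularOp_sub (hω : 0 < ω) (hωπ : ω ≤ Real.pi) (hτ : 0 < τ.re)
    (hF : SectorFactorization P Q P₁ S τ α θ ω K) (hB : 0 < B)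
    (hc : ∀ j, ‖taylorCoeff R j‖ ≤ C * B ^ j) (hΛ : 2 * B ≤ Λ) {M' : ℝ} {y' : ℂ → ℂ}
    (hM : 0 ≤ M) (hM' : 0 ≤ M') (hy : SingExpWith 0 Λ M α (sector α θ ω) y)
    (hy' : SingExpWith 0 Λ M' α (sector α θ ω) y') :
    EqOn (regularOp P₁ S R τ α θ fun ζ => y ζ - y' ζ)
      (fun ζ => regularOp P₁ S R τ α θ y ζ - regularOp P₁ S R τ α θ y' ζ) (sector α θ ω) := by
  intro ζ hζ
  have hE : 0 ≤ branchConst θ τ := zero_le_one.trans (one_le_branchConst θ τ)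
  have hK := hF.nonneg
  have e : ofRegular P₁ τ α θ (fun ζ => y ζ - y' ζ) =
      fun ζ => ofRegular P₁ τ α θ y ζ - ofRegular P₁ τ α θ y' ζ := by
    ext ζ; simp only [ofRegular]; ring
  simp only [regularOp]
  rw [e, iteratedSeries_sub hω hωπ (by linarith) hB hc hΛ (by positivity) (by positivity)
    (singExpWith_ofRegular hωπ hF hy) (singExpWith_ofRegular hωπ hF hy') hζ]
  ring

/-- For a large exponential type the integrated operator is a contraction. -/
theorem singExpWith_integralFrom_regularOp (hω : 0 < ω) (hωπ : ω ≤ Real.pi) (hτ : 0 < τ.re)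
    (hF : SectorFactorization P Q P₁ S τ α θ ω K) (hB : 0 < B)
    (hc : ∀ j, ‖taylorCoeff R j‖ ≤ C * B ^ j) (hΛ : 2 * B ≤ Λ)
    (hΛ' : 2 * regularOpConst τ θ K C ≤ Λ)
    (hM : 0 ≤ M) (hy : SingExpWith 0 Λ M α (sector α θ ω) y) :
    SingExpWith 0 Λ (M / 2) α (sector α θ ω) (integralFrom α (regularOp P₁ S R τ α θ y)) := by
  have hΛ0 : 0 < Λ := by linarith
  have hC : 0 ≤ C := by simpa using (norm_nonneg _).trans (hc 0)
  have hN := regularOpConst_nonneg (θ := θ) hτ hF.nonneg hC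
  refine ((singExpWith_regularOp hω hωπ hτ hF hB hc hΛ hM hy).integralFrom' hω hωπ le_rfl hΛ0
    (by positivity)).mono (by positivity) ?_ le_rfl
  rw [div_le_div_iff₀ hΛ0 two_pos]
  nlinarith

theorem exists_regular_solution (hω : 0 < ω) (hωπ : ω ≤ Real.pi) (hτ : 0 < τ.re)
    (hF : SectorFactorization P Q P₁ S τ α θ ω K) (hB : 0 < B)
    (hc : ∀ j, ‖taylorCoeff R j‖ ≤ C * B ^ j) (hΛ : 2 * B ≤ Λ)
    (hΛ' : 2 * regularOpConst τ θ K C ≤ Λ) (y₀ : ℂ) :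
    ∃ (y : ℂ → ℂ) (M : ℝ), 0 ≤ M ∧ SingExpWith 0 Λ M α (sector α θ ω) y ∧
      ∀ ζ ∈ sector α θ ω, y ζ = y₀ - integralFrom α (regularOp P₁ S R τ α θ y) ζ := by
  have hC : 0 ≤ C := by simpa using (norm_nonneg _).trans (hc 0)
  have hN := regularOpConst_nonneg (θ := θ) hτ hF.nonneg hC
  refine exists_fixed_point hω hωπ (by linarith)
    (T := fun y => integralFrom α (regularOp P₁ S R τ α θ y))
    (fun M y hM hy => singExpWith_integralFrom_regularOp hω hωπ hτ hF hB hc hΛ hΛ' hM hy)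
    (fun M M' y y' hM hM' hy hy' ζ hζ => ?_) y₀
  simp only
  rw [integralFrom_congr (regularOp_sub hω hωπ hτ hF hB hc hΛ hM hM' hy hy') hζ]
  exact integralFrom_sub (by norm_num) (by norm_num)
    (singExpWith_regularOp hω hωπ hτ hF hB hc hΛ hM hy)
    (singExpWith_regularOp hω hωπ hτ hF hB hc hΛ hM' hy') hζ

/-- A solution of the regularized equation solves the Volterra equation. -/
theorem solvesVolterra_ofRegular (hω : 0 < ω) (hωπ : ω ≤ Real.pi) (hτ : 0 < τ.re)
    (hF : SectorFactorization P Q P₁ S τ α θ ω K) (hB : 0 < B)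
    (hc : ∀ j, ‖taylorCoeff R j‖ ≤ C * B ^ j) (hΛ : 2 * B ≤ Λ) (hM : 0 ≤ M)
    (hy : SingExpWith 0 Λ M α (sector α θ ω) y) {y₀ : ℂ}
    (hfix : ∀ ζ ∈ sector α θ ω, y ζ = y₀ - integralFrom α (regularOp P₁ S R τ α θ y) ζ) :
    SolvesVolterra P Q R α (sector α θ ω) (ofRegular P₁ τ α θ y) := by
  have hopen : IsOpen (sector α θ ω) := isOpen_sector hω hωπ
  have hE : 0 ≤ branchConst θ τ := zero_le_one.trans (one_le_branchConst θ τ)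
  have hK := hF.nonneg
  have hC : 0 ≤ C := by simpa using (norm_nonneg _).trans (hc 0)
  have hΛ0 : 0 < Λ := by linarith
  set ψ := ofRegular P₁ τ α θ y with hψdef
  have hψ := singExpWith_ofRegular hωπ hF hy
  have hSψ := hψ.iteratedSeries hω hωπ (by linarith) hB hc hΛ (by positivity)
  obtain ⟨K', hK', hQψ⟩ := hψ.eval_neg_mul (by positivity) Q
  have hSψ' := hSψ.lower (by rw [sub_add_cancel]; positivity)
  have hN := regularOpConst_nonneg (θ := θ) hτ hF.nonneg hC
  have hder : ∀ ζ ∈ sector α θ ω, HasDerivAt (fun ζ => branchPow θ τ (ζ - α) * y ζ)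
      (-1 * (Q.eval (-ζ) * ψ ζ + iteratedSeries (taylorCoeff R) α ψ ζ)) ζ := by
    intro ζ hζ
    have hy' : HasDerivAt y (-regularOp P₁ S R τ α θ y ζ) ζ := by
      have h := ((hasDerivAt_integralFrom hω hωπ (by norm_num) (by positivity)
        (singExpWith_regularOp hω hωπ hτ hF hB hc hΛ hM hy) hζ).const_sub y₀)
      exact h.congr_of_eventuallyEq (by
        filter_upwards [hopen.mem_nhds hζ] with ξ hξ using hfix ξ hξ)
    refine ((hasDerivAt_branchPow_sub hωπ τ hζ).mul hy').congr_deriv ?_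
    have h0 := sector_sub_ne_zero hζ
    have h1 := hF.ne_zero ζ hζ
    have h2 := branchPow_sub_one_mul θ τ h0
    have h3 := branchPow_neg_mul_self θ τ (ζ - α)
    rw [regularOp, ← hψdef, hF.eval_Q]
    have h4 : ψ ζ = -(branchPow θ (τ - 1) (ζ - α) * ((P₁.eval (-ζ))⁻¹ * y ζ)) := rfl
    rw [h4, ← h2]
    have h5 : branchPow θ (τ - 1) (ζ - α) * (ζ - α) * branchPow θ (-τ) (ζ - α) = 1 := by
      rw [h2, mul_comm, h3]
    field_simp
    linear_combination (-(iteratedSeries (taylorCoeff R) α ψ ζ) * P₁.eval (-ζ)) * h5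
  have hdb := (hQψ.add hSψ').const_mul (-1)
  have htip : SingExpWith τ.re Λ (branchConst θ τ * M) α (sector α θ ω)
      (fun ζ => branchPow θ τ (ζ - α) * y ζ) := by
    have := (singExpWith_branchPow (α := α) (θ := θ) hωπ τ).mul hE hy
    simpa using this
  intro ζ hζ
  have hw := eq_add_integralFrom hω hωπ (by linarith) (by linarith)
    (by rw [sub_add_cancel]; positivity) hdb hder hζ
    (htip.tendsto_tip hτ hζ)
  rw [zero_add, integralFrom_const_mul, integralFrom_add (by linarith) (by linarith) hQψ hSψ' hζ]
    at hw
  have hsum := hasSum_integralFrom_iteratedSeries hω hωπ (by linarith) hB hc hΛ (by positivity)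
    hψ hζ
  have h0 := sector_sub_ne_zero hζ
  have h1 := hF.ne_zero ζ hζ
  have h2 := branchPow_sub_one_mul θ τ h0
  have h4 : P.eval (-ζ) * ψ ζ = branchPow θ τ (ζ - α) * y ζ := by
    rw [hF.eval_P, hψdef, ofRegular, ← h2]
    field_simp
  have h5 : -(P.eval (-ζ) * ψ ζ + integralFrom α (fun ξ => Q.eval (-ξ) * ψ ξ) ζ) =
      integralFrom α (iteratedSeries (taylorCoeff R) α ψ) ζ := by
    rw [h4, hw]; ring
  rw [h5]
  exact hsum

/-- The homogeneous Volterra equation has only the trivial solution of order `Re τ`. -/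
theorem eq_zero_of_solvesVolterra (hω : 0 < ω) (hωπ : ω ≤ Real.pi) (hτ : 0 < τ.re)
    (hF : SectorFactorization P Q P₁ S τ α θ ω K) (hB : 0 < B)
    (hc : ∀ j, ‖taylorCoeff R j‖ ≤ C * B ^ j)
    (hψ : IsSingExp τ.re α (sector α θ ω) ψ)
    (hV : SolvesVolterra P Q R α (sector α θ ω) ψ) : EqOn ψ 0 (sector α θ ω) := by
  have hopen : IsOpen (sector α θ ω) := isOpen_sector hω hωπ
  have hE : 0 ≤ branchConst θ τ := zero_le_one.trans (one_le_branchConst θ τ)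
  have hK := hF.nonneg
  have hC : 0 ≤ C := by simpa using (norm_nonneg _).trans (hc 0)
  have hN := regularOpConst_nonneg (θ := θ) hτ hF.nonneg hC
  obtain ⟨Λ₀, M, hΛ₀, hM, hψ⟩ := hψ.exists_singExpWith
  obtain ⟨Λ, h1, h2, h3⟩ : ∃ Λ, Λ₀ ≤ Λ ∧ 2 * B ≤ Λ ∧ 2 * regularOpConst τ θ K C ≤ Λ :=
    ⟨max Λ₀ (max (2 * B) (2 * regularOpConst τ θ K C)), le_max_left _ _,
      (le_max_left _ _).trans (le_max_right _ _), (le_max_right _ _).trans (le_max_right _ _)⟩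
  replace hψ := hψ Λ h1
  have hΛ0 : 0 < Λ := by linarith
  have hSψ := hψ.iteratedSeries hω hωπ (by linarith) hB hc h2 (by positivity)
  have hSψ' := (hSψ.lower (by positivity)).mono (by positivity) le_rfl
    (show Λ + 1 ≤ Λ + 1 + 1 by linarith)
  obtain ⟨KQ, hKQ, hQψ⟩ := hψ.eval_neg_mul hM Q
  obtain ⟨KP, hKP, hPψ⟩ := hψ.eval_neg_mul hM P₁
  -- `w = P(-ζ) ψ` has the derivative that the differentiated equation prescribes.
  have hw : ∀ ζ ∈ sector α θ ω, P.eval (-ζ) * ψ ζ =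
      -(integralFrom α (fun ξ => Q.eval (-ξ) * ψ ξ) ζ +
        integralFrom α (iteratedSeries (taylorCoeff R) α ψ) ζ) := by
    intro ζ hζ
    have hsum := hasSum_integralFrom_iteratedSeries hω hωπ (by linarith) hB hc h2 (by positivity)
      hψ hζ
    have := hsum.unique (hV ζ hζ)
    rw [this]; ring
  set y : ℂ → ℂ := fun ζ => branchPow θ (-τ) (ζ - α) * (P.eval (-ζ) * ψ ζ) with hydef
  have hψy : EqOn (ofRegular P₁ τ α θ y) ψ (sector α θ ω) := by
    intro ζ hζ
    have h0 := sector_sub_ne_zero hζ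
    have h1 := hF.ne_zero ζ hζ
    have h2 := branchPow_sub_one_mul θ τ h0
    have h3 := branchPow_neg_mul_self θ τ (ζ - α)
    rw [← h2] at h3
    simp only [ofRegular, hydef]
    rw [hF.eval_P]
    field_simp
    linear_combination (ψ ζ) * h3
  have hder : ∀ ζ ∈ sector α θ ω,
      HasDerivAt y (-1 * regularOp P₁ S R τ α θ y ζ) ζ := by
    intro ζ hζ
    have d1 : HasDerivAt (fun ζ => P.eval (-ζ) * ψ ζ)
        (-(Q.eval (-ζ) * ψ ζ + iteratedSeries (taylorCoeff R) α ψ ζ)) ζ := by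
      have h := ((hasDerivAt_integralFrom hω hωπ (by linarith) hKQ hQψ hζ).add
        (hasDerivAt_integralFrom hω hωπ (by linarith) (by positivity) hSψ hζ)).neg
      exact h.congr_of_eventuallyEq (by
        filter_upwards [hopen.mem_nhds hζ] with ξ hξ using hw ξ hξ)
    refine ((hasDerivAt_branchPow_sub hωπ (-τ) hζ).mul d1).congr_deriv ?_
    have h0 := sector_sub_ne_zero hζ
    have h1 := hF.ne_zero ζ hζ
    rw [regularOp, iteratedSeries_congr hψy hζ, hF.eval_Q, hydef]
    simp only [hF.eval_P]
    field_simp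
    ring
  have hyb : SingExpWith 1 (Λ + 1) (branchConst θ τ * KP) α (sector α θ ω) y := by
    have hlin : SingExpWith 1 0 1 α (sector α θ ω) (fun ζ => ζ - α) :=
      ⟨by fun_prop, fun ζ _ => by simp⟩
    have h := ((singExpWith_branchPow (α := α) (θ := θ) hωπ (-τ)).mul
      (zero_le_one.trans (one_le_branchConst θ _)) (hlin.mul zero_le_one hPψ)).const_mul (-1)
    simp only [branchConst_neg, Complex.neg_re, norm_neg, norm_one, one_mul, zero_add] at h
    rw [show -τ.re + (1 + τ.re) = 1 by ring] at h
    exact h.congr fun ζ _ => by simp only [hydef, hF.eval_P]; ring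
  have hyb0 : SingExpWith 0 (Λ + 1 + 1) (branchConst θ τ * KP) α (sector α θ ω) y :=
    SingExpWith.lower (by positivity) (by simpa using hyb)
  have hNy := singExpWith_regularOp hω hωπ hτ hF hB hc (show 2 * B ≤ Λ + 1 + 1 by linarith)
    (by positivity) hyb0
  have hzero : ∀ ζ ∈ sector α θ ω, y ζ = 0 := fun ζ hζ =>
    eq_zero_of_contraction (T := fun y => integralFrom α (regularOp P₁ S R τ α θ y))
      (fun M y hM hy => singExpWith_integralFrom_regularOp hω hωπ hτ hF hB hc (by linarith)
        (show _ ≤ Λ + 1 + 1 by linarith) hM hy) (by positivity) hyb0 (fun ζ hζ => by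
          have h := eq_add_integralFrom hω hωπ (by norm_num) (by linarith) (by positivity)
            (hNy.const_mul (-1)) hder hζ (hyb.tendsto_tip one_pos hζ)
          rw [h, integralFrom_const_mul]
          ring) hζ
  intro ζ hζ
  rw [← hψy hζ, ofRegular, hzero ζ hζ]
  simp

end volterra

/-! ### The solution on the position domain -/

section position

variable {P Q P₁ S : Polynomial ℂ} {τ α : ℂ} {θ ω K C B : ℝ} {R ψ φ : ℂ → ℂ}

theorem InPositionAffine.isSingExp (hωπ : ω ≤ Real.pi) (h : InPositionAffine τ α θ ω ψ) :
    IsSingExp (τ.re - 1) α (sector α θ ω) ψ := by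
  obtain ⟨Λ₀, M, hΛ₀, hM, hφ⟩ := h.exists_singExpWith
  have h1 := SingExpWith.lower (σ := τ.re - 1) hM (by simpa using hφ Λ₀ le_rfl)
  have h2 := ((singExpWith_branchPow (α := α) (θ := θ) hωπ (τ - 1)).const_mul
    (Complex.Gamma τ)⁻¹).mono (mul_nonneg (norm_nonneg _)
      (zero_le_one.trans (one_le_branchConst θ _))) le_rfl (show 0 ≤ Λ₀ + 1 by linarith)
  simp only [Complex.sub_re, Complex.one_re] at h2
  exact ((h1.add h2).congr fun ζ _ => by ring).isSingExp

open Polynomial in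
/-- The regularized solution whose value at the tip is `-P₁(-α) / Γ(τ)` gives a solution with the
leading term `(ζ - α) ^ (τ - 1) / Γ(τ)`. -/
theorem exists_solvesVolterra (hω : 0 < ω) (hωπ : ω ≤ Real.pi) (hτ : 0 < τ.re)
    (hF : SectorFactorization P Q P₁ S τ α θ ω K) (hB : 0 < B)
    (hc : ∀ j, ‖taylorCoeff R j‖ ≤ C * B ^ j) {T : ℂ[X]}
    (hT : P₁ = (X + Polynomial.C α) * T + Polynomial.C (P₁.eval (-α)))
    (hTK : ∀ ζ ∈ sector α θ ω, ‖T.eval (-ζ) / P₁.eval (-ζ)‖ ≤ K) :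
    ∃ ψ, InPositionAffine τ α θ ω ψ ∧ SolvesVolterra P Q R α (sector α θ ω) ψ := by
  have hE : 0 ≤ branchConst θ (τ - 1) := zero_le_one.trans (one_le_branchConst θ _)
  have hK := hF.nonneg
  have hC : 0 ≤ C := by simpa using (norm_nonneg _).trans (hc 0)
  have hN := regularOpConst_nonneg (θ := θ) hτ hF.nonneg hC
  set Λ := max (2 * B) (2 * regularOpConst τ θ K C) with hΛ
  have h1 : 2 * B ≤ Λ := le_max_left _ _
  set y₀ : ℂ := -P₁.eval (-α) / Complex.Gamma τ with hy₀
  obtain ⟨y, M, hM, hy, hfix⟩ :=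
    exists_regular_solution hω hωπ hτ hF hB hc h1 (le_max_right _ _) y₀
  refine ⟨ofRegular P₁ τ α θ y, ?_, solvesVolterra_ofRegular hω hωπ hτ hF hB hc h1 hM hy hfix⟩
  have hd : SingExpWith 1 Λ (regularOpConst τ θ K C * M) α (sector α θ ω) (fun ζ => y ζ - y₀) := by
    have h := ((singExpWith_regularOp hω hωπ hτ hF hB hc h1 hM hy).integralFrom hω hωπ
      (by norm_num) (by linarith) (by positivity)).const_mul (-1)
    simp only [zero_add, norm_neg, norm_one, one_mul, div_one] at h
    exact h.congr fun ζ hζ => by rw [hfix ζ hζ]; ring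
  have hT' : SingExpWith 0 0 K α (sector α θ ω) (fun ζ => T.eval (-ζ) / P₁.eval (-ζ)) :=
    ⟨DifferentiableOn.div (T.differentiable.comp differentiable_neg).differentiableOn
      (P₁.differentiable.comp differentiable_neg).differentiableOn hF.ne_zero,
      fun ζ hζ => by simpa using hTK ζ hζ⟩
  have hlin : SingExpWith 1 0 1 α (sector α θ ω) (fun ζ => ζ - α) :=
    ⟨by fun_prop, fun ζ _ => by simp⟩
  have e1 := hF.singExpWith_inv.mul hK hd
  have e2 := (((hlin.mul zero_le_one hT').const_mul (-(Complex.Gamma τ)⁻¹))).mono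
    (by positivity) le_rfl (show 0 + 0 ≤ 0 + Λ by linarith)
  simp only [zero_add, add_zero] at e1 e2
  have e3 := ((singExpWith_branchPow (α := α) (θ := θ) hωπ (τ - 1)).mul hE
    (e1.add e2)).const_mul (-1)
  simp only [Complex.sub_re, Complex.one_re, sub_add_cancel] at e3
  refine (e3.congr fun ζ hζ => ?_).isSingExp
  have h0 := hF.ne_zero ζ hζ
  have h2 : P₁.eval (-ζ) = -(ζ - α) * T.eval (-ζ) + P₁.eval (-α) := by
    conv_lhs => rw [hT]
    simp only [eval_add, eval_mul, eval_X, eval_C]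
    ring
  have h3 : (P₁.eval (-ζ))⁻¹ * P₁.eval (-ζ) = 1 := inv_mul_cancel₀ h0
  simp only [ofRegular]
  rw [hy₀, div_eq_mul_inv, div_eq_mul_inv, div_eq_mul_inv]
  set u := (P₁.eval (-ζ))⁻¹
  rw [h2] at h3
  linear_combination (branchPow θ (τ - 1) (ζ - α) * (Complex.Gamma τ)⁻¹) * h3

theorem eqOn_of_solvesVolterra (hω : 0 < ω) (hωπ : ω ≤ Real.pi) (hτ : 0 < τ.re)
    (hF : SectorFactorization P Q P₁ S τ α θ ω K) (hB : 0 < B)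
    (hc : ∀ j, ‖taylorCoeff R j‖ ≤ C * B ^ j)
    (hψ : InPositionAffine τ α θ ω ψ) (hψV : SolvesVolterra P Q R α (sector α θ ω) ψ)
    (hφ : InPositionAffine τ α θ ω φ) (hφV : SolvesVolterra P Q R α (sector α θ ω) φ) :
    EqOn φ ψ (sector α θ ω) := by
  have hd : IsSingExp τ.re α (sector α θ ω) (fun ζ => φ ζ - ψ ζ) := by
    obtain ⟨Λ₁, M₁, _, hM₁, h₁⟩ := hφ.exists_singExpWith
    obtain ⟨Λ₂, M₂, _, hM₂, h₂⟩ := hψ.exists_singExpWith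
    exact (((h₁ (max Λ₁ Λ₂) (le_max_left _ _)).sub (h₂ _ (le_max_right _ _))).congr
      fun ζ _ => by ring).isSingExp
  obtain ⟨Λ₁, M₁, hΛ₁, hM₁, h₁⟩ := (hφ.isSingExp hωπ).exists_singExpWith
  obtain ⟨Λ₂, M₂, hΛ₂, hM₂, h₂⟩ := (hψ.isSingExp hωπ).exists_singExpWith
  set Λ := max Λ₁ Λ₂ + 1
  have l1 : Λ₁ ≤ Λ := (le_max_left Λ₁ Λ₂).trans (by simp [Λ])
  have l2 : Λ₂ ≤ Λ := (le_max_right Λ₁ Λ₂).trans (by simp [Λ])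
  have hΛ : 0 < Λ := by
    have := le_max_left Λ₁ Λ₂
    simp only [Λ]; linarith
  replace h₁ := h₁ Λ l1
  replace h₂ := h₂ Λ l2
  obtain ⟨N₁, hN₁, hQ₁⟩ := h₁.eval_neg_mul hM₁ Q
  obtain ⟨N₂, hN₂, hQ₂⟩ := h₂.eval_neg_mul hM₂ Q
  have hV : SolvesVolterra P Q R α (sector α θ ω) (fun ζ => φ ζ - ψ ζ) := by
    intro ζ hζ
    have h := (hφV ζ hζ).sub (hψV ζ hζ)
    have e : -(P.eval (-ζ) * (φ ζ - ψ ζ) +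
        integralFrom α (fun ξ => Q.eval (-ξ) * (φ ξ - ψ ξ)) ζ) =
        -(P.eval (-ζ) * φ ζ + integralFrom α (fun ξ => Q.eval (-ξ) * φ ξ) ζ) -
        -(P.eval (-ζ) * ψ ζ + integralFrom α (fun ξ => Q.eval (-ξ) * ψ ξ) ζ) := by
      have := integralFrom_sub (by linarith) (by linarith) hQ₁ hQ₂ hζ
      simp only [mul_sub]
      rw [this]
      ring
    rw [e]
    refine h.congr_fun fun j => ?_
    rw [iterate_integralFrom_sub hω hωπ (by linarith) hΛ hM₁ hM₂ h₁ h₂ (j + 1) hζ]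
    ring
  intro ζ hζ
  exact sub_eq_zero.1 (eq_zero_of_solvesVolterra hω hωπ hτ hF hB hc hd hV hζ)

end position

/-! ### The Laplace transform along a ray -/

section laplace

variable {α : ℂ} {θ ω σ Λ M η : ℝ} {f : ℂ → ℂ} {z : ℂ}

/-- The Laplace integral along the ray from `α` in direction `η`. -/
noncomputable def rayLaplace (α : ℂ) (η : ℝ) (f : ℂ → ℂ) (z : ℂ) : ℂ :=
  ∫ r in Ioi (0 : ℝ), laplaceIntegrand α η f z r

theorem norm_exp_ray (α z : ℂ) (η r : ℝ) :
    ‖Complex.exp (-(z * (α + r * Complex.exp (η * Complex.I))))‖ =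
      ‖Complex.exp (-(α * z))‖ * Real.exp (-((Complex.exp (η * Complex.I) * z).re * r)) := by
  have e : -(z * (α + r * Complex.exp (η * Complex.I))) =
      -(α * z) + -((r : ℂ) * (Complex.exp (η * Complex.I) * z)) := by ring
  rw [e, Complex.exp_add, norm_mul, Complex.norm_exp (-((r : ℂ) * _)), Complex.neg_re,
    Complex.re_ofReal_mul, mul_comm r]

theorem norm_laplaceIntegrand_le (hη : η ∈ Ioo (θ - ω / 2) (θ + ω / 2))
    (hf : SingExpWith σ Λ M α (sector α θ ω) f) {r : ℝ} (hr : 0 < r) (z : ℂ) :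
    ‖laplaceIntegrand α η f z r‖ ≤ ‖Complex.exp (-(α * z))‖ * M *
      (r ^ σ * Real.exp (-((Complex.exp (η * Complex.I) * z).re - Λ) * r)) := by
  have h := hf.bound _ (ray_mem_sector hη hr)
  rw [norm_ray_sub α η hr.le] at h
  rw [laplaceIntegrand, norm_mul, norm_mul, Complex.norm_exp_ofReal_mul_I, mul_one, norm_exp_ray]
  calc _ ≤ ‖Complex.exp (-(α * z))‖ * Real.exp (-((Complex.exp (η * Complex.I) * z).re * r)) *
        (M * r ^ σ * Real.exp (Λ * r)) := by gcongr
    _ = ‖Complex.exp (-(α * z))‖ * M * (r ^ σ *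
        (Real.exp (-((Complex.exp (η * Complex.I) * z).re * r)) * Real.exp (Λ * r))) := by ring
    _ = _ := by rw [← Real.exp_add]; ring_nf

theorem continuousOn_laplaceIntegrand (hη : η ∈ Ioo (θ - ω / 2) (θ + ω / 2))
    (hf : ContinuousOn f (sector α θ ω)) (z : ℂ) :
    ContinuousOn (laplaceIntegrand α η f z) (Ioi 0) := by
  have : ContinuousOn (fun r : ℝ => f (α + r * Complex.exp (η * Complex.I))) (Ioi 0) :=
    hf.comp (by fun_prop) fun r hr => ray_mem_sector hη hr
  have h1 : Continuous fun r : ℝ => Complex.exp (-(z * (α + r * Complex.exp (η * Complex.I)))) := by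
    fun_prop
  exact (h1.continuousOn.mul this).mul continuousOn_const

theorem integrableOn_rpow_mul_exp (hσ : -1 < σ) {b : ℝ} (hb : 0 < b) :
    MeasureTheory.IntegrableOn (fun r : ℝ => r ^ σ * Real.exp (-b * r)) (Ioi 0) := by
  simpa using integrableOn_rpow_mul_exp_neg_mul_rpow hσ one_pos hb

theorem integrableOn_laplaceIntegrand (hη : η ∈ Ioo (θ - ω / 2) (θ + ω / 2)) (hσ : -1 < σ)
    (hf : SingExpWith σ Λ M α (sector α θ ω) f) (hz : Λ < (Complex.exp (η * Complex.I) * z).re) :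
    MeasureTheory.IntegrableOn (laplaceIntegrand α η f z) (Ioi 0) := by
  refine ((integrableOn_rpow_mul_exp hσ (sub_pos.2 hz)).const_mul
    (‖Complex.exp (-(α * z))‖ * M)).mono' ?_ ?_
  · exact (continuousOn_laplaceIntegrand hη hf.diff.continuousOn z).aestronglyMeasurable
      measurableSet_Ioi
  · exact (MeasureTheory.ae_restrict_iff' measurableSet_Ioi).2 (Eventually.of_forall
      fun r hr => norm_laplaceIntegrand_le hη hf hr z)

theorem norm_rayLaplace_le (hη : η ∈ Ioo (θ - ω / 2) (θ + ω / 2)) (hσ : -1 < σ)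
    (hf : SingExpWith σ Λ M α (sector α θ ω) f) (hz : Λ < (Complex.exp (η * Complex.I) * z).re) :
    ‖rayLaplace α η f z‖ ≤ ‖Complex.exp (-(α * z))‖ * (M * Real.Gamma (σ + 1)) *
      ((Complex.exp (η * Complex.I) * z).re - Λ) ^ (-(σ + 1)) := by
  have hb := sub_pos.2 hz
  refine (MeasureTheory.norm_integral_le_of_norm_le
    ((integrableOn_rpow_mul_exp hσ hb).const_mul (‖Complex.exp (-(α * z))‖ * M))
    ((MeasureTheory.ae_restrict_iff' measurableSet_Ioi).2 (Eventually.of_forall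
      fun r hr => norm_laplaceIntegrand_le hη hf hr z))).trans_eq ?_
  have h := Real.integral_rpow_mul_exp_neg_mul_Ioi (show 0 < σ + 1 by linarith) hb
  simp only [add_sub_cancel_right] at h
  simp only [neg_mul] at h ⊢
  rw [MeasureTheory.integral_const_mul, h, one_div, Real.inv_rpow hb.le, Real.rpow_neg hb.le]
  ring

theorem rayLaplace_const_mul (c : ℂ) :
    rayLaplace α η (fun ζ => c * f ζ) z = c * rayLaplace α η f z := by
  rw [rayLaplace, rayLaplace, ← MeasureTheory.integral_const_mul]
  congr 1
  ext r
  simp only [laplaceIntegrand]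
  ring

theorem rayLaplace_add {g : ℂ → ℂ} {σ' M' : ℝ} (hη : η ∈ Ioo (θ - ω / 2) (θ + ω / 2))
    (hσ : -1 < σ) (hσ' : -1 < σ')
    (hf : SingExpWith σ Λ M α (sector α θ ω) f) (hg : SingExpWith σ' Λ M' α (sector α θ ω) g)
    (hz : Λ < (Complex.exp (η * Complex.I) * z).re) :
    rayLaplace α η (fun ζ => f ζ + g ζ) z = rayLaplace α η f z + rayLaplace α η g z := by
  rw [rayLaplace, rayLaplace, rayLaplace,
    ← MeasureTheory.integral_add (integrableOn_laplaceIntegrand hη hσ hf hz)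
      (integrableOn_laplaceIntegrand hη hσ' hg hz)]
  congr 1
  ext r
  simp only [laplaceIntegrand]
  ring

theorem rayLaplace_congr {g : ℂ → ℂ} (hη : η ∈ Ioo (θ - ω / 2) (θ + ω / 2))
    (h : EqOn f g (sector α θ ω)) : rayLaplace α η f z = rayLaplace α η g z := by
  refine MeasureTheory.setIntegral_congr_fun measurableSet_Ioi fun r hr => ?_
  simp only [laplaceIntegrand]
  rw [h (ray_mem_sector hη hr)]

/-- Differentiation of the Laplace transform corresponds to multiplication by `-ζ`. -/
theorem hasDerivAt_rayLaplace {M' : ℝ} (hη : η ∈ Ioo (θ - ω / 2) (θ + ω / 2)) (hσ : -1 < σ)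
    (hM' : 0 ≤ M') (hf : SingExpWith σ Λ M α (sector α θ ω) f)
    (hf' : SingExpWith σ Λ M' α (sector α θ ω) (fun ζ => -ζ * f ζ))
    (hz : Λ < (Complex.exp (η * Complex.I) * z).re) :
    HasDerivAt (rayLaplace α η f) (rayLaplace α η (fun ζ => -ζ * f ζ) z) z := by
  set x := (Complex.exp (η * Complex.I) * z).re with hx
  set b := (x - Λ) / 2 with hb
  have hb0 : 0 < b := half_pos (sub_pos.2 hz)
  have hopen : IsOpen {w : ℂ | Λ + b < (Complex.exp (η * Complex.I) * w).re ∧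
      ‖Complex.exp (-(α * w))‖ < ‖Complex.exp (-(α * z))‖ + 1} := by
    rw [ofPred_and]
    exact (isOpen_lt (by fun_prop) (by fun_prop)).inter (isOpen_lt (by fun_prop) (by fun_prop))
  have hmem : {w : ℂ | Λ + b < (Complex.exp (η * Complex.I) * w).re ∧
      ‖Complex.exp (-(α * w))‖ < ‖Complex.exp (-(α * z))‖ + 1} ∈ 𝓝 z :=
    hopen.mem_nhds ⟨by rw [← hx, hb]; linarith, lt_add_one ‖Complex.exp (-(α * z))‖⟩
  refine (hasDerivAt_integral_of_dominated_loc_of_deriv_le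
    (F := fun z r => laplaceIntegrand α η f z r)
    (F' := fun z r => laplaceIntegrand α η (fun ζ => -ζ * f ζ) z r)
    (bound := fun r => (‖Complex.exp (-(α * z))‖ + 1) * M' * (r ^ σ * Real.exp (-b * r)))
    hmem ?_ (integrableOn_laplaceIntegrand hη hσ hf hz)
    (integrableOn_laplaceIntegrand hη hσ hf' hz).aestronglyMeasurable ?_
    ((integrableOn_rpow_mul_exp hσ hb0).const_mul _) ?_).2
  · exact Eventually.of_forall fun w => (continuousOn_laplaceIntegrand hη
      hf.diff.continuousOn w).aestronglyMeasurable measurableSet_Ioi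
  · refine (MeasureTheory.ae_restrict_iff' measurableSet_Ioi).2 (Eventually.of_forall
      fun r hr w hw => (norm_laplaceIntegrand_le hη hf' hr w).trans ?_)
    have hr0 : 0 < r := hr
    have h1 : -((Complex.exp (η * Complex.I) * w).re - Λ) * r ≤ -b * r :=
      mul_le_mul_of_nonneg_right (by linarith [hw.1]) hr0.le
    have h2 := hw.2.le
    gcongr
  · refine (MeasureTheory.ae_restrict_iff' measurableSet_Ioi).2 (Eventually.of_forall
      fun r hr w hw => ?_)
    have h := (((((hasDerivAt_id w).mul_const
      (α + r * Complex.exp (η * Complex.I))).neg).cexp).mul_const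
        (f (α + r * Complex.exp (η * Complex.I)))).mul_const (Complex.exp (η * Complex.I))
    refine h.congr_deriv ?_
    simp only [laplaceIntegrand, id, Pi.neg_apply]
    ring

theorem tendsto_rpow_mul_exp (s : ℝ) {b : ℝ} (hb : 0 < b) (c : ℝ) :
    Tendsto (fun r : ℝ => c * (r ^ s * Real.exp (-b * r))) atTop (𝓝 0) := by
  simpa using (tendsto_rpow_mul_exp_neg_mul_atTop_nhds_zero s b hb).const_mul c

/-- Integration from the tip corresponds to division by `z`. -/
theorem rayLaplace_integralFrom (hω : 0 < ω) (hωπ : ω ≤ Real.pi)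
    (hη : η ∈ Ioo (θ - ω / 2) (θ + ω / 2)) (hσ : -1 < σ) (hΛ : 0 ≤ Λ) (hM : 0 ≤ M)
    (hf : SingExpWith σ Λ M α (sector α θ ω) f) (hz : Λ < (Complex.exp (η * Complex.I) * z).re) :
    rayLaplace α η (integralFrom α f) z = z⁻¹ * rayLaplace α η f z := by
  have hJ := hf.integralFrom hω hωπ hσ hΛ hM
  have hσ1 : 0 < σ + 1 := by linarith
  have hz0 : z ≠ 0 := by
    rintro rfl
    simp at hz
    linarith
  set e := Complex.exp (η * Complex.I) with he
  set k : ℝ → ℂ := fun r => Complex.exp (-(z * (α + r * e))) * integralFrom α f (α + r * e) with hk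
  have hder : ∀ r ∈ Ioi (0 : ℝ), HasDerivAt k
      (laplaceIntegrand α η f z r - z * laplaceIntegrand α η (integralFrom α f) z r) r := by
    intro r hr
    have h1 : HasDerivAt (fun r : ℝ => α + r * e) e r := by
      simpa using ((Complex.ofRealCLM.hasDerivAt (x := r)).mul_const e).const_add α
    have h2 := (hasDerivAt_integralFrom hω hωπ hσ hM hf (ray_mem_sector hη hr)).comp r h1
    have h3 := ((h1.const_mul z).neg).cexp
    refine (h3.mul h2).congr_deriv ?_
    simp only [laplaceIntegrand, Function.comp, ← he, Pi.neg_apply]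
    ring
  have hbound : ∀ r : ℝ, 0 < r → ‖k r‖ ≤ ‖Complex.exp (-(α * z))‖ * (M / (σ + 1)) *
      (r ^ (σ + 1) * Real.exp (-((e * z).re - Λ) * r)) := by
    intro r hr
    have h := norm_laplaceIntegrand_le hη hJ hr z
    rw [laplaceIntegrand, norm_mul, Complex.norm_exp_ofReal_mul_I, mul_one] at h
    exact h
  have hk0 : k 0 = 0 := by
    simp [hk, integralFrom]
  have hcont : ContinuousWithinAt k (Ici 0) 0 := by
    rw [← continuousWithinAt_Ioi_iff_Ici, ContinuousWithinAt, hk0]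
    refine squeeze_zero_norm' (a := fun r : ℝ => ‖Complex.exp (-(α * z))‖ * (M / (σ + 1)) *
      (r ^ (σ + 1) * Real.exp (-((e * z).re - Λ) * r))) ?_ ?_
    · filter_upwards [self_mem_nhdsWithin] with r hr using hbound r hr
    · have hc : Continuous (fun r : ℝ => ‖Complex.exp (-(α * z))‖ * (M / (σ + 1)) *
          (r ^ (σ + 1) * Real.exp (-((e * z).re - Λ) * r))) := by
        have : Continuous fun r : ℝ => r ^ (σ + 1) :=
          Continuous.rpow_const (by fun_prop) fun _ => Or.inr hσ1.le
        fun_prop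
      have := hc.tendsto 0
      simp only [Real.zero_rpow hσ1.ne', zero_mul, mul_zero] at this
      exact this.mono_left nhdsWithin_le_nhds
  have hinf : Tendsto k atTop (𝓝 0) := by
    refine squeeze_zero_norm' ?_ (tendsto_rpow_mul_exp (σ + 1) (sub_pos.2 hz)
      (‖Complex.exp (-(α * z))‖ * (M / (σ + 1))))
    filter_upwards [eventually_gt_atTop 0] with r hr using hbound r hr
  have i1 := integrableOn_laplaceIntegrand hη hσ hf hz
  have i2 := (integrableOn_laplaceIntegrand hη (by linarith) hJ hz).const_mul z
  have h := MeasureTheory.integral_Ioi_of_hasDerivAt_of_tendsto hcont hder (i1.sub i2) hinf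
  rw [MeasureTheory.integral_sub i1 i2, MeasureTheory.integral_const_mul, hk0, sub_zero] at h
  have h' : rayLaplace α η f z = z * rayLaplace α η (integralFrom α f) z := sub_eq_zero.1 h
  rw [h', inv_mul_cancel_left₀ hz0]

theorem hasSum_rayLaplace (hω : 0 < ω) (hωπ : ω ≤ Real.pi)
    (hη : η ∈ Ioo (θ - ω / 2) (θ + ω / 2)) (hσ : 0 ≤ σ) (hΛ : 0 ≤ Λ) (hM : 0 ≤ M)
    {F : ℕ → ℂ → ℂ} (hF : ∀ j, SingExpWith σ Λ (M * (1 / 2) ^ j) α (sector α θ ω) (F j))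
    (hz : Λ < (Complex.exp (η * Complex.I) * z).re) :
    HasSum (fun j => rayLaplace α η (F j) z) (rayLaplace α η (fun ζ => ∑' j, F j ζ) z) := by
  set G : ℝ → ℝ := fun r =>
    r ^ σ * Real.exp (-((Complex.exp (η * Complex.I) * z).re - Λ) * r)
  have hgeom : ∀ c : ℝ, HasSum (fun j : ℕ => ‖Complex.exp (-(α * z))‖ * (M * (1 / 2) ^ j) * c)
      (‖Complex.exp (-(α * z))‖ * (M * 2) * c) := fun c =>
    (((hasSum_geometric_two).mul_left M).mul_left _).mul_right c
  refine MeasureTheory.hasSum_integral_of_dominated_convergence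
    (fun j r => ‖Complex.exp (-(α * z))‖ * (M * (1 / 2) ^ j) * G r) ?_ ?_ ?_ ?_ ?_
  · exact fun j => (continuousOn_laplaceIntegrand hη
      (hF j).diff.continuousOn z).aestronglyMeasurable measurableSet_Ioi
  · exact fun j => (MeasureTheory.ae_restrict_iff' measurableSet_Ioi).2 (Eventually.of_forall
      fun r hr => norm_laplaceIntegrand_le hη (hF j) hr z)
  · exact Eventually.of_forall fun r => (hgeom _).summable
  · simp only [fun r => (hgeom (G r)).tsum_eq]
    exact (integrableOn_rpow_mul_exp (by linarith) (sub_pos.2 hz)).const_mul _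
  · refine (MeasureTheory.ae_restrict_iff' measurableSet_Ioi).2 (Eventually.of_forall
      fun r hr => ?_)
    have h := ((singExpWith_tsum hω hωπ hσ hΛ hM hF).1 _ (ray_mem_sector hη hr)).hasSum
    exact (h.mul_left _).mul_right _

/-- The Laplace integrals along two rays agree where both converge: they are limits of values of
the primitive `∂⁻¹ (e^{-zζ} f)` at the end points of two equal segments, and the integrand is
exponentially small on the chord between these points. -/
theorem rayLaplace_eq (hω : 0 < ω) (hωπ : ω ≤ Real.pi) (hσ : -1 < σ) (hΛ : 0 ≤ Λ) (hM : 0 ≤ M)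
    (hf : SingExpWith σ Λ M α (sector α θ ω) f) {η₁ η₂ : ℝ}
    (hη₁ : η₁ ∈ Ioo (θ - ω / 2) (θ + ω / 2)) (hη₂ : η₂ ∈ Ioo (θ - ω / 2) (θ + ω / 2))
    (hz₁ : Λ < (Complex.exp (η₁ * Complex.I) * z).re)
    (hz₂ : Λ < (Complex.exp (η₂ * Complex.I) * z).re) :
    rayLaplace α η₁ f z = rayLaplace α η₂ f z := by
  set g : ℂ → ℂ := fun ζ => Complex.exp (-(z * ζ)) * f ζ with hg
  have hz0 : z ≠ 0 := by
    rintro rfl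
    simp at hz₁
    linarith
  have hexp : SingExpWith 0 ‖z‖ ‖Complex.exp (-(α * z))‖ α (sector α θ ω)
      (fun ζ => Complex.exp (-(z * ζ))) := by
    refine ⟨by fun_prop, fun ζ _ => ?_⟩
    have e : -(z * ζ) = -(α * z) + -(z * (ζ - α)) := by ring
    rw [e, Complex.exp_add, norm_mul, Real.rpow_zero, mul_one]
    refine mul_le_mul_of_nonneg_left ?_ (norm_nonneg _)
    refine (Complex.norm_exp_le_exp_norm _).trans (Real.exp_le_exp.2 ?_)
    rw [norm_neg, norm_mul]
  have hgb := hexp.mul (norm_nonneg _) hf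
  have hσ' : -1 < 0 + σ := by linarith
  have hprim : ∀ {η : ℝ}, η ∈ Ioo (θ - ω / 2) (θ + ω / 2) →
      Λ < (Complex.exp (η * Complex.I) * z).re →
      Tendsto (fun r : ℝ => integralFrom α g (α + r * Complex.exp (η * Complex.I))) atTop
        (𝓝 (rayLaplace α η f z)) := by
    intro η hη hz
    refine (MeasureTheory.intervalIntegral_tendsto_integral_Ioi 0
      (integrableOn_laplaceIntegrand hη hσ hf hz) tendsto_id).congr fun r => ?_
    rw [integralFrom_ray]
    rfl
  refine tendsto_nhds_unique (hprim hη₁ hz₁) ?_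
  refine (hprim hη₂ hz₂).congr_dist ?_
  set x := min (Complex.exp (η₁ * Complex.I) * z).re (Complex.exp (η₂ * Complex.I) * z).re with hx
  have hxΛ : Λ < x := lt_min hz₁ hz₂
  have hx0 : 0 < x := hΛ.trans_lt hxΛ
  have hzn : 0 < ‖z‖ := norm_pos_iff.2 hz0
  set D := 1 + (x / ‖z‖) ^ σ with hD
  have hbound : ∀ r : ℝ, 0 < r →
      dist (integralFrom α g (α + r * Complex.exp (η₂ * Complex.I)))
        (integralFrom α g (α + r * Complex.exp (η₁ * Complex.I))) ≤
      2 * ‖Complex.exp (-(α * z))‖ * M * D * (r ^ (σ + 1) * Real.exp (-(x - Λ) * r)) := by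
    intro r hr
    set p := α + r * Complex.exp (η₁ * Complex.I)
    set q := α + r * Complex.exp (η₂ * Complex.I)
    have hp : p ∈ sector α θ ω := ray_mem_sector hη₁ hr
    have hq : q ∈ sector α θ ω := ray_mem_sector hη₂ hr
    have hsub : segment ℝ p q ⊆ sector α θ ω := (convex_sector hω hωπ).segment_subset hp hq
    have hgs : ∀ ζ ∈ segment ℝ p q,
        ‖g ζ‖ ≤ ‖Complex.exp (-(α * z))‖ * M * D * (r ^ σ * Real.exp (-(x - Λ) * r)) := by
      intro ζ hζ
      have hζΩ := hsub hζ
      have h0 := sector_norm_sub_pos hζΩ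
      obtain ⟨a, b, ha, hb, hab, rfl⟩ := hζ
      set ζ := a • p + b • q
      have e : ζ - α = a * (r * Complex.exp (η₁ * Complex.I)) +
          b * (r * Complex.exp (η₂ * Complex.I)) := by
        have : (a : ℂ) + b = 1 := by exact_mod_cast hab
        simp only [ζ, p, q, Complex.real_smul]
        linear_combination α * this
      have hre : r * x ≤ (z * (ζ - α)).re := by
        have e2 : z * (ζ - α) = ((r * a : ℝ) : ℂ) * (Complex.exp (η₁ * Complex.I) * z) +
            ((r * b : ℝ) : ℂ) * (Complex.exp (η₂ * Complex.I) * z) := by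
          rw [e]; push_cast; ring
        rw [e2, Complex.add_re, Complex.re_ofReal_mul, Complex.re_ofReal_mul]
        have h1 : x ≤ (Complex.exp (η₁ * Complex.I) * z).re := min_le_left _ _
        have h2 : x ≤ (Complex.exp (η₂ * Complex.I) * z).re := min_le_right _ _
        calc r * x = r * a * x + r * b * x := by rw [← add_mul, ← mul_add, hab, mul_one]
          _ ≤ _ := by gcongr
      have hup : ‖ζ - α‖ ≤ r := by
        rw [e]
        refine (norm_add_le _ _).trans ?_
        rw [norm_mul, norm_mul, norm_mul, norm_mul, Complex.norm_exp_ofReal_mul_I,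
          Complex.norm_exp_ofReal_mul_I, Complex.norm_real, Complex.norm_real, Complex.norm_real,
          Real.norm_of_nonneg ha, Real.norm_of_nonneg hb, Real.norm_of_nonneg hr.le, mul_one,
          ← add_mul, hab, one_mul]
      have hlow : r * (x / ‖z‖) ≤ ‖ζ - α‖ := by
        rw [← mul_div_assoc, div_le_iff₀ hzn, mul_comm ‖ζ - α‖, ← norm_mul]
        exact hre.trans (Complex.re_le_norm _)
      have hpow : ‖ζ - α‖ ^ σ ≤ D * r ^ σ := by
        have hxz : 0 < (x / ‖z‖) ^ σ := by positivity
        have hrσ : 0 < r ^ σ := by positivity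
        rcases le_total 0 σ with hs | hs
        · calc ‖ζ - α‖ ^ σ ≤ r ^ σ := Real.rpow_le_rpow h0.le hup hs
            _ ≤ D * r ^ σ := le_mul_of_one_le_left hrσ.le (by rw [hD]; linarith)
        · calc ‖ζ - α‖ ^ σ ≤ (r * (x / ‖z‖)) ^ σ :=
                Real.rpow_le_rpow_of_nonpos (by positivity) hlow hs
            _ = (x / ‖z‖) ^ σ * r ^ σ := by
                rw [Real.mul_rpow hr.le (by positivity), mul_comm]
            _ ≤ D * r ^ σ := mul_le_mul_of_nonneg_right (by rw [hD]; linarith) hrσ.le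
      have e3 : -(z * ζ) = -(α * z) + -(z * (ζ - α)) := by ring
      have hexp' : ‖Complex.exp (-(z * ζ))‖ ≤ ‖Complex.exp (-(α * z))‖ * Real.exp (-(r * x)) := by
        rw [e3, Complex.exp_add, norm_mul, Complex.norm_exp (-(z * (ζ - α))), Complex.neg_re]
        gcongr
      have hDnn : 0 ≤ D := by positivity
      calc ‖g ζ‖ ≤ (‖Complex.exp (-(α * z))‖ * Real.exp (-(r * x))) *
            (M * ‖ζ - α‖ ^ σ * Real.exp (Λ * ‖ζ - α‖)) := by
            rw [hg, norm_mul]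
            have := hf.bound ζ hζΩ
            gcongr
        _ ≤ (‖Complex.exp (-(α * z))‖ * Real.exp (-(r * x))) *
            (M * (D * r ^ σ) * Real.exp (Λ * r)) := by gcongr
        _ = ‖Complex.exp (-(α * z))‖ * M * D * (r ^ σ *
            (Real.exp (-(r * x)) * Real.exp (Λ * r))) := by ring
        _ = _ := by rw [← Real.exp_add]; ring_nf
    have h := (convex_segment p q).norm_image_sub_le_of_norm_hasDerivWithin_le
      (fun ζ hζ => (hasDerivAt_integralFrom hω hωπ hσ' (by positivity) hgb
        (hsub hζ)).hasDerivWithinAt) hgs (left_mem_segment ℝ p q) (right_mem_segment ℝ p q)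
    rw [dist_eq_norm]
    refine h.trans ?_
    have hpq : ‖q - p‖ ≤ 2 * r := by
      have e : q - p = (q - α) - (p - α) := by ring
      rw [e]
      refine (norm_sub_le _ _).trans_eq ?_
      rw [norm_ray_sub α η₁ hr.le, norm_ray_sub α η₂ hr.le]
      ring
    have hDnn : 0 ≤ D := by positivity
    rw [Real.rpow_add hr, Real.rpow_one]
    calc _ ≤ ‖Complex.exp (-(α * z))‖ * M * D * (r ^ σ * Real.exp (-(x - Λ) * r)) * (2 * r) := by
          gcongr
      _ = _ := by ring
  refine squeeze_zero' (Eventually.of_forall fun r => dist_nonneg) ?_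
    (tendsto_rpow_mul_exp (σ + 1) (sub_pos.2 hxΛ) (2 * ‖Complex.exp (-(α * z))‖ * M * D))
  filter_upwards [eventually_gt_atTop 0] with r hr using hbound r hr

end laplace

/-! ### Laplace transforms of powers and of solutions of the Volterra equation -/

section power

variable {α τ : ℂ} {θ ω η : ℝ}

theorem rayLaplace_branchPow_aux (hη : |η - θ| < Real.pi) (z : ℂ) :
    rayLaplace α η (fun ζ => branchPow θ (τ - 1) (ζ - α)) z =
      Complex.exp (-(α * z)) * Complex.exp (τ * (η * Complex.I)) *
        ∫ r in Ioi (0 : ℝ), (r : ℂ) ^ (τ - 1) *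
          Complex.exp (-(Complex.exp (η * Complex.I) * z * r)) := by
  rw [rayLaplace, ← MeasureTheory.integral_const_mul]
  refine MeasureTheory.setIntegral_congr_fun measurableSet_Ioi fun r hr => ?_
  have hr0 : (0 : ℝ) < r := hr
  simp only [laplaceIntegrand]
  rw [add_sub_cancel_left, branchPow_eq, branchLog_polar hr0 hη,
    Complex.cpow_def_of_ne_zero (by exact_mod_cast hr0.ne'), Complex.ofReal_log hr0.le,
    ← Complex.exp_add, ← Complex.exp_add, ← Complex.exp_add, ← Complex.exp_add, ← Complex.exp_add]
  congr 1
  ring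

/-- The Gamma integral with a complex rate, by rotation of the ray to the direction in which the
rate is real. -/
theorem integral_cpow_mul_exp_neg_mul {w : ℂ} (hτ : 0 < τ.re) (hw : 0 < w.re) :
    ∫ r in Ioi (0 : ℝ), (r : ℂ) ^ (τ - 1) * Complex.exp (-(w * r)) =
      Complex.Gamma τ * Complex.exp (-τ * Complex.log w) := by
  have hw0 : w ≠ 0 := by rintro rfl; simp at hw
  have hwn : 0 < ‖w‖ := norm_pos_iff.2 hw0
  have harg := Complex.abs_arg_lt_pi_div_two_iff.2 (Or.inl hw)
  rw [abs_lt] at harg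
  have hπ := Real.pi_pos
  have hf := singExpWith_branchPow (α := 0) (θ := 0) (ω := Real.pi) le_rfl (τ - 1)
  have h1 : (0 : ℝ) ∈ Ioo (0 - Real.pi / 2) (0 + Real.pi / 2) := ⟨by linarith, by linarith⟩
  have h2 : -w.arg ∈ Ioo (0 - Real.pi / 2) (0 + Real.pi / 2) := ⟨by linarith, by linarith⟩
  have hrot : Complex.exp ((-w.arg : ℝ) * Complex.I) * w = (‖w‖ : ℝ) := by
    conv_lhs => rw [← Complex.norm_mul_exp_arg_mul_I w]
    rw [mul_left_comm, ← Complex.exp_add]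
    simp
  have h := rayLaplace_eq (z := w) hπ le_rfl (by simpa using hτ) le_rfl
    (zero_le_one.trans (one_le_branchConst _ _)) hf h1 h2 (by simpa using hw)
    (by rw [hrot]; simpa using hw0)
  rw [rayLaplace_branchPow_aux (by simpa using hπ),
    rayLaplace_branchPow_aux (by rw [abs_lt]; constructor <;> linarith), hrot] at h
  simp only [Complex.ofReal_zero, zero_mul, neg_zero, Complex.exp_zero, mul_zero, one_mul] at h
  rw [h, Complex.integral_cpow_mul_exp_neg_mul_Ioi hτ hwn, Complex.cpow_def_of_ne_zero
    (one_div_ne_zero (by exact_mod_cast hwn.ne')), one_div, ← Complex.ofReal_inv,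
    ← Complex.ofReal_log (inv_nonneg.2 hwn.le), Real.log_inv, ← mul_assoc, ← Complex.exp_add,
    mul_comm]
  congr 2
  rw [Complex.log]
  push_cast
  ring

theorem branchLog_neg_eq {z : ℂ} (hη : |η - θ| < Real.pi / 2)
    (hz : 0 < (Complex.exp (η * Complex.I) * z).re) :
    branchLog (-θ) z = Complex.log (Complex.exp (η * Complex.I) * z) - η * Complex.I := by
  set w := Complex.exp (η * Complex.I) * z with hw
  have hw0 : w ≠ 0 := by intro h; rw [h] at hz; simp at hz
  have harg := Complex.abs_arg_lt_pi_div_two_iff.2 (Or.inl hz)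
  rw [abs_lt] at harg hη
  have hz' : z = (‖w‖ : ℝ) * Complex.exp ((w.arg - η : ℝ) * Complex.I) := by
    have : z = Complex.exp (-(η * Complex.I)) * w := by
      rw [hw, ← mul_assoc, ← Complex.exp_add]; simp
    rw [this]
    conv_lhs => rw [← Complex.norm_mul_exp_arg_mul_I w]
    rw [mul_left_comm, ← Complex.exp_add]
    push_cast
    ring_nf
  conv_lhs => rw [hz']
  rw [branchLog_polar (norm_pos_iff.2 hw0) (by rw [abs_lt]; constructor <;> linarith), Complex.log]
  push_cast
  ring

theorem rayLaplace_branchPow (hωπ : ω ≤ Real.pi) (hη : η ∈ Ioo (θ - ω / 2) (θ + ω / 2))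
    (hτ : 0 < τ.re) {z : ℂ} (hz : 0 < (Complex.exp (η * Complex.I) * z).re) :
    rayLaplace α η (fun ζ => branchPow θ (τ - 1) (ζ - α)) z =
      Complex.exp (-(α * z)) * (Complex.Gamma τ * branchPow (-θ) (-τ) z) := by
  have hη' : |η - θ| < Real.pi / 2 := by
    rw [abs_lt]; constructor <;> linarith [hη.1, hη.2]
  rw [rayLaplace_branchPow_aux (hη'.trans (by linarith [Real.pi_pos])),
    integral_cpow_mul_exp_neg_mul hτ hz, branchPow_eq, branchLog_neg_eq hη' hz, mul_sub,
    sub_eq_add_neg, Complex.exp_add]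
  rw [show -(-τ * (η * Complex.I)) = τ * (η * Complex.I) by ring]
  ring

end power

section dualDomain

variable {θ ω Λ Λ' : ℝ} {z : ℂ}

theorem isOpen_dualDomain (θ ω Λ : ℝ) : IsOpen (dualDomain θ ω Λ) := by
  have : dualDomain θ ω Λ = ⋃ η ∈ Ioo (θ - ω / 2) (θ + ω / 2),
      {z | Λ < (Complex.exp (η * Complex.I) * z).re} := by
    ext z; simp [dualDomain]
  rw [this]
  exact isOpen_biUnion fun η _ => isOpen_lt (by fun_prop) (by fun_prop)

theorem dualDomain_anti (h : Λ ≤ Λ') : dualDomain θ ω Λ' ⊆ dualDomain θ ω Λ :=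
  fun _ ⟨η, hη, hz⟩ => ⟨η, hη, h.trans_lt hz⟩

theorem re_exp_mul_le_norm (η : ℝ) (z : ℂ) : (Complex.exp (η * Complex.I) * z).re ≤ ‖z‖ := by
  refine (Complex.re_le_norm _).trans_eq ?_
  rw [norm_mul, Complex.norm_exp_ofReal_mul_I, one_mul]

end dualDomain

section sectorLaplace

variable {α : ℂ} {θ ω σ Λ M η : ℝ} {f : ℂ → ℂ} {z : ℂ}

open Classical in
/-- The Laplace transform on the dual domain, along any ray for which it converges. -/
noncomputable def sectorLaplace (α : ℂ) (θ ω Λ : ℝ) (f : ℂ → ℂ) (z : ℂ) : ℂ :=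
  if h : ∃ η ∈ Ioo (θ - ω / 2) (θ + ω / 2), Λ < (Complex.exp (η * Complex.I) * z).re then
    rayLaplace α h.choose f z
  else 0

theorem sectorLaplace_eq (hω : 0 < ω) (hωπ : ω ≤ Real.pi) (hσ : -1 < σ) (hΛ : 0 ≤ Λ) (hM : 0 ≤ M)
    (hf : SingExpWith σ Λ M α (sector α θ ω) f) (hη : η ∈ Ioo (θ - ω / 2) (θ + ω / 2))
    (hz : Λ < (Complex.exp (η * Complex.I) * z).re) :
    sectorLaplace α θ ω Λ f z = rayLaplace α η f z := by
  have h : ∃ η ∈ Ioo (θ - ω / 2) (θ + ω / 2), Λ < (Complex.exp (η * Complex.I) * z).re :=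
    ⟨η, hη, hz⟩
  rw [sectorLaplace, dif_pos h]
  exact rayLaplace_eq hω hωπ hσ hΛ hM hf h.choose_spec.1 hη h.choose_spec.2 hz

theorem iteratedDeriv_sectorLaplace (hω : 0 < ω) (hωπ : ω ≤ Real.pi) (hσ : -1 < σ) (hΛ : 0 ≤ Λ)
    (hf : ∀ k : ℕ, ∃ M, 0 ≤ M ∧ SingExpWith σ Λ M α (sector α θ ω) (fun ζ => (-ζ) ^ k * f ζ))
    (k : ℕ) : ∀ z ∈ dualDomain θ ω Λ, iteratedDeriv k (sectorLaplace α θ ω Λ f) z =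
      sectorLaplace α θ ω Λ (fun ζ => (-ζ) ^ k * f ζ) z := by
  induction k with
  | zero => intro z _; simp
  | succ k ih =>
    rintro z ⟨η, hη, hz⟩
    rw [iteratedDeriv_succ]
    have hopen : IsOpen {z : ℂ | Λ < (Complex.exp (η * Complex.I) * z).re} :=
      isOpen_lt (by fun_prop) (by fun_prop)
    obtain ⟨M, hM, hk⟩ := hf k
    obtain ⟨M', hM', hk'⟩ := hf (k + 1)
    have e : (fun ζ => (-ζ) ^ (k + 1) * f ζ) = fun ζ => -ζ * ((-ζ) ^ k * f ζ) := by
      ext ζ; rw [pow_succ]; ring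
    rw [sectorLaplace_eq hω hωπ hσ hΛ hM' hk' hη hz, e]
    rw [e] at hk'
    have h := hasDerivAt_rayLaplace hη hσ hM' hk hk' hz
    refine (h.congr_of_eventuallyEq ?_).deriv
    filter_upwards [hopen.mem_nhds hz] with w hw
    rw [ih w ⟨η, hη, hw⟩, sectorLaplace_eq hω hωπ hσ hΛ hM hk hη hw]

theorem differentiableOn_sectorLaplace (hω : 0 < ω) (hωπ : ω ≤ Real.pi) (hσ : -1 < σ) (hΛ : 0 ≤ Λ)
    (hM : 0 ≤ M) (hf : SingExpWith σ Λ M α (sector α θ ω) f) {M' : ℝ} (hM' : 0 ≤ M')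
    (hf' : SingExpWith σ Λ M' α (sector α θ ω) (fun ζ => -ζ * f ζ)) :
    DifferentiableOn ℂ (sectorLaplace α θ ω Λ f) (dualDomain θ ω Λ) := by
  rintro z ⟨η, hη, hz⟩
  have hopen : IsOpen {z : ℂ | Λ < (Complex.exp (η * Complex.I) * z).re} :=
    isOpen_lt (by fun_prop) (by fun_prop)
  refine ((hasDerivAt_rayLaplace hη hσ hM' hf hf' hz).congr_of_eventuallyEq
    ?_).differentiableAt.differentiableWithinAt
  filter_upwards [hopen.mem_nhds hz] with w hw
  exact sectorLaplace_eq hω hωπ hσ hΛ hM hf hη hw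

theorem polyDeriv_add (S T : Polynomial ℂ) (Φ : ℂ → ℂ) (z : ℂ) :
    polyDeriv (S + T) Φ z = polyDeriv S Φ z + polyDeriv T Φ z := by
  rw [polyDeriv, polyDeriv, polyDeriv]
  exact Polynomial.sum_add_index S T _ (fun _ => zero_mul _) fun _ _ _ => add_mul _ _ _

theorem polyDeriv_monomial (n : ℕ) (a : ℂ) (Φ : ℂ → ℂ) (z : ℂ) :
    polyDeriv (Polynomial.monomial n a) Φ z = a * iteratedDeriv n Φ z :=
  Polynomial.sum_monomial_index _ _ (zero_mul _)

/-- On Laplace transforms, `S (d/dz)` acts as multiplication by `S (-ζ)`. -/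
theorem polyDeriv_sectorLaplace (hω : 0 < ω) (hωπ : ω ≤ Real.pi) (hσ : -1 < σ) (hΛ : 0 ≤ Λ)
    (hf : ∀ S : Polynomial ℂ,
      ∃ M, 0 ≤ M ∧ SingExpWith σ Λ M α (sector α θ ω) (fun ζ => S.eval (-ζ) * f ζ))
    (hη : η ∈ Ioo (θ - ω / 2) (θ + ω / 2)) (hz : Λ < (Complex.exp (η * Complex.I) * z).re)
    (S : Polynomial ℂ) :
    polyDeriv S (sectorLaplace α θ ω Λ f) z = rayLaplace α η (fun ζ => S.eval (-ζ) * f ζ) z := by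
  induction S using Polynomial.induction_on' with
  | add S T hS hT =>
    obtain ⟨M, _, h⟩ := hf S
    obtain ⟨M', _, h'⟩ := hf T
    rw [polyDeriv_add, hS, hT, ← rayLaplace_add hη hσ hσ h h' hz]
    simp only [Polynomial.eval_add, add_mul]
  | monomial n a =>
    have hf' : ∀ k : ℕ, ∃ M, 0 ≤ M ∧
        SingExpWith σ Λ M α (sector α θ ω) (fun ζ => (-ζ) ^ k * f ζ) := fun k => by
      simpa using hf (Polynomial.X ^ k)
    obtain ⟨M, hM, h⟩ := hf' n
    rw [polyDeriv_monomial, iteratedDeriv_sectorLaplace hω hωπ hσ hΛ hf' n z ⟨η, hη, hz⟩,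
      sectorLaplace_eq hω hωπ hσ hΛ hM h hη hz, ← rayLaplace_const_mul]
    simp only [Polynomial.eval_monomial, mul_assoc]

end sectorLaplace

section solution

variable {P Q : Polynomial ℂ} {α : ℂ} {θ ω σ Λ M A B C η : ℝ} {R f ψ : ℂ → ℂ} {z : ℂ}

theorem hasSum_taylorCoeff (hR : DifferentiableOn ℂ R (Metric.ball 0 A⁻¹)) {w : ℂ}
    (hw : ‖w‖ < A⁻¹) : HasSum (fun j => taylorCoeff R j * w ^ j) (R w) := by
  have h := Complex.hasSum_taylorSeries_on_ball hR (z := w) (by simpa using hw)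
  refine h.congr_fun fun j => ?_
  simp only [taylorCoeff, sub_zero, smul_eq_mul]
  ring

/-- The Cauchy estimates for the Taylor coefficients. -/
theorem exists_norm_taylorCoeff_le (hA : 0 < A) (hR : DifferentiableOn ℂ R (Metric.ball 0 A⁻¹)) :
    ∃ C, ∀ j, ‖taylorCoeff R j‖ ≤ C * (2 * A) ^ j := by
  have hr : 0 < (2 * A)⁻¹ := by positivity
  have hlt : (2 * A)⁻¹ < A⁻¹ := inv_strictAnti₀ hA (by linarith)
  have hsub : Metric.closedBall (0 : ℂ) (2 * A)⁻¹ ⊆ Metric.ball 0 A⁻¹ :=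
    Metric.closedBall_subset_ball hlt
  obtain ⟨C, hC⟩ := (isCompact_closedBall (0 : ℂ) (2 * A)⁻¹).exists_bound_of_continuousOn
    (hR.continuousOn.mono hsub)
  refine ⟨C, fun j => ?_⟩
  have h := Complex.norm_iteratedDeriv_le_of_forall_mem_sphere_norm_le j hr
    (DifferentiableOn.diffContOnCl (by
      rw [closure_ball _ hr.ne']; exact hR.mono hsub))
    (fun w hw => hC w (Metric.sphere_subset_closedBall hw))
  rw [taylorCoeff, norm_div, Complex.norm_natCast, div_le_iff₀ (by positivity)]
  refine h.trans_eq ?_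
  rw [inv_pow, div_inv_eq_mul]
  ring

theorem rayLaplace_iterate (hω : 0 < ω) (hωπ : ω ≤ Real.pi)
    (hη : η ∈ Ioo (θ - ω / 2) (θ + ω / 2)) (hσ : -1 < σ) (hΛ : 0 < Λ) (hM : 0 ≤ M)
    (hf : SingExpWith σ Λ M α (sector α θ ω) f) (hz : Λ < (Complex.exp (η * Complex.I) * z).re)
    (j : ℕ) :
    rayLaplace α η ((integralFrom α)^[j + 1] f) z = z⁻¹ ^ (j + 1) * rayLaplace α η f z := by
  have hσ1 : 0 < σ + 1 := by linarith
  induction j with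
  | zero => simpa using rayLaplace_integralFrom hω hωπ hη hσ hΛ.le hM hf hz
  | succ j ih =>
    rw [Function.iterate_succ_apply', rayLaplace_integralFrom hω hωπ hη (by linarith) hΛ.le
      (by positivity) (singExpWith_iterate hω hωπ hσ hΛ hM hf j) hz, ih, pow_succ _ (j + 1)]
    ring

theorem rayLaplace_iteratedSeries (hω : 0 < ω) (hωπ : ω ≤ Real.pi)
    (hη : η ∈ Ioo (θ - ω / 2) (θ + ω / 2)) (hσ : -1 < σ) (hB : 0 < B)
    (hc : ∀ j, ‖taylorCoeff R j‖ ≤ C * B ^ j) (hΛ : 2 * B ≤ Λ) (hM : 0 ≤ M)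
    (hf : SingExpWith σ Λ M α (sector α θ ω) f) (hz : Λ < (Complex.exp (η * Complex.I) * z).re)
    (hR : DifferentiableOn ℂ R (Metric.ball 0 A⁻¹)) (hzA : ‖z⁻¹‖ < A⁻¹) :
    rayLaplace α η (iteratedSeries (taylorCoeff R) α f) z =
      z⁻¹ * R z⁻¹ * rayLaplace α η f z := by
  have hσ1 : 0 < σ + 1 := by linarith
  have hC : 0 ≤ C := by simpa using (norm_nonneg _).trans (hc 0)
  have h1 := hasSum_rayLaplace hω hωπ hη hσ1.le (by linarith) (by positivity)
    (singExpWith_iteratedSeries_term hω hωπ hσ hB hc hΛ hM hf) hz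
  have h2 := ((hasSum_taylorCoeff hR hzA).mul_left z⁻¹).mul_right (rayLaplace α η f z)
  refine h1.unique (h2.congr_fun fun j => ?_)
  rw [rayLaplace_const_mul, rayLaplace_iterate hω hωπ hη hσ (by linarith) hM hf hz, pow_succ]
  ring

/-- The Volterra equation with the convergent series collected under one integral. -/
theorem SolvesVolterra.mul_eq (hω : 0 < ω) (hωπ : ω ≤ Real.pi) (hσ : -1 < σ) (hB : 0 < B)
    (hc : ∀ j, ‖taylorCoeff R j‖ ≤ C * B ^ j) (hΛ : 2 * B ≤ Λ) (hM : 0 ≤ M)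
    (hψ : SingExpWith σ Λ M α (sector α θ ω) ψ)
    (hV : SolvesVolterra P Q R α (sector α θ ω) ψ) {ζ : ℂ} (hζ : ζ ∈ sector α θ ω) :
    P.eval (-ζ) * ψ ζ = -1 * (integralFrom α (fun ξ => Q.eval (-ξ) * ψ ξ) ζ +
        integralFrom α (iteratedSeries (taylorCoeff R) α ψ) ζ) := by
  have hsum := hasSum_integralFrom_iteratedSeries hω hωπ hσ hB hc hΛ hM hψ hζ
  rw [hsum.unique (hV ζ hζ)]
  ring

/-- The Laplace transform turns the Volterra equation into the differential equation. -/
theorem levelOneOp_sectorLaplace (hω : 0 < ω) (hωπ : ω ≤ Real.pi) (hσ : -1 < σ) (hB : 0 < B)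
    (hc : ∀ j, ‖taylorCoeff R j‖ ≤ C * B ^ j) (hΛ : 2 * B ≤ Λ) (hM : 0 ≤ M)
    (hψ : SingExpWith σ Λ M α (sector α θ ω) ψ)
    (hψ' : ∀ S : Polynomial ℂ,
      ∃ M, 0 ≤ M ∧ SingExpWith σ Λ M α (sector α θ ω) (fun ζ => S.eval (-ζ) * ψ ζ))
    (hV : SolvesVolterra P Q R α (sector α θ ω) ψ)
    (hA : 0 < A) (hAΛ : A ≤ Λ) (hR : DifferentiableOn ℂ R (Metric.ball 0 A⁻¹))
    (hz : z ∈ dualDomain θ ω Λ) :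
    levelOneOp P Q R (sectorLaplace α θ ω Λ ψ) z = 0 := by
  obtain ⟨η, hη, hz⟩ := hz
  have hσ1 : 0 < σ + 1 := by linarith
  have hC : 0 ≤ C := by simpa using (norm_nonneg _).trans (hc 0)
  have hΛ0 : 0 < Λ := by linarith
  have hzA : ‖z⁻¹‖ < A⁻¹ := by
    rw [norm_inv]
    exact inv_strictAnti₀ hA (hAΛ.trans_lt (hz.trans_le (re_exp_mul_le_norm η z)))
  obtain ⟨MQ, hMQ, hQ⟩ := hψ' Q
  have hS := hψ.iteratedSeries hω hωπ hσ hB hc hΛ hM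
  rw [levelOneOp, polyDeriv_sectorLaplace hω hωπ hσ hΛ0.le hψ' hη hz,
    polyDeriv_sectorLaplace hω hωπ hσ hΛ0.le hψ' hη hz,
    sectorLaplace_eq hω hωπ hσ hΛ0.le hM hψ hη hz,
    rayLaplace_congr hη fun ζ hζ => hV.mul_eq hω hωπ hσ hB hc hΛ hM hψ hζ,
    rayLaplace_const_mul,
    rayLaplace_add hη (by linarith) (by linarith) (hQ.integralFrom hω hωπ hσ hΛ0.le hMQ)
      (hS.integralFrom hω hωπ (by linarith) hΛ0.le (by positivity)) hz,
    rayLaplace_integralFrom hω hωπ hη hσ hΛ0.le hMQ hQ hz,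
    rayLaplace_integralFrom hω hωπ hη (by linarith) hΛ0.le (by positivity) hS hz,
    rayLaplace_iteratedSeries hω hωπ hη hσ hB hc hΛ hM hψ hz hR hzA]
  rw [← inv_pow]
  ring

end solution

/-! ### The dual domains and the spaces on them -/

section geometry

variable {θ ω Λ Λ₀ η : ℝ} {z w : ℂ}

theorem zero_notMem_dualDomain (hΛ : 0 ≤ Λ) : (0 : ℂ) ∉ dualDomain θ ω Λ := by
  rintro ⟨η, _, h⟩
  simp at h
  linarith

theorem dualDomain_ne_univ (hΛ : 0 ≤ Λ) : dualDomain θ ω Λ ≠ univ := fun h =>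
  zero_notMem_dualDomain (θ := θ) (ω := ω) hΛ (h ▸ mem_univ _)

theorem frontier_dualDomain_nonempty (hΛ : 0 ≤ Λ) (hz : z ∈ dualDomain θ ω Λ) :
    (frontier (dualDomain θ ω Λ)).Nonempty :=
  nonempty_frontier_iff.2 ⟨⟨z, hz⟩, dualDomain_ne_univ hΛ⟩

/-- The distance to the boundary is at least the distance to the boundary of each of the half-planes
that make up the dual domain. -/
theorem sub_le_infDist_frontier (hΛ : 0 ≤ Λ) (hη : η ∈ Ioo (θ - ω / 2) (θ + ω / 2))
    (hz : Λ < (Complex.exp (η * Complex.I) * z).re) :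
    (Complex.exp (η * Complex.I) * z).re - Λ ≤ Metric.infDist z (frontier (dualDomain θ ω Λ)) := by
  have hzU : z ∈ dualDomain θ ω Λ := ⟨η, hη, hz⟩
  rw [Metric.le_infDist (frontier_dualDomain_nonempty hΛ hzU)]
  intro y hy
  have hyU : y ∉ dualDomain θ ω Λ := by
    rw [(isOpen_dualDomain θ ω Λ).frontier_eq] at hy
    exact hy.2
  have h1 : (Complex.exp (η * Complex.I) * y).re ≤ Λ := by
    by_contra! h
    exact hyU ⟨η, hη, h⟩
  have h2 := re_exp_mul_le_norm η (z - y)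
  rw [mul_sub, Complex.sub_re] at h2
  rw [dist_eq_norm]
  linarith

theorem infDist_frontier_pos (hΛ : 0 ≤ Λ) (hz : z ∈ dualDomain θ ω Λ) :
    0 < Metric.infDist z (frontier (dualDomain θ ω Λ)) := by
  obtain ⟨η, hη, h⟩ := hz
  exact (sub_pos.2 h).trans_le (sub_le_infDist_frontier hΛ hη h)

theorem infDist_frontier_le_dist (hz : z ∈ dualDomain θ ω Λ) (hw : w ∉ dualDomain θ ω Λ) :
    Metric.infDist z (frontier (dualDomain θ ω Λ)) ≤ dist z w := by
  obtain ⟨y, hy, h⟩ := exists_mem_frontier_infDist_compl_eq_dist hz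
    (fun h => hw (h ▸ mem_univ w))
  calc _ ≤ dist z y := Metric.infDist_le_dist_of_mem hy
    _ = _ := h.symm
    _ ≤ dist z w := Metric.infDist_le_dist_of_mem hw

theorem infDist_frontier_le_norm (hΛ : 0 ≤ Λ) (hz : z ∈ dualDomain θ ω Λ) :
    Metric.infDist z (frontier (dualDomain θ ω Λ)) ≤ ‖z‖ := by
  simpa using infDist_frontier_le_dist hz (zero_notMem_dualDomain hΛ)

theorem infDist_frontier_anti {Λ' : ℝ} (h : Λ ≤ Λ') (hΛ : 0 ≤ Λ) (hz : z ∈ dualDomain θ ω Λ') :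
    Metric.infDist z (frontier (dualDomain θ ω Λ')) ≤
      Metric.infDist z (frontier (dualDomain θ ω Λ)) := by
  rw [Metric.le_infDist (frontier_dualDomain_nonempty hΛ (dualDomain_anti h hz))]
  intro y hy
  refine infDist_frontier_le_dist hz fun hyU => ?_
  rw [(isOpen_dualDomain θ ω Λ).frontier_eq] at hy
  exact hy.2 (dualDomain_anti h hyU)

/-- The case of `exists_infDist_frontier_le` in which the half-planes that come closest to realising
the distance belong to one edge of the sector, the one on the side given by the sign `ε`. -/
theorem exists_infDist_frontier_le_of_edge (hω : 0 < ω) (hωπ : ω ≤ Real.pi) (hΛ₀ : 0 ≤ Λ₀)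
    (hΛ : 2 * Λ₀ ≤ Λ) (hz : z ∈ dualDomain θ ω Λ) {ε p : ℝ} (hε : ε = 1 ∨ ε = -1)
    (hp : |p| ≤ Real.pi) (hzp : z = (‖z‖ : ℝ) * Complex.exp ((p - θ : ℝ) * Complex.I))
    (hedge : ε * p ≤ -(ω / 2)) :
    ∃ η ∈ Ioo (θ - ω / 2) (θ + ω / 2), Metric.infDist z (frontier (dualDomain θ ω Λ)) ≤
      4 * ((Complex.exp (η * Complex.I) * z).re - Λ₀) := by
  have hX : ∀ s : ℝ, (Complex.exp ((θ + s : ℝ) * Complex.I) * z).re =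
      ‖z‖ * Real.cos (ε * s + ε * p) := by
    intro s
    rw [hzp, mul_left_comm, ← Complex.exp_add, ← add_mul, ← Complex.ofReal_add,
      Complex.re_ofReal_mul, Complex.exp_ofReal_mul_I_re]
    have : Real.cos (θ + s + (p - θ)) = Real.cos (ε * s + ε * p) := by
      rcases hε with rfl | rfl
      · congr 1; ring
      · rw [← Real.cos_neg]; congr 1; ring
    rw [this, ← hzp]
  have hεε : ε * ε = 1 := by rcases hε with rfl | rfl <;> norm_num
  have hεabs : ∀ s : ℝ, |s| < ω / 2 → -(ω / 2) < ε * s ∧ ε * s < ω / 2 := by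
    intro s hs
    rw [abs_lt] at hs
    rcases hε with rfl | rfl <;> constructor <;> linarith [hs.1, hs.2]
  have hεp : -Real.pi ≤ ε * p := by
    rw [abs_le] at hp
    rcases hε with rfl | rfl <;> linarith [hp.1, hp.2]
  set v := ‖z‖ * Real.cos (ω / 2 + ε * p) with hv
  have hvX : (Complex.exp ((θ + ε * (ω / 2) : ℝ) * Complex.I) * z).re = v := by
    rw [hX, ← mul_assoc, hεε, one_mul]
  have hπ := Real.pi_pos
  -- The supremum over the open interval of directions is attained at the edge.
  have hvΛ : Λ < v := by
    obtain ⟨η, hη, h⟩ := hz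
    have hs : |η - θ| < ω / 2 := by rw [abs_lt]; constructor <;> linarith [hη.1, hη.2]
    obtain ⟨h1, h2⟩ := hεabs _ hs
    have e := hX (η - θ)
    rw [add_sub_cancel] at e
    rw [e] at h
    refine h.trans_le (mul_le_mul_of_nonneg_left ?_ (norm_nonneg z))
    rw [← Real.cos_neg, ← Real.cos_neg (ω / 2 + ε * p)]
    by_cases hle : -(ε * (η - θ) + ε * p) ≤ Real.pi
    · exact Real.cos_le_cos_of_nonneg_of_le_pi (by linarith) hle (by linarith)
    · push Not at hle
      rw [← Real.cos_two_pi_sub (-(ε * (η - θ) + ε * p))]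
      exact Real.cos_le_cos_of_nonneg_of_le_pi (by linarith) (by linarith) (by linarith)
  have hv0 : 0 < v := by linarith
  -- Moving `z` by `v` against the direction of the edge leads out of the domain.
  have hΔ : Metric.infDist z (frontier (dualDomain θ ω Λ)) ≤ v := by
    set w := z - v * Complex.exp (-((θ + ε * (ω / 2) : ℝ) * Complex.I)) with hw
    have hwU : w ∉ dualDomain θ ω Λ := by
      rintro ⟨η, hη, h⟩
      have hs : |η - θ| < ω / 2 := by rw [abs_lt]; constructor <;> linarith [hη.1, hη.2]
      obtain ⟨h1, h2⟩ := hεabs _ hs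
      have e := hX (η - θ)
      rw [add_sub_cancel] at e
      have e2 : (Complex.exp (η * Complex.I) *
          (v * Complex.exp (-((θ + ε * (ω / 2) : ℝ) * Complex.I)))).re =
          v * Real.cos (ε * (η - θ) - ω / 2) := by
        have e3 : (η : ℂ) * Complex.I + -((θ + ε * (ω / 2) : ℝ) * Complex.I) =
            ((η - θ - ε * (ω / 2) : ℝ) : ℂ) * Complex.I := by push_cast; ring
        rw [mul_left_comm, ← Complex.exp_add, e3, Complex.re_ofReal_mul,
          Complex.exp_ofReal_mul_I_re]
        congr 1
        rcases hε with rfl | rfl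
        · congr 1; ring
        · rw [← Real.cos_neg]; congr 1; ring
      rw [hw, mul_sub, Complex.sub_re, e, e2, hv] at h
      have e4 : ε * (η - θ) + ε * p = (ε * (η - θ) - ω / 2) + (ω / 2 + ε * p) := by ring
      rw [e4, Real.cos_add] at h
      have s1 : Real.sin (ε * (η - θ) - ω / 2) ≤ 0 :=
        Real.sin_nonpos_of_nonpos_of_neg_pi_le (by linarith) (by linarith)
      have s2 : Real.sin (ω / 2 + ε * p) ≤ 0 :=
        Real.sin_nonpos_of_nonpos_of_neg_pi_le (by linarith) (by linarith)
      have := mul_nonneg (norm_nonneg z) (mul_nonneg_of_nonpos_of_nonpos s1 s2)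
      have hΛ0 : 0 ≤ Λ := by linarith
      linarith
    refine (infDist_frontier_le_dist hz hwU).trans_eq ?_
    rw [dist_eq_norm, hw, sub_sub_cancel, norm_mul, ← neg_mul, ← Complex.ofReal_neg,
      Complex.norm_exp_ofReal_mul_I, Complex.norm_real, Real.norm_of_nonneg hv0.le, mul_one]
  have hopen : IsOpen {η : ℝ | 3 / 4 * v < (Complex.exp (η * Complex.I) * z).re} :=
    isOpen_lt (by fun_prop) (by fun_prop)
  have hcl : θ + ε * (ω / 2) ∈ closure (Ioo (θ - ω / 2) (θ + ω / 2)) := by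
    rw [closure_Ioo (by linarith)]
    rcases hε with rfl | rfl <;> constructor <;> linarith
  obtain ⟨η, hη1, hη2⟩ := mem_closure_iff.1 hcl _ hopen (by
    rw [mem_ofPred_eq, hvX]; linarith)
  refine ⟨η, hη2, hΔ.trans ?_⟩
  rw [mem_ofPred_eq] at hη1
  linarith

/-- Up to a factor, the distance to the boundary is also bounded above by the distance to the
boundary of some half-plane in the dual domain. -/
theorem exists_infDist_frontier_le (hω : 0 < ω) (hωπ : ω ≤ Real.pi) (hΛ₀ : 0 ≤ Λ₀)
    (hΛ : 2 * Λ₀ ≤ Λ) (hz : z ∈ dualDomain θ ω Λ) :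
    ∃ η ∈ Ioo (θ - ω / 2) (θ + ω / 2), Metric.infDist z (frontier (dualDomain θ ω Λ)) ≤
      4 * ((Complex.exp (η * Complex.I) * z).re - Λ₀) := by
  set p := (Complex.exp (θ * Complex.I) * z).arg with hp
  have hpπ : |p| ≤ Real.pi := Complex.abs_arg_le_pi _
  have hzp : z = (‖z‖ : ℝ) * Complex.exp ((p - θ : ℝ) * Complex.I) := by
    have h := Complex.norm_mul_exp_arg_mul_I (Complex.exp (θ * Complex.I) * z)
    rw [norm_mul, Complex.norm_exp_ofReal_mul_I, one_mul, ← hp] at h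
    have e : ((p - θ : ℝ) : ℂ) * Complex.I = -(θ * Complex.I) + p * Complex.I := by
      push_cast; ring
    rw [e, Complex.exp_add, mul_left_comm, h, ← mul_assoc, ← Complex.exp_add]
    simp
  by_cases h : |p| < ω / 2
  · rw [abs_lt] at h
    have hre : (Complex.exp ((θ - p : ℝ) * Complex.I) * z).re = ‖z‖ := by
      rw [hzp, mul_left_comm, ← Complex.exp_add, ← add_mul, ← Complex.ofReal_add, ← hzp]
      simp
    refine ⟨θ - p, ⟨by linarith, by linarith⟩, ?_⟩
    rw [hre]
    obtain ⟨η, hη, hzη⟩ := hz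
    have h1 := hzη.trans_le (re_exp_mul_le_norm η z)
    have h2 := infDist_frontier_le_norm (by linarith) (show z ∈ dualDomain θ ω Λ from ⟨η, hη, hzη⟩)
    linarith
  · push Not at h
    rcases le_abs'.1 h with h | h
    · exact exists_infDist_frontier_le_of_edge hω hωπ hΛ₀ hΛ hz (Or.inl rfl) hpπ hzp (by linarith)
    · exact exists_infDist_frontier_le_of_edge hω hωπ hΛ₀ hΛ hz (Or.inr rfl) hpπ hzp (by linarith)

theorem dualDomain_rotate_mem_slitPlane (hωπ : ω ≤ Real.pi) (hΛ : 0 ≤ Λ)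
    (hz : z ∈ dualDomain θ ω Λ) :
    Complex.exp (-((-θ : ℝ) * Complex.I)) * z ∈ Complex.slitPlane := by
  obtain ⟨η, hη, h⟩ := hz
  set v := Complex.exp (-((-θ : ℝ) * Complex.I)) * z with hv
  have e : Complex.exp (η * Complex.I) * z = Complex.exp ((η - θ : ℝ) * Complex.I) * v := by
    rw [hv, ← mul_assoc, ← Complex.exp_add]
    congr 2
    push_cast; ring
  rw [e, Complex.mul_re, Complex.exp_ofReal_mul_I_re, Complex.exp_ofReal_mul_I_im] at h
  rw [Complex.mem_slitPlane_iff]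
  by_contra! hc
  rw [hc.2, mul_zero, sub_zero] at h
  have hcos : 0 < Real.cos (η - θ) :=
    Real.cos_pos_of_mem_Ioo ⟨by linarith [hη.1], by linarith [hη.2]⟩
  nlinarith [hc.1]

theorem differentiableOn_branchPow_dualDomain (hωπ : ω ≤ Real.pi) (hΛ : 0 ≤ Λ) (s : ℂ) :
    DifferentiableOn ℂ (branchPow (-θ) s) (dualDomain θ ω Λ) := fun _ hz =>
  (hasDerivAt_branchPow (-θ) s
    (dualDomain_rotate_mem_slitPlane hωπ hΛ hz)).differentiableAt.differentiableWithinAt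

end geometry

section spaces

variable {τ α : ℂ} {θ ω Λ : ℝ} {ψ : ℂ → ℂ}

theorem hasBasis_dualFilter (θ ω : ℝ) :
    (dualFilter θ ω).HasBasis (fun _ : ℝ => True) (dualDomain θ ω) := by
  refine hasBasis_iInf_principal fun a b => ?_
  exact ⟨max a b, dualDomain_anti (le_max_left _ _), dualDomain_anti (le_max_right _ _)⟩

theorem eventually_dualFilter_iff {p : ℂ → Prop} :
    (∀ᶠ z in dualFilter θ ω, p z) ↔ ∃ Λ, ∀ z ∈ dualDomain θ ω Λ, p z := by
  simpa using (hasBasis_dualFilter θ ω).eventually_iff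

theorem frequencyAffine_subset (hωπ : ω ≤ Real.pi) (hτ : 0 < τ.re) :
    frequencyAffine τ α θ ω ⊆ expDualSpace (-τ.re) α θ ω := by
  rintro G ⟨H, ⟨Λ, hΛ, Φ, ⟨hd, C, hC⟩, rfl⟩, rfl⟩
  refine ⟨powGerm (-τ) θ ω + (Φ : DualGerm θ ω), ⟨Λ + 1, by linarith,
    fun z => branchPow (-θ) (-τ) z + Φ z, ⟨?_, ?_⟩, rfl⟩, rfl⟩
  · exact (differentiableOn_branchPow_dualDomain hωπ (by linarith) _).add
      (hd.mono (dualDomain_anti (by linarith)))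
  · refine ⟨branchConst (-θ) (-τ) + |C|, fun z hz => ?_⟩
    have hΔ0 := infDist_frontier_pos (by linarith : 0 ≤ Λ + 1) hz
    set Δ := Metric.infDist z (frontier (dualDomain θ ω (Λ + 1)))
    set Δ' := Metric.infDist z (frontier (dualDomain θ ω Λ)) with hΔ'
    have hzΛ : z ∈ dualDomain θ ω Λ := dualDomain_anti (by linarith) hz
    have hΔΔ' : Δ ≤ Δ' := infDist_frontier_anti (by linarith) hΛ.le hz
    have h1Δ' : 1 ≤ Δ' := by
      obtain ⟨η, hη, h⟩ := hz
      have := sub_le_infDist_frontier hΛ.le hη ((lt_add_one Λ).trans h)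
      linarith
    have hΔz : Δ ≤ ‖z‖ := infDist_frontier_le_norm (by linarith) hz
    have hz0 : z ≠ 0 := norm_pos_iff.1 (hΔ0.trans_le hΔz)
    have hb : ‖branchPow (-θ) (-τ) z‖ ≤ branchConst (-θ) (-τ) * Δ ^ (-τ.re) := by
      refine (norm_branchPow_le (-θ) (-τ) hz0).trans ?_
      refine mul_le_mul_of_nonneg_left ?_ (zero_le_one.trans (one_le_branchConst _ _))
      rw [Complex.neg_re]
      exact Real.rpow_le_rpow_of_nonpos hΔ0 hΔz (by linarith)
    have hΦ : ‖Φ z‖ ≤ |C| * Δ ^ (-τ.re) := by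
      refine (hC z hzΛ).trans ?_
      have h1 : Δ' ^ (-τ.re - 1) ≤ Δ ^ (-τ.re) :=
        (Real.rpow_le_rpow_of_exponent_le h1Δ' (by linarith)).trans
          (Real.rpow_le_rpow_of_nonpos hΔ0 hΔΔ' (by linarith))
      have h2 : 0 ≤ Δ' ^ (-τ.re - 1) := by positivity
      exact mul_le_mul (le_abs_self C) h1 h2 (abs_nonneg C)
    rw [add_mul]
    exact (norm_add_le _ _).trans (add_le_add hb hΦ)

/-- The Laplace transform maps the affine space on the position domain to the affine space on the
frequency domain. -/
theorem sectorLaplace_mem_frequencyAffine (hω : 0 < ω) (hωπ : ω ≤ Real.pi) (hτ : 0 < τ.re)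
    (hψ : InPositionAffine τ α θ ω ψ) :
    ∃ Λ₀ : ℝ, ∀ Λ, Λ₀ ≤ Λ → DifferentiableOn ℂ (sectorLaplace α θ ω Λ ψ) (dualDomain θ ω Λ) →
      ((sectorLaplace α θ ω Λ ψ : ℂ → ℂ) : DualGerm θ ω) ∈ frequencyAffine τ α θ ω := by
  have hΓ : Complex.Gamma τ ≠ 0 := Complex.Gamma_ne_zero_of_re_pos hτ
  obtain ⟨Λ₁, M₁, hΛ₁, hM₁, h₁⟩ := (hψ.isSingExp hωπ).exists_singExpWith
  obtain ⟨Λ₂, M₂, hΛ₂, hM₂, h₂⟩ := IsSingExp.exists_singExpWith hψ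
  refine ⟨max 1 (max Λ₁ Λ₂), fun Λ hΛ hdiff => ?_⟩
  have l0 : 1 ≤ Λ := (le_max_left _ _).trans hΛ
  have l1 : Λ₁ ≤ Λ := (le_max_left _ _).trans ((le_max_right _ _).trans hΛ)
  have l2 : Λ₂ ≤ Λ := (le_max_right _ _).trans ((le_max_right _ _).trans hΛ)
  replace h₁ := h₁ Λ l1
  replace h₂ := h₂ Λ l2
  set Ψ := sectorLaplace α θ ω Λ ψ with hΨ
  set H : ℂ → ℂ := fun z => Complex.exp (α * z) * Ψ z - branchPow (-θ) (-τ) z with hH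
  have hsub := dualDomain_anti (θ := θ) (ω := ω) (show Λ ≤ 2 * Λ by linarith)
  refine ⟨(H : DualGerm θ ω), ⟨2 * Λ, by linarith, H, ⟨?_, ?_⟩, rfl⟩, ?_⟩
  · refine DifferentiableOn.sub (DifferentiableOn.mul (by fun_prop) (hdiff.mono hsub)) ?_
    exact differentiableOn_branchPow_dualDomain hωπ (by linarith) _
  · set c := M₂ * Real.Gamma (τ.re + 1) with hc
    have hc0 : 0 ≤ c := mul_nonneg hM₂ (Real.Gamma_pos_of_pos (by linarith)).le
    refine ⟨c * 4 ^ (τ.re + 1), fun z hz => ?_⟩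
    obtain ⟨η, hη, hΔ⟩ := exists_infDist_frontier_le hω hωπ (by linarith) le_rfl hz
    have hΔ0 := infDist_frontier_pos (by linarith : 0 ≤ 2 * Λ) hz
    set Δ := Metric.infDist z (frontier (dualDomain θ ω (2 * Λ)))
    have hzη : Λ < (Complex.exp (η * Complex.I) * z).re := by linarith
    have hbp : SingExpWith (τ.re - 1) Λ (‖(Complex.Gamma τ)⁻¹‖ * branchConst θ (τ - 1)) α
        (sector α θ ω) (fun ζ => (Complex.Gamma τ)⁻¹ * branchPow θ (τ - 1) (ζ - α)) := by
      have h := ((singExpWith_branchPow (α := α) (θ := θ) hωπ (τ - 1)).const_mul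
        (Complex.Gamma τ)⁻¹).mono (mul_nonneg (norm_nonneg _)
          (zero_le_one.trans (one_le_branchConst θ _))) le_rfl (show 0 ≤ Λ by linarith)
      simpa using h
    have hHz : H z = Complex.exp (α * z) * rayLaplace α η
        (fun ζ => ψ ζ - branchPow θ (τ - 1) (ζ - α) / Complex.Gamma τ) z := by
      have e : rayLaplace α η ψ z = rayLaplace α η (fun ζ =>
          (ψ ζ - branchPow θ (τ - 1) (ζ - α) / Complex.Gamma τ) +
            (Complex.Gamma τ)⁻¹ * branchPow θ (τ - 1) (ζ - α)) z :=
        rayLaplace_congr hη fun ζ _ => by ring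
      rw [rayLaplace_add hη (by linarith) (by linarith) h₂ hbp hzη, rayLaplace_const_mul,
        rayLaplace_branchPow hωπ hη hτ (by linarith)] at e
      have hexp : Complex.exp (α * z) * Complex.exp (-(α * z)) = 1 := by
        rw [← Complex.exp_add]; simp
      simp only [hH, hΨ]
      rw [sectorLaplace_eq hω hωπ (by linarith) (by linarith) hM₁ h₁ hη hzη, e]
      linear_combination (branchPow (-θ) (-τ) z) * hexp + (branchPow (-θ) (-τ) z *
        Complex.exp (α * z) * Complex.exp (-(α * z))) * inv_mul_cancel₀ hΓ
    have hb := norm_rayLaplace_le hη (by linarith) h₂ hzη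
    rw [hHz, norm_mul]
    have hexp : ‖Complex.exp (α * z)‖ * ‖Complex.exp (-(α * z))‖ = 1 := by
      rw [← norm_mul, ← Complex.exp_add]; simp
    calc _ ≤ ‖Complex.exp (α * z)‖ * (‖Complex.exp (-(α * z))‖ * c *
          ((Complex.exp (η * Complex.I) * z).re - Λ) ^ (-(τ.re + 1))) := by gcongr
      _ = c * ((Complex.exp (η * Complex.I) * z).re - Λ) ^ (-(τ.re + 1)) := by
          linear_combination (c * ((Complex.exp (η * Complex.I) * z).re - Λ) ^ (-(τ.re + 1))) * hexp
      _ ≤ c * (Δ / 4) ^ (-(τ.re + 1)) := by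
          refine mul_le_mul_of_nonneg_left ?_ hc0
          exact Real.rpow_le_rpow_of_nonpos (by positivity) (by linarith) (by linarith)
      _ = c * 4 ^ (τ.re + 1) * Δ ^ (-τ.re - 1) := by
          rw [Real.div_rpow hΔ0.le (by norm_num), Real.rpow_neg (by norm_num : (0 : ℝ) ≤ 4),
            div_inv_eq_mul, show -(τ.re + 1) = -τ.re - 1 by ring]
          ring
  · have e : Ψ = fun z => Complex.exp (-(α * z)) * (branchPow (-θ) (-τ) z + H z) := by
      ext z
      have hexp : Complex.exp (-(α * z)) * Complex.exp (α * z) = 1 := by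
        rw [← Complex.exp_add]; simp
      simp only [hH]
      linear_combination (-Ψ z) * hexp
    conv_lhs => rw [e]
    rfl

end spaces

/-! ### Uniqueness for the differential equation on a half-plane -/

/-- A function that tends to `0` at infinity is bounded by the total variation of a majorant. -/
theorem norm_le_of_norm_deriv_le {k k' : ℝ → ℂ} {b b' : ℝ → ℝ} {B : ℝ}
    (hk : ∀ s, 0 ≤ s → HasDerivAt k (k' s) s) (hb : ∀ s, 0 ≤ s → HasDerivAt b (b' s) s)
    (hle : ∀ s, 0 ≤ s → ‖k' s‖ ≤ b' s) (hB : ∀ s, 0 ≤ s → b s ≤ B)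
    (hlim : Tendsto k atTop (𝓝 0)) : ‖k 0‖ ≤ B - b 0 := by
  have h : ∀ s, 0 ≤ s → ‖k s - k 0‖ ≤ B - b 0 := by
    intro s hs
    have := image_norm_le_of_norm_deriv_right_le_deriv_boundary' (a := 0) (b := s)
      (f := fun s => k s - k 0) (f' := k') (B := fun s => b s - b 0) (B' := b')
      (fun x hx => ((hk x hx.1).sub_const _).continuousAt.continuousWithinAt)
      (fun x hx => ((hk x hx.1).sub_const _).hasDerivWithinAt) (by simp)
      (fun x hx => ((hb x hx.1).sub_const _).continuousAt.continuousWithinAt)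
      (fun x hx => ((hb x hx.1).sub_const _).hasDerivWithinAt)
      (fun x hx => hle x hx.1) (right_mem_Icc.2 hs)
    have h2 := hB s hs
    linarith
  have hl := (hlim.sub_const (k 0)).norm
  rw [zero_sub, norm_neg] at hl
  refine le_of_tendsto hl ?_
  filter_upwards [eventually_ge_atTop 0] with s hs using h s hs

section halfPlane

variable {α τ : ℂ} {θ σ Λ : ℝ} {f : ℂ → ℂ} {z : ℂ}

/-- The real part of `e^{iθ} z`, the coordinate that measures the depth in the half-planes of
direction `θ`. -/
noncomputable def depth (θ : ℝ) (z : ℂ) : ℝ := (Complex.exp (θ * Complex.I) * z).re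

theorem depth_le_norm (θ : ℝ) (z : ℂ) : depth θ z ≤ ‖z‖ := re_exp_mul_le_norm θ z

theorem depth_add (θ : ℝ) (z w : ℂ) : depth θ (z + w) = depth θ z + depth θ w := by
  simp only [depth, mul_add, Complex.add_re]

theorem depth_ofReal_mul (θ s : ℝ) (u : ℂ) : depth θ (s * u) = s * depth θ u := by
  rw [depth, mul_left_comm, Complex.re_ofReal_mul]; rfl

theorem depth_exp_neg (θ : ℝ) : depth θ (Complex.exp (-(θ * Complex.I))) = 1 := by
  rw [depth, ← Complex.exp_add]; simp

theorem isOpen_depth (θ Λ : ℝ) : IsOpen {z | Λ < depth θ z} := by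
  unfold depth
  exact isOpen_lt (by fun_prop) (by fun_prop)

/-- `f` is holomorphic on the half-plane of depth more than `Λ`, and `e^{αz} f` and all
`e^{αz} f^{(k)}` are bounded there by multiples of the power `σ` of the depth. -/
structure DecaysWith (α : ℂ) (θ σ Λ : ℝ) (f : ℂ → ℂ) : Prop where
  diff : DifferentiableOn ℂ f {z | Λ < depth θ z}
  bound : ∀ k : ℕ, ∃ C, ∀ z, Λ < depth θ z →
    ‖Complex.exp (α * z) * iteratedDeriv k f z‖ ≤ C * depth θ z ^ σ

theorem contDiffAt_of_depth (hf : DifferentiableOn ℂ f {z | Λ < depth θ z})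
    (hz : Λ < depth θ z) (n : ℕ) : ContDiffAt ℂ n f z :=
  (hf.analyticAt ((isOpen_depth θ Λ).mem_nhds hz)).contDiffAt

theorem contDiffAt_deriv_of_depth (hf : DifferentiableOn ℂ f {z | Λ < depth θ z})
    (hz : Λ < depth θ z) (n : ℕ) : ContDiffAt ℂ n (deriv f) z :=
  (hf.analyticAt ((isOpen_depth θ Λ).mem_nhds hz)).deriv.contDiffAt

theorem iteratedDeriv_linear (hf : DifferentiableOn ℂ f {z | Λ < depth θ z})
    (hz : Λ < depth θ z) (β : ℂ) (n : ℕ) :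
    iteratedDeriv n (fun w => deriv f w + β * f w) z =
      iteratedDeriv (n + 1) f z + β * iteratedDeriv n f z := by
  have h1 := contDiffAt_of_depth hf hz n
  have h2 := contDiffAt_deriv_of_depth hf hz n
  rw [iteratedDeriv_fun_add h2 (contDiffAt_const.mul h1), iteratedDeriv_const_mul_field,
    iteratedDeriv_succ']

open Polynomial in
theorem polyDeriv_linear_mul (hf : DifferentiableOn ℂ f {z | Λ < depth θ z})
    (hz : Λ < depth θ z) (β : ℂ) (T : ℂ[X]) :
    polyDeriv ((X + C β) * T) f z = polyDeriv T (fun w => deriv f w + β * f w) z := by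
  induction T using Polynomial.induction_on' with
  | add p q hp hq => rw [mul_add, polyDeriv_add, polyDeriv_add, hp, hq]
  | monomial n a =>
    rw [add_mul, X_mul_monomial, C_mul_monomial, polyDeriv_add, polyDeriv_monomial,
      polyDeriv_monomial, polyDeriv_monomial, iteratedDeriv_linear hf hz]
    ring

open Polynomial in
theorem hasDerivAt_polyDeriv (hf : DifferentiableOn ℂ f {z | Λ < depth θ z})
    (hz : Λ < depth θ z) (T : ℂ[X]) :
    HasDerivAt (polyDeriv T f) (polyDeriv (X * T) f z) z := by
  induction T using Polynomial.induction_on' with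
  | add p q hp hq =>
    rw [mul_add, polyDeriv_add]
    exact (hp.add hq).congr_of_eventuallyEq (Eventually.of_forall fun w => polyDeriv_add p q f w)
  | monomial n a =>
    rw [X_mul_monomial, polyDeriv_monomial]
    have h : DifferentiableAt ℂ (iteratedDeriv n f) z := by
      rw [iteratedDeriv_eq_iterate]
      exact ((hf.analyticAt ((isOpen_depth θ Λ).mem_nhds hz)).iterated_deriv n).differentiableAt
    have h' := h.hasDerivAt.const_mul a
    rw [← iteratedDeriv_succ] at h'
    exact h'.congr_of_eventuallyEq (Eventually.of_forall fun w => polyDeriv_monomial n a f w)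

theorem polyDeriv_C_mul (c : ℂ) (T : Polynomial ℂ) (f : ℂ → ℂ) (z : ℂ) :
    polyDeriv (Polynomial.C c * T) f z = c * polyDeriv T f z := by
  induction T using Polynomial.induction_on' with
  | add p q hp hq => rw [mul_add, polyDeriv_add, polyDeriv_add, hp, hq, mul_add]
  | monomial n a => rw [Polynomial.C_mul_monomial, polyDeriv_monomial, polyDeriv_monomial, mul_assoc]

theorem polyDeriv_C (c : ℂ) (f : ℂ → ℂ) (z : ℂ) : polyDeriv (Polynomial.C c) f z = c * f z := by
  rw [← Polynomial.monomial_zero_left, polyDeriv_monomial, iteratedDeriv_zero]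

theorem DecaysWith.linear (hf : DecaysWith α θ σ Λ f) (β : ℂ) :
    DecaysWith α θ σ Λ (fun w => deriv f w + β * f w) := by
  refine ⟨(hf.diff.deriv (isOpen_depth θ Λ)).add (hf.diff.const_mul β), fun k => ?_⟩
  obtain ⟨C₁, h₁⟩ := hf.bound (k + 1)
  obtain ⟨C₂, h₂⟩ := hf.bound k
  refine ⟨C₁ + ‖β‖ * C₂, fun z hz => ?_⟩
  rw [iteratedDeriv_linear hf.diff hz, mul_add, mul_left_comm, add_mul, mul_assoc]
  refine (norm_add_le _ _).trans (add_le_add (h₁ z hz) ?_)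
  rw [norm_mul]
  exact mul_le_mul_of_nonneg_left (h₂ z hz) (norm_nonneg _)

theorem DecaysWith.polyDeriv (hf : DecaysWith α θ σ Λ f) (T : Polynomial ℂ) :
    ∃ C, ∀ z, Λ < depth θ z →
      ‖Complex.exp (α * z) * polyDeriv T f z‖ ≤ C * depth θ z ^ σ := by
  induction T using Polynomial.induction_on' with
  | add p q hp hq =>
    obtain ⟨C₁, h₁⟩ := hp
    obtain ⟨C₂, h₂⟩ := hq
    refine ⟨C₁ + C₂, fun z hz => ?_⟩
    rw [polyDeriv_add, mul_add, add_mul]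
    exact (norm_add_le _ _).trans (add_le_add (h₁ z hz) (h₂ z hz))
  | monomial n a =>
    obtain ⟨C, h⟩ := hf.bound n
    refine ⟨‖a‖ * C, fun z hz => ?_⟩
    rw [polyDeriv_monomial, mul_left_comm, norm_mul, mul_assoc]
    exact mul_le_mul_of_nonneg_left (h z hz) (norm_nonneg _)

/-- Inversion of `d/dz + β` by integration to infinity in a direction `u` that does not leave the
half-plane and in which `e^{(β - α) z}` decays. -/
theorem DecaysWith.norm_le_of_linear (hΛ : 1 ≤ Λ) (hσ : σ ≤ 0) (hf : DecaysWith α θ σ Λ f)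
    {β u : ℂ} {κ Y : ℝ} (hκ : 0 < κ) (hu : ‖u‖ ≤ 1) (hu' : 0 ≤ depth θ u)
    (huβ : ((β - α) * u).re ≤ -κ)
    (h : ∀ z, Λ < depth θ z →
      ‖Complex.exp (α * z) * (deriv f z + β * f z)‖ ≤ Y * depth θ z ^ σ)
    (hz : Λ < depth θ z) : ‖Complex.exp (α * z) * f z‖ ≤ Y / κ * depth θ z ^ σ := by
  set w : ℝ → ℂ := fun s => z + s * u with hw
  have hdepth : ∀ s : ℝ, 0 ≤ s → depth θ z ≤ depth θ (w s) := fun s hs => by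
    rw [hw, depth_add, depth_ofReal_mul]
    nlinarith [mul_nonneg hs hu']
  have hwΛ : ∀ s : ℝ, 0 ≤ s → Λ < depth θ (w s) := fun s hs => hz.trans_le (hdepth s hs)
  have hz0 : 0 < depth θ z := by linarith
  have hpow : ∀ s : ℝ, 0 ≤ s → depth θ (w s) ^ σ ≤ depth θ z ^ σ := fun s hs =>
    Real.rpow_le_rpow_of_nonpos hz0 (hdepth s hs) hσ
  have hYz : 0 ≤ Y * depth θ z ^ σ := (norm_nonneg _).trans (h z hz)
  have hY : 0 ≤ Y := nonneg_of_mul_nonneg_left hYz (Real.rpow_pos_of_pos hz0 σ)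
  have hexp : ∀ s : ℝ, 0 ≤ s → ‖Complex.exp ((β - α) * u * s)‖ ≤ Real.exp (-κ * s) := by
    intro s hs
    rw [Complex.norm_exp, mul_comm, Complex.re_ofReal_mul]
    exact Real.exp_le_exp.2 (by nlinarith)
  have hk := norm_le_of_norm_deriv_le
    (k := fun s : ℝ => Complex.exp ((β - α) * u * s) * (Complex.exp (α * w s) * f (w s)))
    (k' := fun s : ℝ => Complex.exp ((β - α) * u * s) *
      (u * (Complex.exp (α * w s) * (deriv f (w s) + β * f (w s)))))
    (b := fun s : ℝ => -(Y * depth θ z ^ σ / κ * Real.exp (-κ * s)))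
    (b' := fun s : ℝ => Y * depth θ z ^ σ * Real.exp (-κ * s)) (B := 0)
    (fun s hs => by
      have hwd : HasDerivAt w u s := by
        have := ((Complex.ofRealCLM.hasDerivAt (x := s)).mul_const u).const_add z
        simpa only [Complex.ofRealCLM_apply, Complex.ofReal_one, one_mul] using this
      have h1 : HasDerivAt f (deriv f (w s)) (w s) := (hf.diff.differentiableAt
        ((isOpen_depth θ Λ).mem_nhds (hwΛ s hs))).hasDerivAt
      have h2 : HasDerivAt (fun s => f (w s)) (deriv f (w s) * u) s := h1.comp s hwd
      have h3 := (hwd.const_mul α).cexp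
      have h4 := ((Complex.ofRealCLM.hasDerivAt (x := s)).const_mul ((β - α) * u)).cexp
      refine (h4.mul (h3.mul h2)).congr_deriv ?_
      simp only [Complex.ofRealCLM_apply, Complex.ofReal_one, Pi.mul_apply]
      ring)
    (fun s _ => by
      have := ((((hasDerivAt_id s).const_mul (-κ)).exp).const_mul (Y * depth θ z ^ σ / κ)).neg
      refine this.congr_deriv ?_
      simp only [id]
      field_simp)
    (fun s hs => by
      rw [norm_mul, norm_mul]
      calc _ ≤ Real.exp (-κ * s) * (1 * (Y * depth θ z ^ σ)) := by
            have h1 := hexp s hs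
            have h2 : ‖Complex.exp (α * w s) * (deriv f (w s) + β * f (w s))‖ ≤
                Y * depth θ z ^ σ := (h _ (hwΛ s hs)).trans
              (mul_le_mul_of_nonneg_left (hpow s hs) hY)
            gcongr
        _ = _ := by ring)
    (fun s _ => by
      have : 0 ≤ Y * depth θ z ^ σ / κ * Real.exp (-κ * s) := by positivity
      linarith)
    (by
      obtain ⟨C, hC⟩ := hf.bound 0
      simp only [iteratedDeriv_zero] at hC
      refine squeeze_zero_norm' (a := fun s => |C| * depth θ z ^ σ * Real.exp (-κ * s)) ?_ ?_
      · filter_upwards [eventually_ge_atTop 0] with s hs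
        rw [norm_mul, mul_comm]
        have h1 : ‖Complex.exp (α * w s) * f (w s)‖ ≤ |C| * depth θ z ^ σ := by
          refine (hC _ (hwΛ s hs)).trans ?_
          exact mul_le_mul (le_abs_self C) (hpow s hs)
            (Real.rpow_nonneg (hz0.trans_le (hdepth s hs)).le _) (abs_nonneg C)
        have h2 := hexp s hs
        gcongr
      · have : Tendsto (fun s : ℝ => Real.exp (-κ * s)) atTop (𝓝 0) :=
          Real.tendsto_exp_atBot.comp (tendsto_id.const_mul_atTop_of_neg (neg_lt_zero.2 hκ))
        simpa using this.const_mul (|C| * depth θ z ^ σ))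
  simp only [hw, Complex.ofReal_zero, mul_zero, Complex.exp_zero, one_mul, zero_mul,
    add_zero, Real.exp_zero, mul_one] at hk
  refine hk.trans_eq ?_
  ring

open Polynomial in
/-- Inversion of `P₁ (d/dz)`, one linear factor at a time: derivatives of order up to `deg P₁` are
controlled by `P₁ (d/dz) f`, with a constant that does not depend on the half-plane. -/
theorem exists_norm_polyDeriv_le (s : Multiset ℂ)
    (hs : ∀ β ∈ s, ∃ u : ℂ, ‖u‖ ≤ 1 ∧ 0 ≤ depth θ u ∧ ((β - α) * u).re < 0) (S : ℂ[X])
    (hS : S.natDegree ≤ Multiset.card s) :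
    ∃ K : ℝ, 0 ≤ K ∧ ∀ Λ σ Y : ℝ, 1 ≤ Λ → σ ≤ 0 → 0 ≤ Y → ∀ f, DecaysWith α θ σ Λ f →
      (∀ z, Λ < depth θ z →
        ‖Complex.exp (α * z) * polyDeriv (negRootsPoly s) f z‖ ≤ Y * depth θ z ^ σ) →
      ∀ z, Λ < depth θ z → ‖Complex.exp (α * z) * polyDeriv S f z‖ ≤ K * Y * depth θ z ^ σ := by
  induction s using Multiset.induction generalizing S with
  | empty =>
    rw [Multiset.card_zero, Nat.le_zero, natDegree_eq_zero] at hS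
    obtain ⟨c, rfl⟩ := hS
    refine ⟨‖c‖, norm_nonneg _, fun Λ σ Y _ _ _ f _ h z hz => ?_⟩
    have h1 := h z hz
    have e : negRootsPoly 0 = C 1 := by simp [negRootsPoly]
    rw [e, polyDeriv_C, one_mul] at h1
    rw [polyDeriv_C, mul_left_comm, norm_mul, mul_assoc]
    exact mul_le_mul_of_nonneg_left h1 (norm_nonneg c)
  | cons β s ih =>
    have hs' := fun γ hγ => hs γ (Multiset.mem_cons_of_mem hγ)
    obtain ⟨u, hu, hu', huβ⟩ := hs β (Multiset.mem_cons_self β s)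
    obtain ⟨T, hT, hdeg⟩ := exists_eq_linear_mul_add S β
    rw [Multiset.card_cons] at hS
    obtain ⟨K₁, hK₁, h₁⟩ := ih hs' T (by omega)
    obtain ⟨K₂, hK₂, h₂⟩ := ih hs' (C 1) (by simp)
    set c := S.eval (-β)
    set κ := -((β - α) * u).re with hκ
    have hκ0 : 0 < κ := neg_pos.2 huβ
    refine ⟨K₁ + ‖c‖ * (K₂ / κ), by positivity, fun Λ σ Y hΛ hσ hY f hf h z hz => ?_⟩
    have hP : ∀ z, Λ < depth θ z → ‖Complex.exp (α * z) *
        polyDeriv (negRootsPoly s) (fun w => deriv f w + β * f w) z‖ ≤ Y * depth θ z ^ σ := by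
      intro z hz
      rw [← polyDeriv_linear_mul hf.diff hz, ← negRootsPoly_cons]
      exact h z hz
    have hf1 := hf.linear β
    have e1 := h₁ Λ σ Y hΛ hσ hY _ hf1 hP z hz
    have e2 := h₂ Λ σ Y hΛ hσ hY _ hf1 hP
    simp only [polyDeriv_C, one_mul] at e2
    have e3 := hf.norm_le_of_linear hΛ hσ hκ0 hu hu' (by rw [hκ, neg_neg]) e2 hz
    rw [hT, polyDeriv_add, polyDeriv_linear_mul hf.diff hz, polyDeriv_C, mul_add, mul_left_comm]
    refine (norm_add_le _ _).trans ?_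
    rw [norm_mul c]
    calc _ ≤ K₁ * Y * depth θ z ^ σ + ‖c‖ * (K₂ * Y / κ * depth θ z ^ σ) := by gcongr
      _ = _ := by ring

/-- Inversion of `d/dz + τ / z` on functions that decay faster than the solution `z ^ (-τ)` of the
homogeneous equation. -/
theorem norm_le_of_fuchsian (hΛ : 0 ≤ Λ) {g : ℂ → ℂ} {g' : ℂ → ℂ} {X Y : ℝ}
    (hg : ∀ z, Λ < depth θ z → HasDerivAt g (g' z) z)
    (hX : ∀ z, Λ < depth θ z → ‖g z‖ ≤ X * depth θ z ^ (-τ.re - 1)) (hτ : 0 ≤ τ.re)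
    (hY : ∀ z, Λ < depth θ z → ‖g' z + τ / z * g z‖ ≤ Y * depth θ z ^ (-τ.re - 2))
    (hz : Λ < depth θ z) :
    ‖g z‖ ≤ branchConst θ τ ^ 2 * Y * depth θ z ^ (-τ.re - 1) := by
  set m := depth θ z with hm
  have hm0 : 0 < m := hΛ.trans_lt hz
  set u := Complex.exp (-(θ * Complex.I)) with hu
  have hun : ‖u‖ = 1 := by
    rw [hu, ← neg_mul, ← Complex.ofReal_neg, Complex.norm_exp_ofReal_mul_I]
  set w : ℝ → ℂ := fun s => z + s * u with hw
  have hdepth : ∀ s : ℝ, depth θ (w s) = m + s := fun s => by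
    rw [hw, depth_add, depth_ofReal_mul, depth_exp_neg, mul_one]
  have hwΛ : ∀ s : ℝ, 0 ≤ s → Λ < depth θ (w s) := fun s hs => by rw [hdepth]; linarith
  have hmz : m ≤ ‖z‖ := depth_le_norm θ z
  have hz0 : 0 < ‖z‖ := hm0.trans_le hmz
  have hE : 1 ≤ branchConst (-θ) τ := one_le_branchConst _ _
  have hEE : branchConst (-θ) τ = branchConst θ τ := by simp [branchConst]
  set c := branchConst (-θ) τ * ‖z‖ ^ τ.re * m ^ (-τ.re) with hc
  have hc0 : 0 ≤ c := by positivity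
  have hY0 : 0 ≤ Y := nonneg_of_mul_nonneg_left ((norm_nonneg _).trans (hY z hz))
    (Real.rpow_pos_of_pos hm0 _)
  have hX0 : 0 ≤ X := nonneg_of_mul_nonneg_left ((norm_nonneg _).trans (hX z hz))
    (Real.rpow_pos_of_pos hm0 _)
  have hw0 : ∀ s : ℝ, 0 ≤ s → w s ≠ 0 := fun s hs h => by
    have := hdepth s
    rw [h] at this
    simp only [depth, mul_zero, Complex.zero_re] at this
    linarith
  have hbp : ∀ s : ℝ, 0 ≤ s → ‖branchPow (-θ) τ (w s)‖ ≤ c * (m + s) ^ τ.re := by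
    intro s hs
    refine (norm_branchPow_le (-θ) τ (hw0 s hs)).trans ?_
    rw [hc, mul_assoc, mul_assoc]
    refine mul_le_mul_of_nonneg_left ?_ (by linarith)
    have h1 : ‖w s‖ ≤ ‖z‖ * (m⁻¹ * (m + s)) := by
      refine (norm_add_le _ _).trans ?_
      rw [norm_mul, hun, mul_one, Complex.norm_real, Real.norm_of_nonneg hs, mul_add,
        inv_mul_cancel₀ hm0.ne', mul_add, mul_one]
      have : s ≤ ‖z‖ * (m⁻¹ * s) := by
        rw [← mul_assoc]
        exact le_mul_of_one_le_left hs (by rw [← div_eq_mul_inv, one_le_div hm0]; exact hmz)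
      linarith
    refine (Real.rpow_le_rpow (norm_nonneg _) h1 hτ).trans_eq ?_
    rw [Real.mul_rpow hz0.le (by positivity), Real.mul_rpow (by positivity) (by positivity),
      Real.inv_rpow hm0.le, Real.rpow_neg hm0.le]
  have hk := norm_le_of_norm_deriv_le
    (k := fun s : ℝ => branchPow (-θ) τ (w s) * g (w s))
    (k' := fun s : ℝ => branchPow (-θ) τ (w s) * (u * (g' (w s) + τ / w s * g (w s))))
    (b := fun s : ℝ => -(c * Y * (m + s)⁻¹))
    (b' := fun s : ℝ => c * Y * ((m + s) ^ 2)⁻¹) (B := 0)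
    (fun s hs => by
      have hwd : HasDerivAt w u s := by
        have := ((Complex.ofRealCLM.hasDerivAt (x := s)).mul_const u).const_add z
        simpa only [Complex.ofRealCLM_apply, Complex.ofReal_one, one_mul] using this
      have hslit : Complex.exp (-((-θ : ℝ) * Complex.I)) * w s ∈ Complex.slitPlane := by
        left
        have := hdepth s
        rw [depth] at this
        push_cast
        rw [neg_mul, neg_neg, this]
        linarith
      have h1 : HasDerivAt (fun s => branchPow (-θ) τ (w s)) _ s :=
        (hasDerivAt_branchPow (-θ) τ hslit).comp s hwd
      have h2 : HasDerivAt (fun s => g (w s)) (g' (w s) * u) s := (hg _ (hwΛ s hs)).comp s hwd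
      refine (h1.mul h2).congr_deriv ?_
      ring)
    (fun s hs => by
      have hms : m + s ≠ 0 := by linarith
      have := ((((hasDerivAt_id s).const_add m).inv hms).const_mul (c * Y)).neg
      refine this.congr_deriv ?_
      simp only [id]
      field_simp)
    (fun s hs => by
      have hms : 0 < m + s := by linarith
      rw [norm_mul, norm_mul, hun, one_mul]
      calc _ ≤ c * (m + s) ^ τ.re * (Y * (m + s) ^ (-τ.re - 2)) := by
            have h1 := hbp s hs
            have h2 := hY _ (hwΛ s hs)
            rw [hdepth] at h2
            gcongr
        _ = c * Y * ((m + s) ^ τ.re * (m + s) ^ (-τ.re - 2)) := by ring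
        _ = _ := by
            rw [← Real.rpow_add hms, show τ.re + (-τ.re - 2) = -(2 : ℕ) by push_cast; ring,
              Real.rpow_neg hms.le, Real.rpow_natCast])
    (fun s hs => by
      have : 0 ≤ c * Y * (m + s)⁻¹ := by positivity
      linarith)
    (by
      refine squeeze_zero_norm' (a := fun s => c * X * (m + s)⁻¹) ?_ ?_
      · filter_upwards [eventually_ge_atTop 0] with s hs
        have hms : 0 < m + s := by linarith
        rw [norm_mul]
        calc _ ≤ c * (m + s) ^ τ.re * (X * (m + s) ^ (-τ.re - 1)) := by
              have h1 := hbp s hs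
              have h2 := hX _ (hwΛ s hs)
              rw [hdepth] at h2
              gcongr
          _ = c * X * ((m + s) ^ τ.re * (m + s) ^ (-τ.re - 1)) := by ring
          _ = _ := by
              rw [← Real.rpow_add hms, show τ.re + (-τ.re - 1) = -1 by ring, Real.rpow_neg_one]
      · have : Tendsto (fun s : ℝ => (m + s)⁻¹) atTop (𝓝 0) :=
          tendsto_inv_atTop_zero.comp (tendsto_atTop_add_const_left _ m tendsto_id)
        simpa using this.const_mul (c * X))
  simp only [hw, Complex.ofReal_zero, zero_mul, add_zero, zero_sub, neg_neg, norm_mul] at hk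
  have hz0' : z ≠ 0 := norm_pos_iff.1 hz0
  have h1 : ‖branchPow (-θ) (-τ) z‖ * ‖branchPow (-θ) τ z‖ = 1 := by
    rw [← norm_mul, branchPow_neg_mul_self, norm_one]
  have h2 := norm_branchPow_le (-θ) (-τ) hz0'
  rw [branchConst_neg, Complex.neg_re] at h2
  calc ‖g z‖ = ‖branchPow (-θ) (-τ) z‖ * (‖branchPow (-θ) τ z‖ * ‖g z‖) := by
        rw [← mul_assoc, h1, one_mul]
    _ ≤ branchConst (-θ) τ * ‖z‖ ^ (-τ.re) * (c * Y * m⁻¹) := by gcongr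
    _ = branchConst (-θ) τ ^ 2 * Y * (m ^ (-τ.re) * m⁻¹) * (‖z‖ ^ (-τ.re) * ‖z‖ ^ τ.re) := by
        rw [hc]; ring
    _ = _ := by
        rw [← Real.rpow_add hz0, neg_add_cancel, Real.rpow_zero, mul_one, hEE,
          Real.rpow_sub_one hm0.ne', div_eq_mul_inv]

end halfPlane

section halfPlane

variable {α τ : ℂ} {θ σ Λ : ℝ} {δ : ℂ → ℂ} {z : ℂ}

/-- Cauchy's estimates on unit circles: a bound on `δ` in a half-plane gives bounds on all its
derivatives in a smaller one. -/
theorem decaysWith_of_norm_le {Λ₀ C : ℝ} (hΛ₀ : 0 ≤ Λ₀) (hσ : σ ≤ 0)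
    (hδ : DifferentiableOn ℂ δ {z | Λ₀ < depth θ z})
    (h : ∀ z, Λ₀ < depth θ z → ‖Complex.exp (α * z) * δ z‖ ≤ C * (depth θ z - Λ₀) ^ σ)
    (hΛ : 2 * Λ₀ + 2 ≤ Λ) : DecaysWith α θ σ Λ δ := by
  refine ⟨hδ.mono fun z hz => ?_, fun k => ⟨k.factorial * (Real.exp ‖α‖ * |C| * (2⁻¹ : ℝ) ^ σ),
    fun z hz => ?_⟩⟩
  · simp only [mem_ofPred_eq] at hz ⊢
    linarith
  -- Unit disks stay so deep in the larger half-plane that the depth at most halves on them.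
  have hball : ∀ w ∈ Metric.closedBall z 1, depth θ z / 2 ≤ depth θ w - Λ₀ := by
    intro w hw
    have h1 : depth θ z = depth θ w + depth θ (z - w) := by rw [← depth_add]; congr 1; ring
    have h2 := depth_le_norm θ (z - w)
    rw [mem_closedBall_iff_norm'] at hw
    linarith
  have hz0 : 0 < depth θ z := by linarith
  have hd : DiffContOnCl ℂ δ (Metric.ball z 1) := by
    refine (hδ.mono fun w hw => ?_).diffContOnCl
    rw [closure_ball z one_ne_zero] at hw
    have := hball w hw
    simp only [mem_ofPred_eq]
    linarith
  have hsphere : ∀ w ∈ Metric.sphere z 1, ‖δ w‖ ≤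
      ‖Complex.exp (-(α * z))‖ * (Real.exp ‖α‖ * |C| * (depth θ z / 2) ^ σ) := by
    intro w hw
    have h1 := hball w (Metric.sphere_subset_closedBall hw)
    have h2 := h w (by linarith)
    have e : δ w = Complex.exp (-(α * z)) * Complex.exp (α * (z - w)) *
        (Complex.exp (α * w) * δ w) := by
      rw [← mul_assoc, ← Complex.exp_add, ← Complex.exp_add,
        show -(α * z) + α * (z - w) + α * w = 0 by ring, Complex.exp_zero, one_mul]
    rw [e, norm_mul, norm_mul, mul_assoc, mul_assoc (Real.exp ‖α‖)]
    have h3 : ‖Complex.exp (α * (z - w))‖ ≤ Real.exp ‖α‖ := by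
      refine (Complex.norm_exp_le_exp_norm _).trans (Real.exp_le_exp.2 ?_)
      rw [mem_sphere_iff_norm, norm_sub_rev] at hw
      rw [norm_mul, hw, mul_one]
    have h4 : ‖Complex.exp (α * w) * δ w‖ ≤ |C| * (depth θ z / 2) ^ σ := by
      refine h2.trans (mul_le_mul (le_abs_self C) ?_ (Real.rpow_nonneg (by linarith) _)
        (abs_nonneg C))
      exact Real.rpow_le_rpow_of_nonpos (by linarith) h1 hσ
    gcongr
  have hc := Complex.norm_iteratedDeriv_le_of_forall_mem_sphere_norm_le k one_pos hd hsphere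
  rw [one_pow, div_one] at hc
  have e : ‖Complex.exp (α * z)‖ * ‖Complex.exp (-(α * z))‖ = 1 := by
    rw [← norm_mul, ← Complex.exp_add, add_neg_cancel, Complex.exp_zero, norm_one]
  rw [norm_mul]
  calc _ ≤ ‖Complex.exp (α * z)‖ * (k.factorial *
        (‖Complex.exp (-(α * z))‖ * (Real.exp ‖α‖ * |C| * (depth θ z / 2) ^ σ))) := by gcongr
    _ = (‖Complex.exp (α * z)‖ * ‖Complex.exp (-(α * z))‖) * (k.factorial *
        (Real.exp ‖α‖ * |C| * (depth θ z / 2) ^ σ)) := by ring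
    _ = _ := by
        rw [e, one_mul, div_eq_mul_inv, Real.mul_rpow hz0.le (by norm_num)]
        ring

open Polynomial in
/-- One step of the uniqueness argument: the decay of `P₁ (d/dz) δ` and of `P (d/dz) δ` improves by
a factor `2` deep enough in the half-plane. The terms of lower order of the equation first improve
`P (d/dz) δ` by one power of the depth, and then make `e^{αz} P₁ (d/dz) δ` a solution of the
inhomogeneous equation for `d/dz + τ / z` whose right-hand side has gained a second power. -/
theorem norm_polyDeriv_le_half {N S : ℂ[X]} {R : ℂ → ℂ} {K₁ K₂ M ρ X₀ : ℝ}
    (hτ : 0 ≤ τ.re) (hδ : DecaysWith α θ (-τ.re - 1) Λ δ) (hK₁ : 0 ≤ K₁) (hK₂ : 0 ≤ K₂)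
    (hM : 0 ≤ M) (hρ : 0 < ρ) (hR : ∀ w, ‖w‖ ≤ ρ⁻¹ → ‖R w‖ ≤ M)
    (hS : ∀ Y : ℝ, 0 ≤ Y → ∀ f, DecaysWith α θ (-τ.re - 1) Λ f →
      (∀ z, Λ < depth θ z →
        ‖Complex.exp (α * z) * polyDeriv N f z‖ ≤ Y * depth θ z ^ (-τ.re - 1)) →
      ∀ z, Λ < depth θ z →
        ‖Complex.exp (α * z) * polyDeriv S f z‖ ≤ K₁ * Y * depth θ z ^ (-τ.re - 1))
    (hone : ∀ Y : ℝ, 0 ≤ Y → ∀ f, DecaysWith α θ (-τ.re - 1) Λ f →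
      (∀ z, Λ < depth θ z →
        ‖Complex.exp (α * z) * polyDeriv N f z‖ ≤ Y * depth θ z ^ (-τ.re - 1)) →
      ∀ z, Λ < depth θ z →
        ‖Complex.exp (α * z) * f z‖ ≤ K₂ * Y * depth θ z ^ (-τ.re - 1))
    (hODE : ∀ z, Λ < depth θ z →
      levelOneOp ((X + C α) * N) (C τ * N + (X + C α) * S) R δ z = 0)
    (hΛ1 : 1 ≤ Λ) (hΛρ : ρ ≤ Λ) (hΛK : 2 * (‖τ‖ + K₁ + M * K₂) ≤ Λ)
    (hΛL : 2 * (branchConst θ τ ^ 2 * (K₁ * (‖τ‖ + K₁ + M * K₂) + M * K₂)) ≤ Λ) (hX₀ : 0 ≤ X₀)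
    (hG : ∀ z, Λ < depth θ z →
      ‖Complex.exp (α * z) * polyDeriv N δ z‖ ≤ X₀ * depth θ z ^ (-τ.re - 1))
    (hD : ∀ z, Λ < depth θ z →
      ‖Complex.exp (α * z) * polyDeriv ((X + C α) * N) δ z‖ ≤ X₀ * depth θ z ^ (-τ.re - 1)) :
    (∀ z, Λ < depth θ z →
      ‖Complex.exp (α * z) * polyDeriv N δ z‖ ≤ X₀ / 2 * depth θ z ^ (-τ.re - 1)) ∧
    ∀ z, Λ < depth θ z →
      ‖Complex.exp (α * z) * polyDeriv ((X + C α) * N) δ z‖ ≤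
        X₀ / 2 * depth θ z ^ (-τ.re - 1) := by
  set σ := -τ.re - 1 with hσ
  set K := ‖τ‖ + K₁ + M * K₂ with hK
  have hK0 : 0 ≤ K := by positivity
  have hΛ0 : 0 < Λ := by linarith
  set E := fun w => deriv δ w + α * δ w
  have hE : DecaysWith α θ σ Λ E := hδ.linear α
  have hSE : ∀ Y : ℝ, 0 ≤ Y → (∀ z, Λ < depth θ z →
      ‖Complex.exp (α * z) * polyDeriv ((X + C α) * N) δ z‖ ≤ Y * depth θ z ^ σ) →
      ∀ z, Λ < depth θ z →
        ‖Complex.exp (α * z) * polyDeriv S E z‖ ≤ K₁ * Y * depth θ z ^ σ := by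
    intro Y hY h
    refine hS Y hY E hE fun z hz => ?_
    rw [← polyDeriv_linear_mul hδ.diff hz]
    exact h z hz
  have hinv : ∀ z, Λ < depth θ z → ‖z⁻¹‖ ≤ (depth θ z)⁻¹ := fun z hz => by
    rw [norm_inv]
    exact inv_anti₀ (hΛ0.trans hz) (depth_le_norm θ z)
  have hinvΛ : ∀ z, Λ < depth θ z → (depth θ z)⁻¹ ≤ Λ⁻¹ := fun z hz => inv_anti₀ hΛ0 hz.le
  have hRz : ∀ z, Λ < depth θ z → ‖R z⁻¹‖ ≤ M := fun z hz =>
    hR _ ((hinv z hz).trans ((hinvΛ z hz).trans (inv_anti₀ hρ hΛρ)))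
  have heq : ∀ z, Λ < depth θ z → polyDeriv ((X + C α) * N) δ z =
      -(z⁻¹ * (τ * polyDeriv N δ z + polyDeriv S E z) + z⁻¹ * (z⁻¹ * (R z⁻¹ * δ z))) := by
    intro z hz
    have := hODE z hz
    rw [levelOneOp, polyDeriv_add, polyDeriv_C_mul, polyDeriv_linear_mul hδ.diff hz α S, sq,
      mul_inv] at this
    linear_combination this
  have hδX := hone X₀ hX₀ δ hδ hG
  have hRδ : ∀ z, Λ < depth θ z → ‖z⁻¹ * (R z⁻¹ * (Complex.exp (α * z) * δ z))‖ ≤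
      Λ⁻¹ * (M * (K₂ * X₀ * depth θ z ^ σ)) := by
    intro z hz
    rw [norm_mul, norm_mul (R z⁻¹)]
    have h1 := (hinv z hz).trans (hinvΛ z hz)
    have h2 := hδX z hz
    have h3 := hRz z hz
    gcongr
  have hΛinv : Λ⁻¹ ≤ 1 := inv_le_one_of_one_le₀ hΛ1
  -- All terms of lower order carry a factor `z⁻¹`.
  have hD' : ∀ z, Λ < depth θ z →
      ‖Complex.exp (α * z) * polyDeriv ((X + C α) * N) δ z‖ ≤ Λ⁻¹ * K * X₀ * depth θ z ^ σ := by
    intro z hz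
    have hm : 0 < depth θ z := hΛ0.trans hz
    have e : Complex.exp (α * z) * polyDeriv ((X + C α) * N) δ z =
        -(z⁻¹ * (τ * (Complex.exp (α * z) * polyDeriv N δ z) +
          Complex.exp (α * z) * polyDeriv S E z +
          z⁻¹ * (R z⁻¹ * (Complex.exp (α * z) * δ z)))) := by
      rw [heq z hz]; ring
    rw [e, norm_neg, norm_mul]
    have h1 : ‖τ * (Complex.exp (α * z) * polyDeriv N δ z)‖ ≤ ‖τ‖ * (X₀ * depth θ z ^ σ) := by
      rw [norm_mul]
      exact mul_le_mul_of_nonneg_left (hG z hz) (norm_nonneg τ)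
    have h2 := hSE X₀ hX₀ hD z hz
    have h3 : ‖z⁻¹ * (R z⁻¹ * (Complex.exp (α * z) * δ z))‖ ≤
        M * (K₂ * X₀ * depth θ z ^ σ) :=
      (hRδ z hz).trans (mul_le_of_le_one_left (by positivity) hΛinv)
    calc _ ≤ Λ⁻¹ * (‖τ‖ * (X₀ * depth θ z ^ σ) + K₁ * X₀ * depth θ z ^ σ +
          M * (K₂ * X₀ * depth θ z ^ σ)) := by
          refine mul_le_mul ((hinv z hz).trans (hinvΛ z hz)) ?_ (norm_nonneg _) (by positivity)
          exact (norm_add_le _ _).trans (add_le_add ((norm_add_le _ _).trans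
            (add_le_add h1 h2)) h3)
      _ = _ := by rw [hK]; ring
  have hhalf : ∀ L : ℝ, 2 * L ≤ Λ → Λ⁻¹ * L ≤ 1 / 2 := fun L hL => by
    rw [inv_mul_le_iff₀ hΛ0]; linarith
  refine ⟨fun z hz => ?_, fun z hz => ?_⟩
  -- The gain of `hD'` enters through `S (d/dz) E`, so that the right-hand side is of second order.
  · have hfuchs := norm_le_of_fuchsian (θ := θ) (Λ := Λ) (τ := τ) (z := z) hΛ0.le
      (g := fun w => Complex.exp (α * w) * polyDeriv N δ w)
      (g' := fun w => Complex.exp (α * w) * polyDeriv ((X + C α) * N) δ w)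
      (X := X₀) (Y := Λ⁻¹ * (K₁ * K + M * K₂) * X₀)
      (fun w hw => by
        have h1 : HasDerivAt (fun w : ℂ => α * w) α w := by
          simpa using (hasDerivAt_id w).const_mul α
        refine (h1.cexp.mul (hasDerivAt_polyDeriv hδ.diff hw N)).congr_deriv ?_
        rw [add_mul X, polyDeriv_add, polyDeriv_C_mul]
        ring)
      hG hτ
      (fun w hw => by
        have hm : 0 < depth θ w := hΛ0.trans hw
        have e : Complex.exp (α * w) * polyDeriv ((X + C α) * N) δ w +
            τ / w * (Complex.exp (α * w) * polyDeriv N δ w) =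
            -(w⁻¹ * (Complex.exp (α * w) * polyDeriv S E w +
              w⁻¹ * (R w⁻¹ * (Complex.exp (α * w) * δ w)))) := by
          rw [heq w hw]; ring
        rw [e, norm_neg, norm_mul]
        have h2 := hSE (Λ⁻¹ * K * X₀) (by positivity) hD' w hw
        calc _ ≤ (depth θ w)⁻¹ * (K₁ * (Λ⁻¹ * K * X₀) * depth θ w ^ σ +
              Λ⁻¹ * (M * (K₂ * X₀ * depth θ w ^ σ))) := by
              refine mul_le_mul (hinv w hw) ?_ (norm_nonneg _) (by positivity)
              exact (norm_add_le _ _).trans (add_le_add h2 (hRδ w hw))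
          _ = Λ⁻¹ * (K₁ * K + M * K₂) * X₀ * (depth θ w ^ σ * (depth θ w)⁻¹) := by ring
          _ = _ := by
              rw [show -τ.re - 2 = σ - 1 by rw [hσ]; ring, Real.rpow_sub_one hm.ne' σ,
                div_eq_mul_inv])
      hz
    have hm : 0 < depth θ z := hΛ0.trans hz
    refine hfuchs.trans (mul_le_mul_of_nonneg_right ?_ (Real.rpow_nonneg hm.le _))
    have := mul_le_mul_of_nonneg_right (hhalf _ hΛL) hX₀
    linarith
  · have hm : 0 < depth θ z := hΛ0.trans hz
    refine (hD' z hz).trans (mul_le_mul_of_nonneg_right ?_ (Real.rpow_nonneg hm.le _))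
    have := mul_le_mul_of_nonneg_right (hhalf _ hΛK) hX₀
    linarith

open Polynomial in
/-- A solution of the homogeneous equation on one half-plane that decays faster than
`e^{-αz} z^{-τ}` vanishes deep in that half-plane. -/
theorem exists_eq_zero_of_levelOneOp (s : Multiset ℂ) {S : ℂ[X]}
    (hS : S.natDegree ≤ Multiset.card s)
    (hs : ∀ β ∈ s, ∃ u : ℂ, ‖u‖ ≤ 1 ∧ 0 ≤ depth θ u ∧ ((β - α) * u).re < 0)
    {R : ℂ → ℂ} {M ρ Λ₀ C₀ : ℝ} (hM : 0 ≤ M) (hρ : 0 < ρ) (hR : ∀ w, ‖w‖ ≤ ρ⁻¹ → ‖R w‖ ≤ M)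
    (hτ : 0 ≤ τ.re) (hΛ₀ : 0 ≤ Λ₀) (hdiff : DifferentiableOn ℂ δ {z | Λ₀ < depth θ z})
    (hbound : ∀ z, Λ₀ < depth θ z →
      ‖Complex.exp (α * z) * δ z‖ ≤ C₀ * (depth θ z - Λ₀) ^ (-τ.re - 1))
    (hODE : ∀ z, Λ₀ < depth θ z → levelOneOp ((X + C α) * negRootsPoly s)
      (C τ * negRootsPoly s + (X + C α) * S) R δ z = 0) :
    ∃ Λ, ∀ z, Λ < depth θ z → δ z = 0 := by
  obtain ⟨K₁, hK₁, h₁⟩ := exists_norm_polyDeriv_le s hs S hS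
  obtain ⟨K₂, hK₂, h₂⟩ := exists_norm_polyDeriv_le s hs (C 1) (by simp)
  simp only [polyDeriv_C, one_mul] at h₂
  set K := ‖τ‖ + K₁ + M * K₂ with hK
  set L := branchConst θ τ ^ 2 * (K₁ * K + M * K₂) with hL
  have hK0 : 0 ≤ K := by positivity
  have hL0 : 0 ≤ L := by positivity
  set Λ := 2 * Λ₀ + 2 + ρ + 2 * K + 2 * L with hΛ
  have hσ : -τ.re - 1 ≤ 0 := by linarith
  have hδ : DecaysWith α θ (-τ.re - 1) Λ δ :=
    decaysWith_of_norm_le hΛ₀ hσ hdiff hbound (by linarith)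
  obtain ⟨C₁, hC₁⟩ := hδ.polyDeriv (negRootsPoly s)
  obtain ⟨C₂, hC₂⟩ := hδ.polyDeriv ((X + C α) * negRootsPoly s)
  set X₀ := max 0 (max C₁ C₂) with hX₀
  have hX₀0 : 0 ≤ X₀ := le_max_left _ _
  have hpow : ∀ z, Λ < depth θ z → 0 ≤ depth θ z ^ (-τ.re - 1) := fun z hz =>
    Real.rpow_nonneg (by linarith) _
  have hiter : ∀ n : ℕ,
      (∀ z, Λ < depth θ z → ‖Complex.exp (α * z) * polyDeriv (negRootsPoly s) δ z‖ ≤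
        X₀ / 2 ^ n * depth θ z ^ (-τ.re - 1)) ∧
      ∀ z, Λ < depth θ z → ‖Complex.exp (α * z) * polyDeriv ((X + C α) * negRootsPoly s) δ z‖ ≤
        X₀ / 2 ^ n * depth θ z ^ (-τ.re - 1) := by
    intro n
    induction n with
    | zero =>
      rw [pow_zero, div_one]
      exact ⟨fun z hz => (hC₁ z hz).trans (mul_le_mul_of_nonneg_right
          ((le_max_left _ _).trans (le_max_right _ _)) (hpow z hz)),
        fun z hz => (hC₂ z hz).trans (mul_le_mul_of_nonneg_right
          ((le_max_right _ _).trans (le_max_right _ _)) (hpow z hz))⟩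
    | succ n ih =>
      rw [pow_succ, ← div_div]
      exact norm_polyDeriv_le_half hτ hδ hK₁ hK₂ hM hρ hR
        (fun Y hY f => h₁ Λ _ Y (by linarith) hσ hY f)
        (fun Y hY f => h₂ Λ _ Y (by linarith) hσ hY f)
        (fun z hz => hODE z (by linarith)) (by linarith) (by linarith) (by linarith)
        (by linarith) (by positivity) ih.1 ih.2
  refine ⟨Λ, fun z hz => ?_⟩
  have hle : ‖Complex.exp (α * z) * δ z‖ ≤ K₂ * 0 * depth θ z ^ (-τ.re - 1) := by
    refine h₂ Λ _ 0 (by linarith) hσ le_rfl δ hδ (fun w hw => ?_) z hz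
    refine ge_of_tendsto' (x := atTop) ?_ fun n => (hiter n).1 w hw
    have := (tendsto_const_nhds (x := X₀)).div_atTop
      (tendsto_pow_atTop_atTop_of_one_lt (one_lt_two (α := ℝ)))
    exact this.mul_const _
  rw [mul_zero, zero_mul, norm_le_zero_iff] at hle
  exact (mul_eq_zero.1 hle).resolve_left (Complex.exp_ne_zero _)

end halfPlane

/-! ### The other roots: bounds on the sector and directions of integration -/

section otherRoots

variable {α β : ℂ} {θ ω : ℝ}

theorem exists_le_norm_of_notMem_closure {W : Set ℂ} (s : Multiset ℂ)
    (hs : ∀ β ∈ s, β ∉ closure W) : ∃ ε : ℝ, 0 < ε ∧ ∀ β ∈ s, ∀ ζ ∈ W, ε ≤ ‖-ζ + β‖ := by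
  induction s using Multiset.induction with
  | empty => exact ⟨1, one_pos, by simp⟩
  | cons β s ih =>
    obtain ⟨ε, hε, h⟩ := ih fun γ hγ => hs γ (Multiset.mem_cons_of_mem hγ)
    have hβ := hs β (Multiset.mem_cons_self β s)
    rw [Metric.mem_closure_iff] at hβ
    push Not at hβ
    obtain ⟨ε', hε', h'⟩ := hβ
    refine ⟨min ε ε', lt_min hε hε', fun γ hγ ζ hζ => ?_⟩
    rcases Multiset.mem_cons.1 hγ with rfl | hγ
    · refine (min_le_right _ _).trans ((h' ζ hζ).trans_eq ?_)
      rw [dist_eq_norm]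
      congr 1
      ring
    · exact (min_le_left _ _).trans (h γ hγ ζ hζ)

/-- If `β` is not on the closed ray from `α` in direction `θ`, then `e^{(β - α) z}` decays in some
direction that does not leave the half-planes of direction `θ`: one of the two directions parallel
to their edges or, if `β` is on the opposite ray, the direction orthogonal to them. -/
theorem exists_direction (hω : 0 < ω) (hβα : β ≠ α) (hβ : β ∉ sector α θ ω) :
    ∃ u : ℂ, ‖u‖ ≤ 1 ∧ 0 ≤ depth θ u ∧ ((β - α) * u).re < 0 := by
  set v := Complex.exp (-(θ * Complex.I)) with hv
  have hvn : ‖v‖ = 1 := by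
    rw [hv, ← neg_mul, ← Complex.ofReal_neg, Complex.norm_exp_ofReal_mul_I]
  have hθv : Complex.exp (θ * Complex.I) * v = 1 := by rw [hv, ← Complex.exp_add]; simp
  set w := (β - α) * v with hw
  have hβw : β = α + w * Complex.exp (θ * Complex.I) := by
    rw [hw]; linear_combination (α - β) * hθv
  rcases lt_trichotomy w.im 0 with h | h | h
  · refine ⟨-Complex.I * v, by simp [hvn], ?_, ?_⟩
    · rw [depth, mul_left_comm, hθv]; simp
    · rw [mul_left_comm, ← hw]; simpa using h
  · have hwre : w = (w.re : ℂ) := Complex.ext rfl (by simpa using h)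
    refine ⟨v, hvn.le, ?_, ?_⟩
    · rw [depth, hθv]; simp
    · rw [← hw]
      by_contra! h0
      rcases h0.eq_or_lt with h0 | h0
      · rw [hwre, ← h0] at hβw
        exact hβα (by simpa using hβw)
      · rw [hwre] at hβw
        exact hβ ⟨w.re, h0, θ, ⟨by linarith, by linarith⟩, hβw⟩
  · refine ⟨Complex.I * v, by simp [hvn], ?_, ?_⟩
    · rw [depth, mul_left_comm, hθv]; simp
    · rw [mul_left_comm, ← hw]; simpa using h

open Polynomial in
theorem exists_sectorFactorization {P Q S : ℂ[X]} {τ : ℂ} (s : Multiset ℂ)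
    (hP : P = (X + C α) * negRootsPoly s) (hQ : Q = C τ * negRootsPoly s + (X + C α) * S)
    (hS : S.natDegree ≤ Multiset.card s) (hs : ∀ β ∈ s, β ∉ closure (sector α θ ω)) :
    ∃ (K : ℝ) (T : ℂ[X]), SectorFactorization P Q (negRootsPoly s) S τ α θ ω K ∧
      negRootsPoly s = (X + C α) * T + C ((negRootsPoly s).eval (-α)) ∧
      ∀ ζ ∈ sector α θ ω, ‖T.eval (-ζ) / (negRootsPoly s).eval (-ζ)‖ ≤ K := by
  obtain ⟨ε, hε, h⟩ := exists_le_norm_of_notMem_closure s hs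
  obtain ⟨T, hT, hTdeg⟩ := exists_eq_linear_mul_add (negRootsPoly s) α
  rw [natDegree_negRootsPoly] at hTdeg
  obtain ⟨K₁, hK₁, h₁⟩ := exists_norm_eval_div_le hε s h 1 (by simp)
  obtain ⟨K₂, hK₂, h₂⟩ := exists_norm_eval_div_le hε s h S hS
  obtain ⟨K₃, hK₃, h₃⟩ := exists_norm_eval_div_le hε s h T (by omega)
  refine ⟨K₁ + K₂ + K₃, T, ⟨by positivity, hP, hQ, fun ζ hζ => ?_, fun ζ hζ => ?_,
    fun ζ hζ => ?_⟩, hT, fun ζ hζ => ?_⟩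
  · refine eval_negRootsPoly_ne_zero fun β hβ => ?_
    rintro rfl
    exact hs β hβ (subset_closure hζ)
  · have := h₁ ζ hζ
    rw [eval_one, one_div] at this
    linarith
  · linarith [h₂ ζ hζ]
  · linarith [h₃ ζ hζ]

end otherRoots

/-! ### Uniqueness on the frequency domain -/

section frequency

variable {P Q : Polynomial ℂ} {R : ℂ → ℂ} {τ α : ℂ} {θ ω Λ Λ' : ℝ} {δ f g : ℂ → ℂ} {z : ℂ}

/-- A holomorphic function on a dual domain that vanishes on a half-plane of direction `θ`
vanishes identically: that half-plane meets all those that make up the dual domain. -/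
theorem eq_zero_of_eq_zero_depth (hωπ : ω ≤ Real.pi)
    (hδ : DifferentiableOn ℂ δ (dualDomain θ ω Λ)) (h : ∀ z, Λ' < depth θ z → δ z = 0)
    (hz : z ∈ dualDomain θ ω Λ) : δ z = 0 := by
  obtain ⟨η, hη, hz⟩ := hz
  have hcos : 0 < Real.cos (η - θ) :=
    Real.cos_pos_of_mem_Ioo ⟨by linarith [hη.1], by linarith [hη.2]⟩
  have hopen : IsOpen {z : ℂ | Λ < depth η z} := isOpen_depth η Λ
  have han : AnalyticOnNhd ℂ δ {z : ℂ | Λ < depth η z} :=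
    (hδ.mono fun w hw => ⟨η, hη, hw⟩).analyticOnNhd hopen
  have hconv : Convex ℝ {z : ℂ | Λ < depth η z} := by
    intro x hx y hy a b ha hb hab
    simp only [mem_ofPred_eq, Complex.real_smul, depth_add, depth_ofReal_mul] at hx hy ⊢
    rcases ha.eq_or_lt with rfl | ha
    · rw [zero_add] at hab
      rw [hab]
      linarith
    · have e : Λ = a * Λ + b * Λ := by rw [← add_mul, hab, one_mul]
      linarith [mul_lt_mul_of_pos_left hx ha, mul_le_mul_of_nonneg_left hy.le hb]
  -- A point far out on the axis of the dual domain lies in both half-planes.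
  set t := |Λ'| + 1 + |Λ| / Real.cos (η - θ) + 1 / Real.cos (η - θ) with ht
  set z₀ : ℂ := (t : ℂ) * Complex.exp (-(θ * Complex.I)) with hz₀
  have h1 : Λ' < depth θ z₀ := by
    rw [hz₀, depth_ofReal_mul, depth_exp_neg, mul_one, ht]
    have : 0 ≤ |Λ| / Real.cos (η - θ) + 1 / Real.cos (η - θ) := by positivity
    linarith [le_abs_self Λ']
  have h2 : Λ < depth η z₀ := by
    have e : depth η (Complex.exp (-(θ * Complex.I))) = Real.cos (η - θ) := by
      rw [depth, ← Complex.exp_add, ← Complex.exp_ofReal_mul_I_re]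
      congr 2
      push_cast
      ring
    rw [hz₀, depth_ofReal_mul, e, ht, add_mul, add_mul, div_mul_cancel₀ _ hcos.ne',
      div_mul_cancel₀ _ hcos.ne']
    have : 0 ≤ (|Λ'| + 1) * Real.cos (η - θ) := by positivity
    linarith [le_abs_self Λ]
  have hev : δ =ᶠ[𝓝 z₀] fun _ => 0 := by
    filter_upwards [(isOpen_depth θ Λ').mem_nhds h1] with w hw using h w hw
  exact han.eqOn_of_preconnected_of_eventuallyEq (analyticOnNhd_const) hconv.isPreconnected h2 hev hz

theorem polyDeriv_sub (S : Polynomial ℂ) (hf : ∀ n : ℕ, ContDiffAt ℂ n f z)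
    (hg : ∀ n : ℕ, ContDiffAt ℂ n g z) :
    polyDeriv S (fun w => f w - g w) z = polyDeriv S f z - polyDeriv S g z := by
  simp only [polyDeriv, Polynomial.sum, iteratedDeriv_fun_sub (hf _) (hg _), mul_sub,
    Finset.sum_sub_distrib]

theorem levelOneOp_sub (hf : ∀ n : ℕ, ContDiffAt ℂ n f z) (hg : ∀ n : ℕ, ContDiffAt ℂ n g z) :
    levelOneOp P Q R (fun w => f w - g w) z = levelOneOp P Q R f z - levelOneOp P Q R g z := by
  simp only [levelOneOp, polyDeriv_sub _ hf hg]
  ring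

/-- Two solutions in the affine space on the frequency domain agree, provided that the homogeneous
equation has uniqueness on the half-planes of direction `θ`. -/
theorem eq_of_mem_frequencyAffine (hω : 0 < ω) (hωπ : ω ≤ Real.pi) (hτ : 0 < τ.re)
    (huniq : ∀ (δ : ℂ → ℂ) (Λ₀ C₀ : ℝ), 0 ≤ Λ₀ → DifferentiableOn ℂ δ {z | Λ₀ < depth θ z} →
      (∀ z, Λ₀ < depth θ z →
        ‖Complex.exp (α * z) * δ z‖ ≤ C₀ * (depth θ z - Λ₀) ^ (-τ.re - 1)) →
      (∀ z, Λ₀ < depth θ z → levelOneOp P Q R δ z = 0) →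
      ∃ Λ, ∀ z, Λ < depth θ z → δ z = 0)
    {G₁ G₂ : DualGerm θ ω} (h₁ : G₁ ∈ frequencyAffine τ α θ ω) (h₁' : SolvesODE P Q R G₁)
    (h₂ : G₂ ∈ frequencyAffine τ α θ ω) (h₂' : SolvesODE P Q R G₂) : G₁ = G₂ := by
  have key : ∀ G : DualGerm θ ω, G ∈ frequencyAffine τ α θ ω → SolvesODE P Q R G →
      ∃ (F Φ : ℂ → ℂ) (Λ₀ C₀ : ℝ), G = (F : DualGerm θ ω) ∧ 0 ≤ Λ₀ ∧
        DifferentiableOn ℂ F (dualDomain θ ω Λ₀) ∧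
        (∀ z ∈ dualDomain θ ω Λ₀, levelOneOp P Q R F z = 0) ∧
        (∀ z ∈ dualDomain θ ω Λ₀, F z = Complex.exp (-(α * z)) * (branchPow (-θ) (-τ) z + Φ z)) ∧
        ∀ Λ, Λ₀ ≤ Λ → ∀ z, Λ < depth θ z → ‖Φ z‖ ≤ |C₀| * (depth θ z - Λ) ^ (-τ.re - 1) := by
    rintro _ ⟨_, ⟨Λ₁, hΛ₁, Φ, ⟨hd, C, hC⟩, rfl⟩, rfl⟩ ⟨F, hF, hODE⟩
    obtain ⟨Λ₂, h₂⟩ := eventually_dualFilter_iff.1 hODE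
    have hF' : (fun z => Complex.exp (-(α * z)) * (branchPow (-θ) (-τ) z + Φ z))
        =ᶠ[dualFilter θ ω] F := Germ.coe_eq.1 hF
    obtain ⟨Λ₃, h₃⟩ := eventually_dualFilter_iff.1 hF'
    set Λ₀ := max Λ₁ (max Λ₂ Λ₃) with hΛ₀
    have l1 : Λ₁ ≤ Λ₀ := le_max_left _ _
    have l2 : Λ₂ ≤ Λ₀ := (le_max_left _ _).trans (le_max_right _ _)
    have l3 : Λ₃ ≤ Λ₀ := (le_max_right _ _).trans (le_max_right _ _)
    have hFeq : ∀ z ∈ dualDomain θ ω Λ₀,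
        F z = Complex.exp (-(α * z)) * (branchPow (-θ) (-τ) z + Φ z) :=
      fun z hz => (h₃ z (dualDomain_anti l3 hz)).symm
    refine ⟨F, Φ, Λ₀, C, hF, by linarith, ?_, fun z hz => h₂ z (dualDomain_anti l2 hz), hFeq, ?_⟩
    · refine DifferentiableOn.congr (DifferentiableOn.mul (by fun_prop) ?_) hFeq
      exact (differentiableOn_branchPow_dualDomain hωπ (by linarith) _).add
        (hd.mono (dualDomain_anti l1))
    · intro Λ hΛ z hz
      have hθ : θ ∈ Ioo (θ - ω / 2) (θ + ω / 2) := ⟨by linarith, by linarith⟩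
      have hz1 : Λ₁ < depth θ z := by linarith
      have hΔ : depth θ z - Λ₁ ≤ Metric.infDist z (frontier (dualDomain θ ω Λ₁)) :=
        sub_le_infDist_frontier hΛ₁.le hθ hz1
      refine (hC z ⟨θ, hθ, hz1⟩).trans ?_
      refine mul_le_mul (le_abs_self C) ?_ (Real.rpow_nonneg Metric.infDist_nonneg _) (abs_nonneg C)
      exact Real.rpow_le_rpow_of_nonpos (by linarith) (by linarith) (by linarith)
  obtain ⟨F₁, Φ₁, Λ₁, C₁, rfl, hΛ₁, hd₁, hO₁, hF₁, hb₁⟩ := key G₁ h₁ h₁'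
  obtain ⟨F₂, Φ₂, Λ₂, C₂, rfl, hΛ₂, hd₂, hO₂, hF₂, hb₂⟩ := key G₂ h₂ h₂'
  set Λ₀ := max Λ₁ Λ₂
  have hθ : θ ∈ Ioo (θ - ω / 2) (θ + ω / 2) := ⟨by linarith, by linarith⟩
  have s1 := dualDomain_anti (θ := θ) (ω := ω) (le_max_left Λ₁ Λ₂)
  have s2 := dualDomain_anti (θ := θ) (ω := ω) (le_max_right Λ₁ Λ₂)
  have hmem : ∀ z, Λ₀ < depth θ z → z ∈ dualDomain θ ω Λ₀ := fun z hz => ⟨θ, hθ, hz⟩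
  have hdiff : DifferentiableOn ℂ (fun z => F₁ z - F₂ z) (dualDomain θ ω Λ₀) :=
    (hd₁.mono s1).sub (hd₂.mono s2)
  have hcd : ∀ {F : ℂ → ℂ}, DifferentiableOn ℂ F (dualDomain θ ω Λ₀) →
      ∀ z ∈ dualDomain θ ω Λ₀, ∀ n : ℕ, ContDiffAt ℂ n F z := fun hF z hz n =>
    (hF.analyticAt ((isOpen_dualDomain θ ω Λ₀).mem_nhds hz)).contDiffAt
  obtain ⟨Λ, hΛ⟩ := huniq (fun z => F₁ z - F₂ z) Λ₀ (|C₁| + |C₂|) (hΛ₁.trans (le_max_left _ _))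
    (hdiff.mono fun z hz => hmem z hz)
    (fun z hz => by
      have e : Complex.exp (α * z) * (F₁ z - F₂ z) = Φ₁ z - Φ₂ z := by
        have hexp : Complex.exp (α * z) * Complex.exp (-(α * z)) = 1 := by
          rw [← Complex.exp_add]; simp
        rw [hF₁ z (s1 (hmem z hz)), hF₂ z (s2 (hmem z hz))]
        linear_combination (Φ₁ z - Φ₂ z) * hexp
      rw [e, add_mul]
      exact (norm_sub_le _ _).trans (add_le_add (hb₁ Λ₀ (le_max_left _ _) z hz)
        (hb₂ Λ₀ (le_max_right _ _) z hz)))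
    (fun z hz => by
      have hz' := hmem z hz
      rw [levelOneOp_sub (hcd (hd₁.mono s1) z hz') (hcd (hd₂.mono s2) z hz'), hO₁ z (s1 hz'),
        hO₂ z (s2 hz'), sub_zero])
  refine Germ.coe_eq.2 (eventually_dualFilter_iff.2 ⟨Λ₀, fun z hz => ?_⟩)
  exact sub_eq_zero.1 (eq_zero_of_eq_zero_depth (δ := fun z => F₁ z - F₂ z) hωπ hdiff hΛ hz)

end frequency

/-- The products of `ψ` with all polynomials admit a common exponential type, so that a single `Λ`
serves for all derivatives of the Laplace transform. -/
theorem InPositionAffine.exists_singExpWith_eval_mul {τ α : ℂ} {θ ω : ℝ} {ψ : ℂ → ℂ}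
    (hωπ : ω ≤ Real.pi) (h : InPositionAffine τ α θ ω ψ) :
    ∃ Λ₀ : ℝ, ∀ Λ, Λ₀ ≤ Λ → ∀ S : Polynomial ℂ, ∃ M : ℝ, 0 ≤ M ∧
      SingExpWith (τ.re - 1) Λ M α (sector α θ ω) (fun ζ => S.eval (-ζ) * ψ ζ) := by
  obtain ⟨Λ₁, M, _, hM, h₁⟩ := (h.isSingExp hωπ).exists_singExpWith
  refine ⟨Λ₁ + 1, fun Λ hΛ S => ?_⟩
  obtain ⟨K, hK, h'⟩ := (h₁ (Λ - 1) (by linarith)).eval_neg_mul hM S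
  exact ⟨K, hK, by simpa using h'⟩

end LevelOne

open LevelOne in
theorem theorem1p5 (P Q : Polynomial ℂ) (R : ℂ → ℂ) (A : ℝ)
    (hPmonic : P.Monic) (hPsimple : P.roots.Nodup)
    (hQdeg : Q.natDegree + 1 = P.natDegree)
    (hQroots : ∀ x : ℂ, P.IsRoot x → Q.eval x ≠ 0)
    (hA : 0 < A) (hR : DifferentiableOn ℂ R (Metric.ball 0 A⁻¹))
    (α : ℂ) (hα : P.IsRoot (-α))
    (hτ : 0 < (LevelOne.charExponent P Q α).re)
    (θ ω : ℝ) (hω : 0 < ω) (hωπ : ω ≤ Real.pi)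
    (hsector : ∀ β : ℂ, P.IsRoot (-β) → β ≠ α → β ∉ closure (LevelOne.sector α θ ω)) :
    LevelOne.frequencyAffine (LevelOne.charExponent P Q α) α θ ω ⊆
        LevelOne.expDualSpace (-(LevelOne.charExponent P Q α).re) α θ ω ∧
      (∃! G : LevelOne.DualGerm θ ω,
        G ∈ LevelOne.frequencyAffine (LevelOne.charExponent P Q α) α θ ω ∧
          LevelOne.SolvesODE P Q R G) ∧
      ∃ ψ : ℂ → ℂ,
        (LevelOne.InPositionAffine (LevelOne.charExponent P Q α) α θ ω ψ ∧
          LevelOne.SolvesVolterra P Q R α (LevelOne.sector α θ ω) ψ) ∧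
        (∀ φ : ℂ → ℂ, LevelOne.InPositionAffine (LevelOne.charExponent P Q α) α θ ω φ →
          LevelOne.SolvesVolterra P Q R α (LevelOne.sector α θ ω) φ →
            EqOn φ ψ (LevelOne.sector α θ ω)) ∧
        ∃ Ψ : ℂ → ℂ, LevelOne.IsLaplaceTransform α θ ω ψ Ψ ∧
          (Ψ : LevelOne.DualGerm θ ω) ∈
            LevelOne.frequencyAffine (LevelOne.charExponent P Q α) α θ ω ∧
          LevelOne.SolvesODE P Q R (Ψ : LevelOne.DualGerm θ ω) := by
  obtain ⟨s, S, hP, hQ, hS, -, hs⟩ := exists_factorization hPmonic hPsimple hQdeg hα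
  set τ := charExponent P Q α
  have hscl : ∀ β ∈ s, β ∉ closure (sector α θ ω) := fun β hβ =>
    hsector β (hs β hβ).1 (hs β hβ).2
  obtain ⟨K, T, hF, hT, hTK⟩ := exists_sectorFactorization s hP hQ hS hscl
  obtain ⟨C, hc⟩ := exists_norm_taylorCoeff_le hA hR
  have hB : 0 < 2 * A := by linarith
  obtain ⟨ψ, hψ, hψV⟩ := exists_solvesVolterra hω hωπ hτ hF hB hc hT hTK
  obtain ⟨Λ₁, h₁⟩ := hψ.exists_singExpWith_eval_mul hωπ
  obtain ⟨Λ₂, h₂⟩ := sectorLaplace_mem_frequencyAffine hω hωπ hτ hψ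
  -- `2 * (2 * A)` makes the transformed series of iterated integrals converge geometrically.
  set Λ := max (2 * (2 * A)) (max Λ₁ Λ₂)
  have l0 : 2 * (2 * A) ≤ Λ := le_max_left _ _
  have l1 : Λ₁ ≤ Λ := (le_max_left _ _).trans (le_max_right _ _)
  have l2 : Λ₂ ≤ Λ := (le_max_right _ _).trans (le_max_right _ _)
  have hσ : -1 < τ.re - 1 := by linarith
  have hpoly := h₁ Λ l1
  obtain ⟨M, hM, hψΛ⟩ := hpoly 1
  simp only [Polynomial.eval_one, one_mul] at hψΛ
  obtain ⟨M', hM', hψΛ'⟩ := hpoly Polynomial.X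
  simp only [Polynomial.eval_X] at hψΛ'
  set Ψ := sectorLaplace α θ ω Λ ψ with hΨ
  have hΨmem : (Ψ : DualGerm θ ω) ∈ frequencyAffine τ α θ ω :=
    h₂ Λ l2 (differentiableOn_sectorLaplace hω hωπ hσ (by linarith) hM hψΛ hM' hψΛ')
  have hΨODE : SolvesODE P Q R (Ψ : DualGerm θ ω) :=
    ⟨Ψ, rfl, eventually_dualFilter_iff.2 ⟨Λ, fun z hz =>
      levelOneOp_sectorLaplace hω hωπ hσ hB hc l0 hM hψΛ hpoly hψV hA (by linarith) hR hz⟩⟩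
  refine ⟨frequencyAffine_subset hωπ hτ, ⟨Ψ, ⟨hΨmem, hΨODE⟩, fun G hG => ?_⟩, ψ, ⟨hψ, hψV⟩,
    fun φ hφ hφV => eqOn_of_solvesVolterra hω hωπ hτ hF hB hc hψ hψV hφ hφV, Ψ, ⟨Λ, ?_⟩,
    hΨmem, hΨODE⟩
  -- The closed disk of radius `(2 * A)⁻¹` is compact in the domain of `R`, so `R` is bounded on it.
  · obtain ⟨C_R, hC_R⟩ := (isCompact_closedBall (0 : ℂ) (2 * A)⁻¹).exists_bound_of_continuousOn
      (hR.continuousOn.mono (Metric.closedBall_subset_ball (inv_strictAnti₀ hA (by linarith))))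
    have hR' : ∀ w, ‖w‖ ≤ (2 * A)⁻¹ → ‖R w‖ ≤ C_R := fun w hw =>
      hC_R w (mem_closedBall_zero_iff.2 hw)
    have hC_R0 : 0 ≤ C_R := (norm_nonneg (R 0)).trans (hR' 0 (by rw [norm_zero]; positivity))
    refine eq_of_mem_frequencyAffine hω hωπ hτ (fun δ Λ₀ C₀ hΛ₀ hδ hb hO => ?_)
      hG.1 hG.2 hΨmem hΨODE
    rw [hP, hQ] at hO
    exact exists_eq_zero_of_levelOneOp s hS (fun β hβ => exists_direction hω (hs β hβ).2
      fun h => hscl β hβ (subset_closure h)) hC_R0 hB hR' hτ.le hΛ₀ hδ hb hO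
  · intro η hη z hz
    exact ⟨integrableOn_laplaceIntegrand hη hσ hψΛ hz,
      sectorLaplace_eq hω hωπ hσ (by linarith) hM hψΛ hη hz⟩
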